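/- Let $\mathbb F$ be a field of characteristic $p>3$ and let $m>3$ be an integer. Let $\mathcal O=\mathcal O(m,m;\underline 1)$ be the tensor product of the divided power algebra with basis $\{x^{(\alpha)} : \alpha\in\mathbb N_0^m,\ 0\le\alpha_i\le p-1\}$ and multiplication $x^{(\alpha)}x^{(\beta)}=\prod_i\binom{\alpha_i+\beta_i}{\alpha_i}\,x^{(\alpha+\beta)}$ (read as $0$ if some $\alpha_i+\beta_i\ge p$), and the exterior algebra over $\mathbb F$ in $x_{m+1},\dots,x_{2m}$. It is a superalgebra ($x^{(\alpha)}$ even, $x_{m+1},\dots,x_{2m}$ odd), and it is $\mathbb Z$-graded by $\deg\big(x^{(\alpha)}x_{i_1}\cdots x_{i_k}\big)=|\alpha|+k$ for $m<i_1<\dots<i_k\le 2m$. Let $Y=\{1,\dots,2m\}$. For $r\le m$ let $\partial_r$ be the even superderivation of $\mathcal O$ with $\partial_r(x^{(\alpha)}x_{i_1}\cdots x_{i_k})=x^{(\alpha-\varepsilon_r)}x_{i_1}\cdots x_{i_k}$ ($0$ if $\alpha_r=0$), and for $r>m$ let $\partial_r$ be the odd superderivation given by the left partial derivative with respect to $x_r$.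 Let $W=\bigoplus_{r\in Y}\mathcal O\,\partial_r$, a Lie superalgebra of operators on $\mathcal O$ under the supercommutator, $\mathbb Z$-graded by $W_i=\mathrm{span}\{f\partial_r : r\in Y,\ f\in\mathcal O_{i+1}\}$. Write $\mathrm p$ for parity, $i'=i+m$ for $i\le m$ and $i'=i-m$ for $i>m$. Let $\mathrm{T_H}:\mathcal O\to W$ and $\mathrm{div}:W\to\mathcal O$ be the linear maps with $$\mathrm{T_H}(a)=\sum_{i\in Y}(-1)^{\mathrm p(\partial_i)\mathrm p(a)}\partial_i(a)\,\partial_{i'},\qquad \mathrm{div}(f\partial_r)=(-1)^{\mathrm p(\partial_r)\mathrm p(f)}\partial_r(f)$$ for $\mathbb Z_2$-homogeneous $a$, $f$, and put $$\mathfrak g=\{D\in W : \mathrm{div}(D)=0\}\cap \mathrm{T_H}(\mathcal O),\qquad \mathfrak g^{(1)}=[\mathfrak g,\mathfrak g],\qquad X=\mathfrak g^{(2)}=[\mathfrak g^{(1)},\mathfrak g^{(1)}],$$ where $[A,A]$ denotes the linear span of all brackets of elements of $A$. Let $\mathrm{Der}X=\mathrm{Der}_{\bar 0}X\oplus\mathrm{Der}_{\bar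 1}X$, where $\mathrm{Der}_{\theta}X$ is the space of linear maps $\varphi:X\to X$ of parity $\theta$ with $\varphi[D,E]=[\varphi D,E]+(-1)^{\theta\,\mathrm p(D)}[D,\varphi E]$ for all $\mathbb Z_2$-homogeneous $D\in X$ and all $E\in X$. For $i\in\mathbb Z$ let $\mathrm{Der}_iX=\{\varphi\in\mathrm{Der}X : \varphi(X\cap W_t)\subseteq X\cap W_{t+i}\text{ for all }t\in\mathbb Z\}$, and let $\mathrm{Der}^-X$ be the linear span of $\bigcup_{i<0}\mathrm{Der}_iX$. Then $X$ is closed under the bracket, $\partial_i\in X$ for every $i\in Y$, and $$\mathrm{Der}^-X=\mathrm{span}_{\mathbb F}\{\mathrm{ad}\,\partial_i : i\in Y\}.$$ -/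

import Mathlib

open Module

noncomputable section

namespace SHOAlg

/-! ### The superalgebra `𝒪(m,m;1)` -/

/-- Labels of the standard basis `x^(α) x^u` of `𝒪(m,m;1)`: a multi-index `α` with
`0 ≤ α i ≤ p - 1`, and a subset `u` of the `m` odd variables; `j ∈ u` stands for the odd
variable `x_{m+j}`, and `x^u` is the product of the odd variables in increasing order. -/
abbrev Idx (p m : ℕ) : Type := (Fin m → Fin p) × Finset (Fin m)

/-- The underlying vector space of `𝒪(m,m;1) = 𝒪(m;1) ⊗ Λ(m)`, the tensor product of the
divided power algebra with truncation exponent `1` in each variable and the exterior algebra.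
Its multiplication is `mulO` (no pointwise product is ever used). -/
abbrev O (F : Type*) [Field F] (p m : ℕ) : Type _ := Idx p m →₀ F

/-- The index set `Y = Y₀ ∪ Y₁ = {1, …, 2m}`; `inl i` is `i ∈ Y₀` and `inr i` is `m + i ∈ Y₁`. -/
abbrev Y (m : ℕ) : Type := Fin m ⊕ Fin m

/-- `μ(i)`, the parity of `∂_i` (and of the variable `x_i`), as a number `0` or `1`. -/
def mu {m : ℕ} : Y m → ℕ := Sum.elim (fun _ => 0) (fun _ => 1)

variable (F : Type*) [Field F] (p m : ℕ)

/-- The element `x^(α) x^u`, with the convention that it is zero if some `α i` exceeds `p - 1`. -/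
def mono (α : Fin m → ℕ) (u : Finset (Fin m)) : O F p m :=
  if h : ∀ i, α i < p then Finsupp.single (fun i => ⟨α i, h i⟩, u) 1 else 0

/-- The sign in `x^u x^v = ± x^(u ∪ v)` for disjoint `u`, `v`: the parity of the number of
inversions. -/
def mulSign (u v : Finset (Fin m)) : F :=
  (-1) ^ ((u ×ˢ v).filter fun q => q.2 < q.1).card

/-- The product of two standard basis elements: `(x^(α) x^u)(x^(β) x^v)` is
`∏ᵢ (αᵢ + βᵢ choose αᵢ) x^(α + β) (x^u x^v)`, and `x^u x^v = 0` if `u`, `v` meet. -/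
def mulMono (a b : Idx p m) : O F p m :=
  if Disjoint a.2 b.2 then
    ((∏ i, ((a.1 i + b.1 i : ℕ).choose (a.1 i) : F)) * mulSign F m a.2 b.2) •
      mono F p m (fun i => (a.1 i : ℕ) + b.1 i) (a.2 ∪ b.2)
  else 0

/-- The multiplication of `𝒪(m,m;1)`, as a bilinear map. -/
def mulO : O F p m →ₗ[F] O F p m →ₗ[F] O F p m :=
  Finsupp.linearCombination F fun a => Finsupp.linearCombination F fun b => mulMono F p m a b

/-- The superderivations `∂_r`, `r ∈ Y`: for even `r`, `∂_r (x^(α) x^u) = x^(α - ε_r) x^u` (zero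
if `α_r = 0`); for odd `r`, the left partial derivative of `x^u` with respect to `x_r`. -/
def pd : Y m → End F (O F p m)
  | Sum.inl r => Finsupp.linearCombination F fun a : Idx p m =>
      if (a.1 r : ℕ) = 0 then 0
      else mono F p m (fun i => if i = r then (a.1 i : ℕ) - 1 else a.1 i) a.2
  | Sum.inr r => Finsupp.linearCombination F fun a : Idx p m =>
      if r ∈ a.2 then
        ((-1 : F) ^ (a.2.filter fun k => k < r).card) • Finsupp.single (a.1, a.2.erase r) 1
      else 0

/-- The `ℤ/2`-grading of `𝒪(m,m;1)`: the span of the `x^(α) x^u` with `|u| ≡ θ` mod 2. -/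
def oPar (θ : ZMod 2) : Submodule F (O F p m) :=
  Submodule.span F
    {f | ∃ a : Idx p m, (a.2.card : ZMod 2) = θ ∧ f = Finsupp.single a 1}

/-- The projection of `𝒪(m,m;1)` onto its part of parity `θ`. -/
def oProj (θ : ZMod 2) : End F (O F p m) :=
  Finsupp.linearCombination F fun a : Idx p m =>
    if (a.2.card : ZMod 2) = θ then Finsupp.single a 1 else 0

/-- The linear map `f ↦ (-1)^{p(f)} f`. -/
def parInv : End F (O F p m) :=
  Finsupp.linearCombination F fun a : Idx p m => ((-1 : F) ^ a.2.card) • Finsupp.single a 1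

/-- The standard `ℤ`-grading of `𝒪(m,m;1)`: the span of the `x^(α) x^u` with `|α| + |u| = r`. -/
def oDeg (r : ℤ) : Submodule F (O F p m) :=
  Submodule.span F
    {f | ∃ a : Idx p m, (((∑ i, (a.1 i : ℕ)) + a.2.card : ℕ) : ℤ) = r ∧ f = Finsupp.single a 1}

/-! ### Linear operators on `𝒪(m,m;1)` as a Lie superalgebra -/

/-- The sign `(-1)^{ab}`. -/
def sgn (a b : ZMod 2) : F := if a = 1 ∧ b = 1 then -1 else 1

/-- The operators on `𝒪(m,m;1)` that are homogeneous of parity `θ`. -/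
def endPar (θ : ZMod 2) : Submodule F (End F (O F p m)) where
  carrier := {D | ∀ a, ∀ f ∈ oPar F p m a, D f ∈ oPar F p m (a + θ)}
  add_mem' hD hE a f hf := Submodule.add_mem _ (hD a f hf) (hE a f hf)
  zero_mem' _ _ _ := Submodule.zero_mem _
  smul_mem' c _ hD _ f hf := Submodule.smul_mem _ c (hD _ f hf)

/-- The component of parity `θ` of an operator. -/
def comp (θ : ZMod 2) (D : End F (O F p m)) : End F (O F p m) :=
  ∑ b : ZMod 2, oProj F p m (b + θ) * D * oProj F p m b

/-- The supercommutator, the bilinear map with `[D, E] = D E - (-1)^{p(D) p(E)} E D` for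
homogeneous operators `D`, `E` (see `superBracket_apply`). -/
def superBracket : End F (O F p m) →ₗ[F] End F (O F p m) →ₗ[F] End F (O F p m) :=
  LinearMap.mk₂ F
    (fun D E => D * E - ∑ a : ZMod 2, ∑ b : ZMod 2,
      sgn F a b • (comp F p m b E * comp F p m a D))
    (fun D D' E => by
      simp only [comp, mul_add, add_mul, Finset.sum_add_distrib, smul_add]; abel)
    (fun c D E => by
      simp only [comp, mul_smul_comm, smul_mul_assoc, ← Finset.smul_sum, smul_comm _ c]
      exact LinearMap.ext fun f => (smul_sub c _ _).symm)
    (fun D E E' => by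
      simp only [comp, mul_add, add_mul, Finset.sum_add_distrib, smul_add]; abel)
    (fun c D E => by
      simp only [comp, mul_smul_comm, smul_mul_assoc, ← Finset.smul_sum, smul_comm _ c]
      exact LinearMap.ext fun f => (smul_sub c _ _).symm)

/-- A subspace of operators that is closed under the supercommutator. -/
def IsSubalg (X : Submodule F (End F (O F p m))) : Prop :=
  ∀ D ∈ X, ∀ E ∈ X, superBracket F p m D E ∈ X

/-- The derived algebra `[X, X]`, the span of all `[D, E]` with `D, E ∈ X`. -/
def derived (X : Submodule F (End F (O F p m))) : Submodule F (End F (O F p m)) :=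
  Submodule.map₂ (superBracket F p m) X X

/-! ### The algebras `HO`, `S'` and `SHO` -/

/-- The operator `∑_r f_r ∂_r`, as a linear function of its coefficients. The range of this map is
the generalized Witt superalgebra `W(m,m;1)`, and the coefficients are determined by the operator
(`f_r` is its value at `x_r`). -/
def vf : (Y m → O F p m) →ₗ[F] End F (O F p m) :=
  ∑ r : Y m, (LinearMap.mulRight F (pd F p m r)) ∘ₗ mulO F p m ∘ₗ LinearMap.proj r

/-- The component `W(m,m;1)_i`, spanned by the `f ∂_r` with `f` of degree `i + 1`. -/
def wDeg (i : ℤ) : Submodule F (End F (O F p m)) :=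
  Submodule.span F
    {D | ∃ r : Y m, ∃ f ∈ oDeg F p m (i + 1), D = vf F p m (Pi.single r f)}

/-- The divergence of `∑_r f_r ∂_r`, in terms of the coefficients:
`∑_r (-1)^{p(∂_r) p(f_r)} ∂_r(f_r)`. -/
def div : (Y m → O F p m) →ₗ[F] O F p m :=
  ∑ r : Y m, (pd F p m r ∘ₗ (parInv F p m ^ mu r)) ∘ₗ LinearMap.proj r

/-- `S'(m,m;1)`: the elements of `W(m,m;1)` of divergence zero. -/
def S' : Submodule F (End F (O F p m)) := (LinearMap.ker (div F p m)).map (vf F p m)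

/-- `T_H(a) = ∑_{i ∈ Y} (-1)^{p(∂_i) p(a)} ∂_i(a) ∂_{i'}`, where `i ↦ i'` exchanges `i` and
`m + i`. -/
def TH : O F p m →ₗ[F] End F (O F p m) :=
  ∑ i : Y m, vf F p m ∘ₗ LinearMap.single F (fun _ : Y m => O F p m) i.swap ∘ₗ
    (pd F p m i ∘ₗ (parInv F p m ^ mu i))

/-- The odd Hamiltonian superalgebra `HO(m,m;1) = {T_H(a)}`. -/
def HO : Submodule F (End F (O F p m)) := LinearMap.range (TH F p m)

/-- The special odd Hamiltonian superalgebra `SHO(m,m;1) = S'(m,m;1) ∩ HO(m,m;1)`. -/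
def SHO : Submodule F (End F (O F p m)) := S' F p m ⊓ HO F p m

/-- The second derived algebra `SHO(m,m;1)^(2)`. -/
def SHO2 : Submodule F (End F (O F p m)) := derived F p m (derived F p m (SHO F p m))

/-! ### Superderivations of a Lie superalgebra of operators -/

variable {F p m}

/-- `ad D` on `X`, for `D ∈ X`; thus `adOn hX D E` is the bracket `[D, E]` in `X`. -/
def adOn {X : Submodule F (End F (O F p m))} (hX : IsSubalg F p m X) (D : X) : X →ₗ[F] X :=
  (superBracket F p m D.1).restrict (hX D.1 D.2)

/-- The superderivations of `X` of parity `θ`: the linear maps `φ : X → X` of parity `θ` with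
`φ [D, E] = [φ D, E] + (-1)^{θ p(D)} [D, φ E]`. -/
def derPar {X : Submodule F (End F (O F p m))} (hX : IsSubalg F p m X) (θ : ZMod 2) :
    Submodule F (X →ₗ[F] X) where
  carrier := {φ |
    (∀ a, ∀ D : X, D.1 ∈ endPar F p m a → (φ D).1 ∈ endPar F p m (a + θ)) ∧
    ∀ a, ∀ D E : X, D.1 ∈ endPar F p m a →
      φ (adOn hX D E) = adOn hX (φ D) E + sgn F θ a • adOn hX D (φ E)}
  add_mem' := by
    rintro φ ψ ⟨h1, h2⟩ ⟨k1, k2⟩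
    refine ⟨fun a D hD => Submodule.add_mem _ (h1 a D hD) (k1 a D hD), fun a D E hD => ?_⟩
    have e : adOn hX (φ D + ψ D) E = adOn hX (φ D) E + adOn hX (ψ D) E := by
      apply Subtype.ext; simp [adOn, LinearMap.restrict_apply]
    simp only [LinearMap.add_apply, h2 a D E hD, k2 a D E hD, e, map_add, smul_add]
    abel
  zero_mem' := by
    refine ⟨fun a D _ => Submodule.zero_mem _, fun a D E _ => ?_⟩
    have e : adOn hX 0 E = 0 := by
      apply Subtype.ext; simp [adOn, LinearMap.restrict_apply]
    simp [e]
  smul_mem' := by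
    rintro c φ ⟨h1, h2⟩
    refine ⟨fun a D hD => Submodule.smul_mem _ c (h1 a D hD), fun a D E hD => ?_⟩
    have e : adOn hX (c • φ D) E = c • adOn hX (φ D) E := by
      apply Subtype.ext; simp [adOn, LinearMap.restrict_apply]
    simp only [LinearMap.smul_apply, h2 a D E hD, e, map_smul, smul_add, smul_comm _ c]

/-- The derivation algebra `Der X = Der_0̄ X ⊕ Der_1̄ X`. -/
def der {X : Submodule F (End F (O F p m))} (hX : IsSubalg F p m X) : Submodule F (X →ₗ[F] X) :=
  derPar hX 0 ⊔ derPar hX 1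

/-- `Der_i X = {φ ∈ Der X | φ(X_t) ⊆ X_{t+i} for all t}`, where `X_t = X ∩ W_t`. -/
def derDeg {X : Submodule F (End F (O F p m))} (hX : IsSubalg F p m X) (i : ℤ) :
    Submodule F (X →ₗ[F] X) where
  carrier := {φ | φ ∈ der hX ∧
    ∀ t : ℤ, ∀ D : X, D.1 ∈ wDeg F p m t → (φ D).1 ∈ wDeg F p m (t + i)}
  add_mem' h k := ⟨Submodule.add_mem _ h.1 k.1,
    fun t D hD => Submodule.add_mem _ (h.2 t D hD) (k.2 t D hD)⟩
  zero_mem' := ⟨Submodule.zero_mem _, fun _ _ _ => Submodule.zero_mem _⟩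
  smul_mem' c _ h := ⟨Submodule.smul_mem _ c h.1,
    fun t D hD => Submodule.smul_mem _ c (h.2 t D hD)⟩

/-- `Der⁻ X`, the span of the `Der_i X` with `i < 0`. -/
def negDer {X : Submodule F (End F (O F p m))} (hX : IsSubalg F p m X) :
    Submodule F (X →ₗ[F] X) :=
  Submodule.span F {φ | ∃ i : ℤ, i < 0 ∧ φ ∈ derDeg hX i}

/-! ### The supercommutator on homogeneous operators -/

theorem oProj_of_mem {a : ZMod 2} {f : O F p m} (hf : f ∈ oPar F p m a) (b : ZMod 2) :
    oProj F p m b f = if a = b then f else 0 := by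
  induction hf using Submodule.span_induction with
  | mem x hx =>
    obtain ⟨c, hc, rfl⟩ := hx
    simp [oProj, hc]
  | zero => simp
  | add x y _ _ hx hy => rw [map_add, hx, hy]; split_ifs <;> simp
  | smul c x _ hx => rw [map_smul, hx]; split_ifs <;> simp

theorem comp_of_mem {a : ZMod 2} {D : End F (O F p m)} (hD : D ∈ endPar F p m a) (b : ZMod 2) :
    comp F p m b D = if a = b then D else 0 := by
  refine Finsupp.lhom_ext' fun c => LinearMap.ext_ring ?_
  have hc : Finsupp.single c (1 : F) ∈ oPar F p m (c.2.card : ZMod 2) :=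
    Submodule.subset_span ⟨c, rfl, rfl⟩
  have h1 : ∀ b' : ZMod 2, (oProj F p m (b' + b) * D * oProj F p m b') (Finsupp.single c 1)
      = if (c.2.card : ZMod 2) = b' then (if a = b then D (Finsupp.single c 1) else 0) else 0 := by
    intro b'
    simp only [Module.End.mul_apply, oProj_of_mem hc]
    split_ifs with h h'
    · rw [oProj_of_mem (hD _ _ hc), if_pos (by rw [h, h'])]
    · rw [oProj_of_mem (hD _ _ hc), if_neg (by rw [h]; simpa using h')]
    · simp
  simp only [LinearMap.comp_apply, Finsupp.lsingle_apply, comp, LinearMap.sum_apply, h1]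
  rw [Finset.sum_ite_eq]
  split_ifs <;> simp_all

/-- On homogeneous operators, the bracket is the usual supercommutator. -/
theorem superBracket_apply {a b : ZMod 2} {D E : End F (O F p m)}
    (hD : D ∈ endPar F p m a) (hE : E ∈ endPar F p m b) :
    superBracket F p m D E = D * E - sgn F a b • (E * D) := by
  simp only [superBracket, LinearMap.mk₂_apply, comp_of_mem hD, comp_of_mem hE]
  congr 1
  rw [Finset.sum_eq_single a, Finset.sum_eq_single b]
  · simp
  · intro c _ hc; simp [hc.symm]
  · simp
  · intro c _ hc; simp [hc.symm]
  · simp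

end SHOAlg

end

/-!
# Negative superderivations of the special odd Hamiltonian superalgebra

Write `Δ = ∑ ∂_i ∂_{i'}` (sum over the even `i`). Everything is expressed through Hamiltonian
functions: `[T_H(a), T_H(b)] = T_H(T_H(a)(b))` (`superBracket_TH`), and `T_H(a)` has divergence
`±2 Δ(a)`, so `SHO` consists of the `T_H(a)` with `Δ(a) = 0` (`mem_SHO_iff`). As `Δ` has order two
and square zero, `T_H(a)(b) = Δ(σ(a) b)` for `a`, `b` in the kernel of `Δ` (`TH_eq_lap`), where `σ`
is the parity automorphism. Hence `X = SHO^(2)` lies in `T_H(im Δ)` (`SHO2_le`).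

Conversely, call a monomial *clean* if it contains no variable together with its conjugate, and if
it has a nonzero product with some `x_l x_{l'}`, `l ≤ m`. Distributing the factors of the monomial
and the two variables suitably, every clean monomial is the bracket of two clean monomials, and so
lies in `X` (`TH_mono_mem_SHO2`). This covers the variables, that is, the `∂_r`.
The image of `Δ` is generated by clean monomials, except for `Δ` of the monomial of highest degree
(`lap_mono_mem`).

Let `φ` be a superderivation of `X` of parity `θ` and degree `-t < 0`; the even and the odd part of
an element of `Der_{-t} X` are of this kind (`isHomDer_of_add`). It kills all functions of degree at
most `t`, in particular the variables, so it commutes with the `ad ∂_r` up to sign. By transitivity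
it vanishes as soon as it vanishes on the functions of degree `t + 1`
(`IsHomDer.mem_kerFun_of_pd`), which it maps to functions of degree `1`.

Suppose that `φ` kills the torus spanned by the `x_i x_{i'} - x_j x_{j'}`. Then it preserves
weights, so it kills every function of degree `t + 1` whose weight is *exceptional*, that is,
not the weight of any variable (`IsHomDer.mem_kerFun_of_exceptional`). For `t = 1` all clean quadratic
monomials have exceptional weight; for `t = 2` a clean cubic monomial is the bracket of a quadratic
monomial and of a cubic one of exceptional weight; for `t ≥ 3` a clean monomial of degree `t + 1` is
the bracket of two of smaller degree. The element of highest degree has zero weight, which is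
exceptional. So `φ = 0` (`IsHomDer.eq_zero`).

For `t ≥ 2` the torus is killed for reasons of degree. For `t = 1`, since the torus is abelian and
acts diagonally on the variables, the restriction of `φ` to it is that of an inner superderivation
`ad T_H(e)` with `e` of degree `1` (`IsHomDer.exists_eq_on_torus`), that is, of a combination of the
`ad ∂_r`, and subtracting it reduces to the case above.
-/

noncomputable section

namespace SHOAlg

variable {F : Type*} [Field F] {p m : ℕ}

local notation:70 a:70 " ⋆ " b:71 => mulO F p m a b
local notation "σ" => parInv F p m

/-! ### Monomials -/

/-- The multi-index `ε_r`. -/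
def eps (r : Fin m) : Fin m → ℕ := Pi.single r 1

theorem eps_apply (r i : Fin m) : eps r i = if i = r then 1 else 0 := by
  simp [eps, Pi.single_apply]

@[simp] theorem eps_self (r : Fin m) : eps r r = 1 := by simp [eps]

theorem eps_of_ne {r i : Fin m} (h : i ≠ r) : eps r i = 0 := by simp [eps, h]

theorem mono_val (a : Idx p m) :
    mono F p m (fun i => (a.1 i : ℕ)) a.2 = Finsupp.single a 1 := by
  simp [mono]

theorem mono_of_lt {α : Fin m → ℕ} (h : ∀ i, α i < p) (u : Finset (Fin m)) :
    mono F p m α u = Finsupp.single (fun i => ⟨α i, h i⟩, u) 1 := by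
  simp [mono, h]

theorem mono_of_le {α : Fin m → ℕ} {i : Fin m} (h : p ≤ α i) (u : Finset (Fin m)) :
    mono F p m α u = 0 := by
  rw [mono, dif_neg]
  exact fun h' => absurd (h' i) (by omega)

/-- Two linear maps on `𝒪` that agree on the monomials are equal. -/
theorem linearMap_ext_mono {V : Type*} [AddCommMonoid V] [Module F V] {f g : O F p m →ₗ[F] V}
    (h : ∀ α u, (∀ i, α i < p) → f (mono F p m α u) = g (mono F p m α u)) : f = g := by
  refine Finsupp.lhom_ext' fun a => LinearMap.ext_ring ?_
  simpa [mono_val] using h (fun i => a.1 i) a.2 fun i => (a.1 i).2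

theorem mulO_mono (α β : Fin m → ℕ) (u v : Finset (Fin m)) :
    mono F p m α u ⋆ mono F p m β v =
      if Disjoint u v then
        ((∏ i, ((α i + β i).choose (α i) : F)) * mulSign F m u v) • mono F p m (α + β) (u ∪ v)
      else 0 := by
  by_cases hα : ∀ i, α i < p
  · by_cases hβ : ∀ i, β i < p
    · rw [mono_of_lt hα, mono_of_lt hβ]
      simp only [mulO, Finsupp.linearCombination_single, one_smul, mulMono]
      rfl
    · push Not at hβ
      obtain ⟨i, hi⟩ := hβ
      rw [mono_of_le hi, mono_of_le (α := α + β) (i := i) (by simp; omega)]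
      simp
  · push Not at hα
    obtain ⟨i, hi⟩ := hα
    rw [mono_of_le hi, mono_of_le (α := α + β) (i := i) (by simp; omega)]
    simp

theorem pd_inl_mono_zero {α : Fin m → ℕ} {r : Fin m} (h : α r = 0) (u : Finset (Fin m)) :
    pd F p m (Sum.inl r) (mono F p m α u) = 0 := by
  rw [mono]
  split_ifs with h'
  · simp [pd, h]
  · simp

theorem pd_inl_mono_add {α : Fin m → ℕ} {r : Fin m} (h : ∀ i, (α + eps r) i < p)
    (u : Finset (Fin m)) :
    pd F p m (Sum.inl r) (mono F p m (α + eps r) u) = mono F p m α u := by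
  rw [mono_of_lt h]
  simp only [pd, Finsupp.linearCombination_single, one_smul]
  rw [if_neg (by simp)]
  congr 1
  funext i
  by_cases hi : i = r <;> simp [hi, eps_apply]

theorem pd_inr_mono (α : Fin m → ℕ) (r : Fin m) (u : Finset (Fin m)) :
    pd F p m (Sum.inr r) (mono F p m α u) =
      if r ∈ u then ((-1 : F) ^ (u.filter fun k => k < r).card) • mono F p m α (u.erase r)
      else 0 := by
  by_cases h : ∀ i, α i < p
  · rw [mono_of_lt h, mono_of_lt h]; simp [pd]
  · push Not at h
    obtain ⟨i, hi⟩ := h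
    simp [mono_of_le hi]

theorem parInv_mono (α : Fin m → ℕ) (u : Finset (Fin m)) :
    σ (mono F p m α u) = ((-1 : F) ^ u.card) • mono F p m α u := by
  by_cases h : ∀ i, α i < p
  · rw [mono_of_lt h]; simp [parInv]
  · push Not at h
    obtain ⟨i, hi⟩ := h
    simp [mono_of_le hi]

/-! ### The product of `𝒪` -/

theorem mulSign_union_left {u v w : Finset (Fin m)} (h : Disjoint u v) :
    mulSign F m (u ∪ v) w = mulSign F m u w * mulSign F m v w := by
  rw [mulSign, mulSign, mulSign, ← pow_add, Finset.union_product, Finset.filter_union,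
    Finset.card_union_of_disjoint]
  exact Finset.disjoint_filter_filter (Finset.disjoint_product.2 (Or.inl h))

theorem mulSign_union_right {u v w : Finset (Fin m)} (h : Disjoint v w) :
    mulSign F m u (v ∪ w) = mulSign F m u v * mulSign F m u w := by
  rw [mulSign, mulSign, mulSign, ← pow_add, Finset.product_union, Finset.filter_union,
    Finset.card_union_of_disjoint]
  exact Finset.disjoint_filter_filter (Finset.disjoint_product.2 (Or.inr h))

theorem mulSign_ne_zero (u v : Finset (Fin m)) : mulSign F m u v ≠ 0 := by
  rw [mulSign]; exact pow_ne_zero _ (by simp)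

theorem mulSign_swap {u v : Finset (Fin m)} (h : Disjoint u v) :
    mulSign F m u v = (-1) ^ (u.card * v.card) * mulSign F m v u := by
  have key : ((u ×ˢ v).filter fun q => q.2 < q.1).card +
      ((v ×ˢ u).filter fun q => q.2 < q.1).card = u.card * v.card := by
    rw [← Finset.card_product,
      ← Finset.card_filter_add_card_filter_not (s := u ×ˢ v) (fun q => q.2 < q.1)]
    congr 1
    refine Finset.card_bij (fun q _ => (q.2, q.1)) ?_ ?_ ?_
    · intro q hq
      simp only [Finset.mem_filter, Finset.mem_product] at hq ⊢
      exact ⟨⟨hq.1.2, hq.1.1⟩, by simpa using hq.2.le⟩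
    · rintro ⟨a, b⟩ _ ⟨c, d⟩ _ h; simp at h ⊢; tauto
    · rintro ⟨a, b⟩ hq
      simp only [Finset.mem_filter, Finset.mem_product] at hq
      refine ⟨(b, a), ?_, rfl⟩
      simp only [Finset.mem_filter, Finset.mem_product]
      refine ⟨⟨hq.1.2, hq.1.1⟩, lt_of_le_of_ne (not_lt.1 hq.2) ?_⟩
      rintro rfl
      exact Finset.disjoint_left.1 h hq.1.1 hq.1.2
  rw [← key, pow_add, mulSign, mulSign, mul_assoc, ← mul_pow]
  simp

theorem mono_induction {P : O F p m → Prop} (f : O F p m) (zero : P 0)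
    (add : ∀ f g, P f → P g → P (f + g)) (smul : ∀ (c : F) f, P f → P (c • f))
    (mono : ∀ α u, (∀ i, α i < p) → P (mono F p m α u)) : P f := by
  induction f using Finsupp.induction_linear with
  | zero => exact zero
  | add f g hf hg => exact add f g hf hg
  | single a c =>
    have := smul c _ (mono (fun i => a.1 i) a.2 fun i => (a.1 i).2)
    rw [mono_val] at this
    simpa using this

theorem mulO_assoc (f g h : O F p m) : f ⋆ g ⋆ h = f ⋆ (g ⋆ h) := by
  induction f using mono_induction with
  | zero => simp
  | add f f' h1 h2 => simp [h1, h2]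
  | smul c f h => simp [h]
  | mono α u hα =>
  induction g using mono_induction with
  | zero => simp
  | add f f' h1 h2 => simp [h1, h2]
  | smul c f h => simp [h]
  | mono β v hβ =>
  induction h using mono_induction with
  | zero => simp
  | add f f' h1 h2 => simp [h1, h2]
  | smul c f h => simp [h]
  | mono γ w hγ =>
  simp only [mulO_mono]
  by_cases huv : Disjoint u v
  · by_cases hvw : Disjoint v w
    · by_cases huw : Disjoint u w
      · rw [if_pos huv, if_pos hvw]
        simp only [map_smul, LinearMap.smul_apply, mulO_mono]
        rw [if_pos (by simp [hvw, huw]), if_pos (by simp [huv, huw]), smul_smul, smul_smul,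
          add_assoc, Finset.union_assoc, mulSign_union_left huv, mulSign_union_right hvw]
        congr 1
        have : (∏ i, ((α i + β i).choose (α i) : F)) *
              ∏ i, (((α + β) i + γ i).choose ((α + β) i) : F) =
            (∏ i, ((β i + γ i).choose (β i) : F)) *
              ∏ i, ((α i + (β + γ) i).choose (α i) : F) := by
          rw [← Finset.prod_mul_distrib, ← Finset.prod_mul_distrib]
          refine Finset.prod_congr rfl fun i _ => ?_
          have := Nat.choose_mul (n := α i + β i + γ i) (k := α i + β i) (s := α i) (by omega)
          rw [show α i + β i + γ i - α i = β i + γ i by omega,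
            show α i + β i - α i = β i by omega] at this
          simp only [Pi.add_apply, ← add_assoc]
          rw [← Nat.cast_mul, ← Nat.cast_mul, mul_comm, this, mul_comm]
        linear_combination (mulSign F m u v * mulSign F m u w * mulSign F m v w) * this
      · rw [if_pos huv, if_pos hvw]
        simp only [map_smul, LinearMap.smul_apply, mulO_mono]
        rw [if_neg (by simp [huw]), if_neg (by simp [huw])]
        simp
    · rw [if_neg hvw, if_pos huv]
      simp only [map_smul, LinearMap.smul_apply, mulO_mono]
      rw [if_neg (by simp [hvw])]
      simp
  · rw [if_neg huv]
    split_ifs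
    · simp only [map_smul, mulO_mono]
      rw [if_neg (by simp [huv])]
      simp
    · simp

/-- Supercommutativity of `𝒪`. -/
theorem mono_mulO (α : Fin m → ℕ) (u : Finset (Fin m)) (g : O F p m) :
    mono F p m α u ⋆ g = (σ ^ u.card) g ⋆ mono F p m α u := by
  induction g using mono_induction with
  | zero => simp
  | add f f' h1 h2 => simp [h1, h2]
  | smul c f h => simp [h]
  | mono β v hβ =>
  have hσ : ∀ n : ℕ, (σ ^ n) (mono F p m β v) = ((-1 : F) ^ (n * v.card)) • mono F p m β v := by
    intro n
    induction n with
    | zero => simp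
    | succ n ih => rw [pow_succ', Module.End.mul_apply, ih, map_smul, parInv_mono, smul_smul,
        ← pow_add, add_mul, one_mul]
  rw [hσ, map_smul, LinearMap.smul_apply, mulO_mono, mulO_mono]
  by_cases huv : Disjoint u v
  · rw [if_pos huv, if_pos huv.symm, smul_smul, mulSign_swap huv, add_comm α β, Finset.union_comm]
    congr 1
    have : (∏ i, ((α i + β i).choose (α i) : F)) = ∏ i, ((β i + α i).choose (β i) : F) := by
      refine Finset.prod_congr rfl fun i _ => ?_
      rw [Nat.choose_symm_add, add_comm]
    rw [this]; ring
  · rw [if_neg huv, if_neg (fun h => huv h.symm)]; simp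

theorem parInv_parInv (f : O F p m) : σ (σ f) = f := by
  induction f using mono_induction with
  | zero => simp
  | add f f' h1 h2 => simp [h1, h2]
  | smul c f h => simp [h]
  | mono β v hβ => rw [parInv_mono, map_smul, parInv_mono, smul_smul, ← mul_pow]; simp

theorem parInv_mulO (f g : O F p m) : σ (f ⋆ g) = σ f ⋆ σ g := by
  induction f using mono_induction with
  | zero => simp
  | add f f' h1 h2 => simp [h1, h2]
  | smul c f h => simp [h]
  | mono α u hα =>
  induction g using mono_induction with
  | zero => simp
  | add f f' h1 h2 => simp [h1, h2]
  | smul c f h => simp [h]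
  | mono β v hβ =>
  simp only [parInv_mono, map_smul, LinearMap.smul_apply, mulO_mono]
  split_ifs with h
  · rw [map_smul, parInv_mono, Finset.card_union_of_disjoint h]
    simp only [smul_smul]
    congr 1; ring
  · simp

theorem parInv_of_mem {θ : ZMod 2} {f : O F p m} (hf : f ∈ oPar F p m θ) :
    σ f = ((-1 : F) ^ θ.val) • f := by
  induction hf using Submodule.span_induction with
  | mem x hx =>
    obtain ⟨a, ha, rfl⟩ := hx
    rw [← mono_val a, parInv_mono]
    congr 1
    rw [← ha, ZMod.val_natCast, neg_one_pow_eq_pow_mod_two]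
  | zero => simp
  | add x y _ _ hx hy => rw [map_add, hx, hy, smul_add]
  | smul c x _ hx => rw [map_smul, hx, smul_comm]

theorem mulO_comm_of_mem {θ : ZMod 2} {f : O F p m} (hf : f ∈ oPar F p m θ) (g : O F p m) :
    f ⋆ g = (σ ^ θ.val) g ⋆ f := by
  induction hf using Submodule.span_induction with
  | mem x hx =>
    obtain ⟨a, ha, rfl⟩ := hx
    have h2 : (σ : End F (O F p m)) ^ 2 = 1 := by
      refine LinearMap.ext fun f => ?_
      rw [pow_two, Module.End.mul_apply, parInv_parInv, Module.End.one_apply]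
    rw [← mono_val a, mono_mulO, ← ha, ZMod.val_natCast, pow_eq_pow_mod _ h2]
  | zero => simp
  | add x y _ _ hx hy => simp [hx, hy]
  | smul c x _ hx => simp [hx]

theorem mono_one_mulO (f : O F p m) : mono F p m 0 ∅ ⋆ f = f := by
  induction f using mono_induction with
  | zero => simp
  | add f f' h1 h2 => simp [h1, h2]
  | smul c f h => simp [h]
  | mono α u hα => simp [mulO_mono, mulSign]

theorem mulO_mono_one (f : O F p m) : f ⋆ mono F p m 0 ∅ = f := by
  have := mono_mulO 0 ∅ f
  simpa [mono_one_mulO] using this.symm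

/-! ### The superderivations `∂_r` -/

theorem exists_eq_add_eps {α : Fin m → ℕ} {r : Fin m} (h : α r ≠ 0) : ∃ β, α = β + eps r := by
  refine ⟨fun i => α i - eps r i, funext fun i => ?_⟩
  by_cases hi : i = r
  · subst hi; simp; omega
  · simp [eps_of_ne hi]

theorem pd_inl_mono_of_ne {α : Fin m → ℕ} {r : Fin m} (h : α r + 1 ≠ p) (u : Finset (Fin m)) :
    pd F p m (Sum.inl r) (mono F p m (α + eps r) u) = mono F p m α u := by
  by_cases h' : ∀ i, (α + eps r) i < p
  · exact pd_inl_mono_add h' u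
  · push Not at h'
    obtain ⟨i, hi⟩ := h'
    rw [mono_of_le hi, map_zero, mono_of_le (i := i)]
    by_cases hir : i = r
    · subst hir; simp at hi; omega
    · simpa [eps_of_ne hir] using hi

theorem prod_choose_split (α β : Fin m → ℕ) (r : Fin m) :
    (∏ i, ((α i + β i).choose (α i) : F)) =
      ((α r + β r).choose (α r) : F) *
        ∏ i ∈ Finset.univ.erase r, ((α i + β i).choose (α i) : F) :=
  (Finset.mul_prod_erase _ _ (Finset.mem_univ r)).symm

/-- The truncation at `p` is harmless for the Leibniz rule because `p` divides the binomial
coefficients `(p choose k)`, `0 < k < p`. -/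
theorem pd_inl_mulO [CharP F p] [Fact p.Prime] (r : Fin m) (f g : O F p m) :
    pd F p m (Sum.inl r) (f ⋆ g) = pd F p m (Sum.inl r) f ⋆ g + f ⋆ pd F p m (Sum.inl r) g := by
  have hp : 0 < p := (Fact.out : p.Prime).pos
  induction f using mono_induction with
  | zero => simp
  | add f f' h1 h2 => simp only [map_add, LinearMap.add_apply, h1, h2]; abel
  | smul c f h => simp [h]
  | mono α u hα =>
  induction g using mono_induction with
  | zero => simp
  | add f f' h1 h2 => simp only [map_add, h1, h2]; abel
  | smul c f h => simp [h]
  | mono β v hβ =>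
  have herase : ∀ α' β' : Fin m → ℕ, (∀ i, i ≠ r → α' i = α i) → (∀ i, i ≠ r → β' i = β i) →
      ∏ i ∈ Finset.univ.erase r, ((α' i + β' i).choose (α' i) : F) =
        ∏ i ∈ Finset.univ.erase r, ((α i + β i).choose (α i) : F) := by
    intro α' β' h1 h2
    refine Finset.prod_congr rfl fun i hi => ?_
    rw [h1 i (Finset.ne_of_mem_erase hi), h2 i (Finset.ne_of_mem_erase hi)]
  by_cases huv : Disjoint u v
  swap
  · have hz : ∀ γ δ : Fin m → ℕ, mono F p m γ u ⋆ mono F p m δ v = 0 := fun γ δ => by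
      rw [mulO_mono, if_neg huv]
    rw [hz, map_zero]
    by_cases ha : α r = 0 <;> by_cases hb : β r = 0
    · simp [pd_inl_mono_zero ha, pd_inl_mono_zero hb]
    · obtain ⟨β', rfl⟩ := exists_eq_add_eps hb
      simp [pd_inl_mono_zero ha, pd_inl_mono_add hβ, hz]
    · obtain ⟨α', rfl⟩ := exists_eq_add_eps ha
      simp [pd_inl_mono_zero hb, pd_inl_mono_add hα, hz]
    · obtain ⟨α', rfl⟩ := exists_eq_add_eps ha
      obtain ⟨β', rfl⟩ := exists_eq_add_eps hb
      simp [pd_inl_mono_add hα, pd_inl_mono_add hβ, hz]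
  have hαr := hα r
  have hβr := hβ r
  by_cases ha : α r = 0 <;> by_cases hb : β r = 0
  · rw [pd_inl_mono_zero ha, pd_inl_mono_zero hb, mulO_mono, if_pos huv, map_smul,
      pd_inl_mono_zero (by simp [ha, hb])]
    simp
  · obtain ⟨β', rfl⟩ := exists_eq_add_eps hb
    simp only [Pi.add_apply, eps_self] at hβr
    rw [pd_inl_mono_zero ha, pd_inl_mono_add hβ, mulO_mono, mulO_mono, if_pos huv, if_pos huv,
      map_smul, ← add_assoc, pd_inl_mono_of_ne (by simp [ha]; omega), prod_choose_split _ _ r,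
      prod_choose_split α β' r, herase α β' (fun _ _ => rfl) (fun i hi => by simp [eps_of_ne hi])]
    simp [ha]
  · obtain ⟨α', rfl⟩ := exists_eq_add_eps ha
    simp only [Pi.add_apply, eps_self] at hαr
    rw [pd_inl_mono_zero hb, pd_inl_mono_add hα, mulO_mono, mulO_mono, if_pos huv, if_pos huv,
      map_smul, add_right_comm, pd_inl_mono_of_ne (by simp [hb]; omega), prod_choose_split _ _ r,
      prod_choose_split α' β r, herase α' β (fun i hi => by simp [eps_of_ne hi]) (fun _ _ => rfl)]
    simp [hb]
  · obtain ⟨α', rfl⟩ := exists_eq_add_eps ha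
    obtain ⟨β', rfl⟩ := exists_eq_add_eps hb
    simp only [Pi.add_apply, eps_self] at hβr hαr
    have hsum : α' + eps r + (β' + eps r) = α' + β' + eps r + eps r := by abel
    have hsum1 : α' + (β' + eps r) = α' + β' + eps r := by abel
    have hsum2 : α' + eps r + β' = α' + β' + eps r := by abel
    rw [pd_inl_mono_add hα, pd_inl_mono_add hβ, mulO_mono, mulO_mono, mulO_mono, if_pos huv,
      if_pos huv, if_pos huv, map_smul, hsum, hsum1, hsum2, prod_choose_split _ _ r,
      prod_choose_split α' (β' + eps r) r, prod_choose_split (α' + eps r) β' r,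
      herase α' (β' + eps r) (fun i hi => by simp [eps_of_ne hi]) (fun _ _ => rfl),
      herase (α' + eps r) β' (fun _ _ => rfl) (fun i hi => by simp [eps_of_ne hi]), ← add_smul]
    simp only [Pi.add_apply, eps_self]
    have hpas : ((α' r + 1 + (β' r + 1)).choose (α' r + 1) : F) =
        ((α' r + (β' r + 1)).choose (α' r) : F) + ((α' r + 1 + β' r).choose (α' r + 1) : F) := by
      rw [show α' r + 1 + (β' r + 1) = (α' r + (β' r + 1)) + 1 by ring, Nat.choose_succ_succ',
        Nat.cast_add]
      congr 3; ring
    by_cases h : (α' + β' + eps r) r + 1 = p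
    · rw [mono_of_le (α := α' + β' + eps r + eps r) (i := r) (by simp at h ⊢; omega), map_zero,
        smul_zero, ← add_mul, ← add_mul, ← hpas]
      simp only [Pi.add_apply, eps_self] at h
      rw [show α' r + 1 + (β' r + 1) = p by omega, (CharP.cast_eq_zero_iff F p _).2
        ((Fact.out : p.Prime).dvd_choose_self (by omega) (by omega))]
      simp
    · rw [pd_inl_mono_of_ne h, hpas]
      congr 1; ring

theorem mulSign_singleton_left (r : Fin m) (v : Finset (Fin m)) :
    mulSign F m {r} v = (-1) ^ (v.filter fun k => k < r).card := by
  rw [mulSign]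
  congr 1
  refine Finset.card_bij (fun q _ => q.2) ?_ ?_ ?_
  · rintro ⟨a, b⟩ hq; simp at hq ⊢; rcases hq with ⟨⟨h1, rfl⟩, h2⟩; exact ⟨h1, h2⟩
  · rintro ⟨a, b⟩ h1 ⟨c, d⟩ h2 h; simp at h1 h2 h ⊢; grind
  · intro b hb; simp at hb; exact ⟨(r, b), by simpa using hb, rfl⟩

theorem mulSign_singleton_right (u : Finset (Fin m)) (r : Fin m) :
    mulSign F m u {r} = (-1) ^ (u.filter fun k => r < k).card := by
  rw [mulSign]
  congr 1
  refine Finset.card_bij (fun q _ => q.1) ?_ ?_ ?_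
  · rintro ⟨a, b⟩ hq; simp at hq ⊢; rcases hq with ⟨⟨h1, rfl⟩, h2⟩; exact ⟨h1, h2⟩
  · rintro ⟨a, b⟩ h1 ⟨c, d⟩ h2 h; simp at h1 h2 h ⊢; grind
  · intro b hb; simp at hb; exact ⟨(b, r), by simpa using hb, rfl⟩

theorem card_filter_lt_add_card_filter_gt {u : Finset (Fin m)} {r : Fin m} (h : r ∉ u) :
    (u.filter fun k => k < r).card + (u.filter fun k => r < k).card = u.card := by
  rw [← Finset.card_filter_add_card_filter_not (s := u) (fun k => k < r)]
  congr 2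
  refine Finset.filter_congr fun k hk => ?_
  have : k ≠ r := fun e => h (e ▸ hk)
  simp only [not_lt]
  exact ⟨le_of_lt, fun h => lt_of_le_of_ne h this.symm⟩

theorem mulSign_erase_left {u : Finset (Fin m)} {r : Fin m} (h : r ∈ u) (v : Finset (Fin m)) :
    mulSign F m u v = (-1) ^ (v.filter fun k => k < r).card * mulSign F m (u.erase r) v := by
  conv_lhs => rw [← Finset.insert_erase h, Finset.insert_eq]
  rw [mulSign_union_left (by simp), mulSign_singleton_left]

theorem mulSign_erase_right {v : Finset (Fin m)} {r : Fin m} (h : r ∈ v) (u : Finset (Fin m)) :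
    mulSign F m u v = (-1) ^ (u.filter fun k => r < k).card * mulSign F m u (v.erase r) := by
  conv_lhs => rw [← Finset.insert_erase h, Finset.insert_eq]
  rw [mulSign_union_right (by simp), mulSign_singleton_right]

theorem neg_one_pow_mul_self (n : ℕ) : ((-1 : F) ^ n) * (-1) ^ n = 1 := by
  rw [← mul_pow]; simp

theorem filter_erase_lt (u : Finset (Fin m)) (r : Fin m) :
    ((u.erase r).filter fun k => k < r) = u.filter fun k => k < r := by
  ext k; simp only [Finset.mem_filter, Finset.mem_erase]
  exact ⟨fun h => ⟨h.1.2, h.2⟩, fun h => ⟨⟨ne_of_lt h.2, h.1⟩, h.2⟩⟩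

theorem filter_erase_gt (u : Finset (Fin m)) (r : Fin m) :
    ((u.erase r).filter fun k => r < k) = u.filter fun k => r < k := by
  ext k; simp only [Finset.mem_filter, Finset.mem_erase]
  exact ⟨fun h => ⟨h.1.2, h.2⟩, fun h => ⟨⟨ne_of_gt h.2, h.1⟩, h.2⟩⟩

theorem pd_inr_mulO (r : Fin m) (f g : O F p m) :
    pd F p m (Sum.inr r) (f ⋆ g) =
      pd F p m (Sum.inr r) f ⋆ g + σ f ⋆ pd F p m (Sum.inr r) g := by
  induction f using mono_induction with
  | zero => simp
  | add f f' h1 h2 => simp only [map_add, LinearMap.add_apply, h1, h2]; abel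
  | smul c f h => simp [h]
  | mono α u hα =>
  induction g using mono_induction with
  | zero => simp
  | add f f' h1 h2 => simp only [map_add, h1, h2]; abel
  | smul c f h => simp [h]
  | mono β v hβ =>
  rw [pd_inr_mono, pd_inr_mono, parInv_mono, mulO_mono]
  by_cases huv : Disjoint u v
  · rw [if_pos huv, map_smul, pd_inr_mono]
    by_cases hu : r ∈ u
    · have hv : r ∉ v := Finset.disjoint_left.1 huv hu
      rw [if_pos (Finset.mem_union_left _ hu), if_pos hu, if_neg hv, map_smul,
        LinearMap.smul_apply, mulO_mono, if_pos (huv.mono_left (Finset.erase_subset _ _)),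
        Finset.erase_union_distrib, Finset.erase_eq_of_notMem hv, Finset.filter_union,
        Finset.card_union_of_disjoint (Finset.disjoint_filter_filter huv), mulSign_erase_left hu,
        map_zero, add_zero, smul_smul, smul_smul]
      congr 1
      rw [pow_add]
      linear_combination ((∏ i, ((α i + β i).choose (α i) : F)) * mulSign F m (u.erase r) v *
        (-1) ^ (u.filter fun k => k < r).card) *
        neg_one_pow_mul_self (F := F) (v.filter fun k => k < r).card
    · by_cases hv : r ∈ v
      · rw [if_pos (Finset.mem_union_right _ hv), if_pos hv, if_neg hu, map_zero,
          LinearMap.zero_apply, zero_add, map_smul, map_smul, LinearMap.smul_apply, mulO_mono,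
          if_pos (huv.mono_right (Finset.erase_subset _ _)),
          Finset.erase_union_distrib, Finset.erase_eq_of_notMem hu, Finset.filter_union,
          Finset.card_union_of_disjoint (Finset.disjoint_filter_filter huv),
          mulSign_erase_right hv, smul_smul, smul_smul, smul_smul,
          ← card_filter_lt_add_card_filter_gt hu]
        congr 1
        rw [pow_add, pow_add]; ring
      · rw [if_neg (by simp [hu, hv]), if_neg hu, if_neg hv]; simp
  · rw [if_neg huv, map_zero]
    by_cases hu : r ∈ u
    · by_cases hv : r ∈ v
      · rw [if_pos hu, if_pos hv, map_smul, map_smul, map_smul, LinearMap.smul_apply,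
          LinearMap.smul_apply, mulO_mono, mulO_mono]
        by_cases hd : Disjoint (u.erase r) (v.erase r)
        · have h1 : Disjoint (u.erase r) v := by
            rw [← Finset.insert_erase hv, Finset.disjoint_insert_right]
            exact ⟨by simp, hd⟩
          have h2 : Disjoint u (v.erase r) := by
            rw [← Finset.insert_erase hu, Finset.disjoint_insert_left]
            exact ⟨by simp, hd⟩
          have h3 : u.erase r ∪ v = u ∪ v.erase r := by
            ext k; simp only [Finset.mem_union, Finset.mem_erase]
            by_cases hk : k = r
            · subst hk; simp [hu, hv]
            · simp [hk]
          rw [if_pos h1, if_pos h2, h3, mulSign_erase_right hv (u.erase r),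
            mulSign_erase_left hu (v.erase r), filter_erase_lt, filter_erase_gt,
            ← Finset.card_erase_add_one hu,
            ← card_filter_lt_add_card_filter_gt (Finset.notMem_erase r u), filter_erase_lt,
            filter_erase_gt, smul_smul, smul_smul, smul_smul, ← add_smul]
          refine (smul_eq_zero.2 (Or.inl ?_)).symm
          rw [pow_add, pow_add]
          linear_combination -((∏ i, ((α i + β i).choose (α i) : F)) *
            mulSign F m (u.erase r) (v.erase r) * (-1) ^ (u.filter fun k => k < r).card *
            (-1) ^ (u.filter fun k => r < k).card) *
            neg_one_pow_mul_self (F := F) (v.filter fun k => k < r).card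
        · rw [if_neg (fun h => hd (h.mono_right (Finset.erase_subset _ _))),
            if_neg (fun h => hd (h.mono_left (Finset.erase_subset _ _)))]
          simp
      · rw [if_pos hu, if_neg hv, map_smul, LinearMap.smul_apply, mulO_mono, if_neg]
        · simp
        · intro h
          apply huv
          rw [← Finset.insert_erase hu, Finset.disjoint_insert_left]
          exact ⟨hv, h⟩
    · by_cases hv : r ∈ v
      · rw [if_neg hu, if_pos hv, map_smul, map_smul, LinearMap.smul_apply, mulO_mono, if_neg]
        · simp
        · intro h
          apply huv
          rw [← Finset.insert_erase hv, Finset.disjoint_insert_right]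
          exact ⟨hu, h⟩
      · rw [if_neg hu, if_neg hv]; simp

theorem pd_inl_pd_inl (r s : Fin m) (f : O F p m) :
    pd F p m (Sum.inl r) (pd F p m (Sum.inl s) f) =
      pd F p m (Sum.inl s) (pd F p m (Sum.inl r) f) := by
  by_cases hrs : r = s
  · rw [hrs]
  induction f using mono_induction with
  | zero => simp
  | add f f' h1 h2 => simp [h1, h2]
  | smul c f h => simp [h]
  | mono α u hα =>
  have key : ∀ r s : Fin m, r ≠ s → α r = 0 →
      pd F p m (Sum.inl r) (pd F p m (Sum.inl s) (mono F p m α u)) =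
      pd F p m (Sum.inl s) (pd F p m (Sum.inl r) (mono F p m α u)) := by
    intro r s hrs h
    rw [pd_inl_mono_zero h, map_zero]
    by_cases hs : α s = 0
    · rw [pd_inl_mono_zero hs, map_zero]
    · obtain ⟨β, rfl⟩ := exists_eq_add_eps hs
      rw [pd_inl_mono_add hα, pd_inl_mono_zero]
      simpa [eps_of_ne hrs] using h
  by_cases h1 : α r = 0
  · exact key r s hrs h1
  by_cases h2 : α s = 0
  · exact (key s r (Ne.symm hrs) h2).symm
  obtain ⟨β, rfl⟩ := exists_eq_add_eps h1
  have h3 : β s ≠ 0 := by simpa [eps_of_ne (Ne.symm hrs)] using h2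
  obtain ⟨γ, rfl⟩ := exists_eq_add_eps h3
  have hα' : ∀ i, (γ + eps r + eps s) i < p := by
    intro i; have := hα i; simp at this ⊢; omega
  have h4 : ∀ i, (γ + eps s) i < p := by
    intro i; have := hα i; simp at this ⊢; omega
  have h5 : ∀ i, (γ + eps r) i < p := by
    intro i; have := hα i; simp at this ⊢; omega
  rw [pd_inl_mono_add hα, pd_inl_mono_add h4, add_right_comm, pd_inl_mono_add hα',
    pd_inl_mono_add h5]

theorem pd_inl_pd_inr (r s : Fin m) (f : O F p m) :
    pd F p m (Sum.inl r) (pd F p m (Sum.inr s) f) =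
      pd F p m (Sum.inr s) (pd F p m (Sum.inl r) f) := by
  induction f using mono_induction with
  | zero => simp
  | add f f' h1 h2 => simp [h1, h2]
  | smul c f h => simp [h]
  | mono α u hα =>
  rw [pd_inr_mono]
  by_cases h : α r = 0
  · rw [pd_inl_mono_zero h, map_zero]
    split_ifs
    · rw [map_smul, pd_inl_mono_zero h, smul_zero]
    · simp
  · obtain ⟨β, rfl⟩ := exists_eq_add_eps h
    rw [pd_inl_mono_add hα, pd_inr_mono]
    split_ifs
    · rw [map_smul, pd_inl_mono_add hα]
    · simp

theorem pd_inr_pd_inr (r s : Fin m) (f : O F p m) :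
    pd F p m (Sum.inr r) (pd F p m (Sum.inr s) f) =
      -pd F p m (Sum.inr s) (pd F p m (Sum.inr r) f) := by
  induction f using mono_induction with
  | zero => simp
  | add f f' h1 h2 => simp only [map_add, h1, h2, neg_add]
  | smul c f h => simp [h]
  | mono α u hα =>
  have key : ∀ r s : Fin m, r < s → r ∈ u → s ∈ u →
      ((-1 : F) ^ (u.filter fun k => k < s).card) *
        (-1) ^ ((u.erase s).filter fun k => k < r).card =
      -(((-1 : F) ^ (u.filter fun k => k < r).card) *
        (-1) ^ ((u.erase r).filter fun k => k < s).card) := by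
    intro r s hrs hr hs
    have h1 : ((u.erase s).filter fun k => k < r) = u.filter fun k => k < r := by
      ext k; simp only [Finset.mem_filter, Finset.mem_erase]
      exact ⟨fun h => ⟨h.1.2, h.2⟩, fun h => ⟨⟨ne_of_lt (h.2.trans hrs), h.1⟩, h.2⟩⟩
    have h2 : ((u.erase r).filter fun k => k < s) = (u.filter fun k => k < s).erase r := by
      ext k; simp only [Finset.mem_filter, Finset.mem_erase]; tauto
    have h3 := Finset.card_erase_add_one (s := u.filter fun k => k < s) (a := r) (by simp [hr, hrs])
    rw [h1, h2, ← h3, pow_succ]; ring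
  rw [pd_inr_mono, pd_inr_mono]
  by_cases hr : r ∈ u <;> by_cases hs : s ∈ u
  · rw [if_pos hr, if_pos hs, map_smul, map_smul, pd_inr_mono, pd_inr_mono]
    by_cases hrs : r = s
    · subst hrs; simp
    · rw [if_pos (by simp [hr, hrs]), if_pos (by simp [hs, Ne.symm hrs]), smul_smul, smul_smul,
        ← neg_smul, Finset.erase_right_comm]
      congr 1
      rcases lt_or_gt_of_ne hrs with h | h
      · exact key r s h hr hs
      · rw [key s r h hs hr, neg_neg]
  · rw [if_pos hr, if_neg hs, map_smul, pd_inr_mono, if_neg (by simp [hs])]; simp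
  · rw [if_neg hr, if_pos hs, map_smul, pd_inr_mono, if_neg (by simp [hr])]; simp
  · rw [if_neg hr, if_neg hs]; simp

theorem parInv_pd_inl (r : Fin m) (f : O F p m) :
    σ (pd F p m (Sum.inl r) f) = pd F p m (Sum.inl r) (σ f) := by
  induction f using mono_induction with
  | zero => simp
  | add f f' h1 h2 => simp [h1, h2]
  | smul c f h => simp [h]
  | mono α u hα =>
  rw [parInv_mono, map_smul]
  by_cases h : α r = 0
  · simp [pd_inl_mono_zero h]
  · obtain ⟨β, rfl⟩ := exists_eq_add_eps h
    rw [pd_inl_mono_add hα, parInv_mono]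

theorem parInv_pd_inr (r : Fin m) (f : O F p m) :
    σ (pd F p m (Sum.inr r) f) = -pd F p m (Sum.inr r) (σ f) := by
  induction f using mono_induction with
  | zero => simp
  | add f f' h1 h2 => simp only [map_add, h1, h2, neg_add]
  | smul c f h => simp [h]
  | mono α u hα =>
  rw [parInv_mono, map_smul, pd_inr_mono]
  split_ifs with h
  · rw [map_smul, parInv_mono, ← Finset.card_erase_add_one h, pow_succ, smul_comm, ← neg_smul]
    congr 1; ring
  · simp

/-! ### Parity -/

theorem mono_mem_oPar {α : Fin m → ℕ} {u : Finset (Fin m)} :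
    mono F p m α u ∈ oPar F p m u.card := by
  by_cases h : ∀ i, α i < p
  · rw [mono_of_lt h]; exact Submodule.subset_span ⟨_, rfl, rfl⟩
  · push Not at h
    obtain ⟨i, hi⟩ := h
    rw [mono_of_le hi]; exact Submodule.zero_mem _

theorem map_mem_of_mono_mem {θ : ZMod 2} {N : Submodule F (O F p m)} (A : End F (O F p m))
    (h : ∀ α u, (u.card : ZMod 2) = θ → (∀ i, α i < p) → A (mono F p m α u) ∈ N)
    {f : O F p m} (hf : f ∈ oPar F p m θ) : A f ∈ N := by
  induction hf using Submodule.span_induction with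
  | mem x hx =>
    obtain ⟨a, ha, rfl⟩ := hx
    rw [← mono_val a]; exact h _ _ ha fun i => (a.1 i).2
  | zero => simp
  | add x y _ _ hx hy => rw [map_add]; exact Submodule.add_mem _ hx hy
  | smul c x _ hx => rw [map_smul]; exact Submodule.smul_mem _ _ hx

theorem parInv_mem_oPar {θ : ZMod 2} {f : O F p m} (hf : f ∈ oPar F p m θ) :
    σ f ∈ oPar F p m θ := by
  rw [parInv_of_mem hf]; exact Submodule.smul_mem _ _ hf

theorem pd_inl_mem_oPar {θ : ZMod 2} {f : O F p m} (hf : f ∈ oPar F p m θ) (r : Fin m) :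
    pd F p m (Sum.inl r) f ∈ oPar F p m θ := by
  refine map_mem_of_mono_mem _ (fun α u hu hα => ?_) hf
  by_cases h : α r = 0
  · rw [pd_inl_mono_zero h]; exact Submodule.zero_mem _
  · obtain ⟨β, rfl⟩ := exists_eq_add_eps h
    rw [pd_inl_mono_add hα, ← hu]; exact mono_mem_oPar

theorem pd_inr_mem_oPar {θ : ZMod 2} {f : O F p m} (hf : f ∈ oPar F p m θ) (r : Fin m) :
    pd F p m (Sum.inr r) f ∈ oPar F p m (θ + 1) := by
  refine map_mem_of_mono_mem _ (fun α u hu hα => ?_) hf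
  rw [pd_inr_mono]
  split_ifs with h
  · refine Submodule.smul_mem _ _ ?_
    have : ((u.erase r).card : ZMod 2) = θ + 1 := by
      rw [← hu, ← Finset.card_erase_add_one h, Nat.cast_add, Nat.cast_one, add_assoc,
        show (1 : ZMod 2) + 1 = 0 by decide, add_zero]
    rw [← this]; exact mono_mem_oPar
  · exact Submodule.zero_mem _

theorem pd_inr_mem_oPar_one {f : O F p m} (hf : f ∈ oPar F p m 0) (r : Fin m) :
    pd F p m (Sum.inr r) f ∈ oPar F p m 1 := by
  simpa using pd_inr_mem_oPar hf r

theorem pd_inr_mem_oPar_zero {f : O F p m} (hf : f ∈ oPar F p m 1) (r : Fin m) :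
    pd F p m (Sum.inr r) f ∈ oPar F p m 0 :=
  pd_inr_mem_oPar hf r

theorem mulO_mem_oPar {θ η : ZMod 2} {f g : O F p m} (hf : f ∈ oPar F p m θ)
    (hg : g ∈ oPar F p m η) : f ⋆ g ∈ oPar F p m (θ + η) := by
  refine map_mem_of_mono_mem ((mulO F p m).flip g) (fun α u hu hα => ?_) hf
  refine map_mem_of_mono_mem (mulO F p m (mono F p m α u)) (fun β v hv hβ => ?_) hg
  rw [mulO_mono]
  split_ifs with h
  · refine Submodule.smul_mem _ _ ?_
    rw [← hu, ← hv, ← Nat.cast_add, ← Finset.card_union_of_disjoint h]; exact mono_mem_oPar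
  · exact Submodule.zero_mem _

theorem parInv_of_mem_zero {f : O F p m} (hf : f ∈ oPar F p m 0) : σ f = f := by
  simpa using parInv_of_mem hf

theorem parInv_of_mem_one {f : O F p m} (hf : f ∈ oPar F p m 1) : σ f = -f := by
  simpa [show (1 : ZMod 2).val = 1 from rfl] using parInv_of_mem hf

theorem mulO_comm_of_mem_zero {f : O F p m} (hf : f ∈ oPar F p m 0) (g : O F p m) :
    f ⋆ g = g ⋆ f := by
  simpa using mulO_comm_of_mem hf g

theorem mulO_comm_of_mem_one {f : O F p m} (hf : f ∈ oPar F p m 1) (g : O F p m) :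
    f ⋆ g = σ g ⋆ f := by
  simpa [show (1 : ZMod 2).val = 1 from rfl] using mulO_comm_of_mem hf g

/-! ### Hamiltonian operators -/

theorem vf_apply (f : Y m → O F p m) (g : O F p m) :
    vf F p m f g = ∑ r, f r ⋆ pd F p m r g := by
  simp [vf]

theorem TH_eq_vf (a : O F p m) :
    TH F p m a = vf F p m (Sum.elim (fun i => pd F p m (Sum.inr i) (σ a))
      fun i => pd F p m (Sum.inl i) a) := by
  have : (Sum.elim (fun i => pd F p m (Sum.inr i) (σ a)) fun i => pd F p m (Sum.inl i) a) =
      ∑ i : Y m, (Pi.single i.swap (pd F p m i ((σ ^ mu i) a)) : Y m → O F p m) := by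
    funext r
    rw [Finset.sum_apply, Finset.sum_eq_single r.swap]
    · rcases r with r | r <;> simp [mu]
    · intro b _ hb
      rw [Pi.single_eq_of_ne]
      rintro rfl
      simp at hb
    · simp
  rw [this, map_sum]
  simp [TH]

theorem TH_apply (a f : O F p m) :
    TH F p m a f = ∑ i, (pd F p m (Sum.inl i) a ⋆ pd F p m (Sum.inr i) f +
      pd F p m (Sum.inr i) (σ a) ⋆ pd F p m (Sum.inl i) f) := by
  rw [TH_eq_vf, vf_apply, Fintype.sum_sum_type, add_comm, Finset.sum_add_distrib]
  rfl

theorem parInv_TH (a f : O F p m) : σ (TH F p m a f) = -TH F p m (σ a) (σ f) := by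
  rw [TH_apply, TH_apply, map_sum, ← Finset.sum_neg_distrib]
  refine Finset.sum_congr rfl fun i _ => ?_
  rw [map_add, parInv_mulO, parInv_mulO, parInv_pd_inl, parInv_pd_inr, parInv_pd_inr,
    parInv_pd_inl]
  simp only [map_neg, LinearMap.neg_apply]; abel

theorem TH_mem_endPar {θ : ZMod 2} {a : O F p m} (ha : a ∈ oPar F p m θ) :
    TH F p m a ∈ endPar F p m (θ + 1) := by
  intro η f hf
  rw [TH_apply]
  refine Submodule.sum_mem _ fun i _ => Submodule.add_mem _ ?_ ?_
  · rw [show η + (θ + 1) = θ + (η + 1) by ring]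
    exact mulO_mem_oPar (pd_inl_mem_oPar ha i) (pd_inr_mem_oPar hf i)
  · rw [show η + (θ + 1) = θ + 1 + η by ring]
    exact mulO_mem_oPar (pd_inr_mem_oPar (parInv_mem_oPar ha) i) (pd_inl_mem_oPar hf i)

theorem pd_inr_TH (r : Fin m) (a f : O F p m) :
    pd F p m (Sum.inr r) (TH F p m a f) =
      TH F p m (pd F p m (Sum.inr r) a) f - TH F p m (σ a) (pd F p m (Sum.inr r) f) := by
  simp only [TH_apply, map_sum, ← Finset.sum_sub_distrib]
  refine Finset.sum_congr rfl fun i _ => ?_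
  rw [map_add, pd_inr_mulO, pd_inr_mulO, ← pd_inl_pd_inr i r a, pd_inr_pd_inr r i f,
    pd_inr_pd_inr r i (σ a), ← pd_inl_pd_inr i r f, parInv_pd_inl, parInv_pd_inr,
    parInv_pd_inr, parInv_parInv]
  simp only [map_neg, LinearMap.neg_apply]; abel

theorem TH_comm_of_mem_zero {a : O F p m} (ha : a ∈ oPar F p m 0) (b : O F p m) :
    TH F p m a b = TH F p m (σ b) a := by
  rw [TH_apply, TH_apply]
  refine Finset.sum_congr rfl fun i _ => ?_
  rw [parInv_of_mem_zero ha, parInv_parInv, mulO_comm_of_mem_zero (pd_inl_mem_oPar ha i),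
    mulO_comm_of_mem_one (pd_inr_mem_oPar_one ha i), parInv_pd_inl, add_comm]

theorem TH_comm_of_mem_one {a : O F p m} (ha : a ∈ oPar F p m 1) (b : O F p m) :
    TH F p m a b = -TH F p m b a := by
  rw [TH_apply, TH_apply, ← Finset.sum_neg_distrib]
  refine Finset.sum_congr rfl fun i _ => ?_
  rw [parInv_of_mem_one ha, map_neg, map_neg, LinearMap.neg_apply,
    mulO_comm_of_mem_one (pd_inl_mem_oPar ha i), parInv_pd_inr, mulO_comm_of_mem_zero
    (pd_inr_mem_oPar_zero ha i)]
  simp only [map_neg, LinearMap.neg_apply]; abel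

/-- The part of `T_H(b) T_H(a)` in which the coefficients of `T_H(a)` are differentiated. -/
theorem sum_mulO_TH_pd (a b f : O F p m) :
    ∑ i, (pd F p m (Sum.inl i) b ⋆ TH F p m (pd F p m (Sum.inr i) a) f +
      pd F p m (Sum.inr i) (σ b) ⋆ TH F p m (pd F p m (Sum.inl i) a) f) =
    ∑ j, (TH F p m b (pd F p m (Sum.inl j) a) ⋆ pd F p m (Sum.inr j) f +
      TH F p m b (pd F p m (Sum.inr j) (σ a)) ⋆ pd F p m (Sum.inl j) f) := by
  simp only [TH_apply, map_sum, LinearMap.sum_apply, ← Finset.sum_add_distrib]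
  rw [Finset.sum_comm]
  refine Finset.sum_congr rfl fun j _ => Finset.sum_congr rfl fun i _ => ?_
  rw [parInv_pd_inr, map_neg, pd_inr_pd_inr j i, neg_neg, pd_inl_pd_inr j i, parInv_pd_inl,
    ← pd_inl_pd_inr i j, pd_inl_pd_inl j i]
  simp only [map_add, LinearMap.add_apply, ← mulO_assoc]
  abel

section

variable [CharP F p] [Fact p.Prime]

theorem pd_inl_TH (r : Fin m) (a f : O F p m) :
    pd F p m (Sum.inl r) (TH F p m a f) =
      TH F p m (pd F p m (Sum.inl r) a) f + TH F p m a (pd F p m (Sum.inl r) f) := by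
  simp only [TH_apply, map_sum, ← Finset.sum_add_distrib]
  refine Finset.sum_congr rfl fun i _ => ?_
  rw [map_add, pd_inl_mulO, pd_inl_mulO, pd_inl_pd_inl r i, pd_inl_pd_inr r i f,
    pd_inl_pd_inr r i (σ a), pd_inl_pd_inl r i f, parInv_pd_inl]
  abel

theorem TH_mulO_of_mem_one {a : O F p m} (ha : a ∈ oPar F p m 1) (f g : O F p m) :
    TH F p m a (f ⋆ g) = TH F p m a f ⋆ g + f ⋆ TH F p m a g := by
  simp only [TH_apply, map_sum, LinearMap.sum_apply, ← Finset.sum_add_distrib]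
  refine Finset.sum_congr rfl fun i _ => ?_
  have h1 : pd F p m (Sum.inl i) a ⋆ σ f = f ⋆ pd F p m (Sum.inl i) a := by
    rw [mulO_comm_of_mem_one (pd_inl_mem_oPar ha i), parInv_parInv]
  have h2 : pd F p m (Sum.inr i) (σ a) ⋆ f = f ⋆ pd F p m (Sum.inr i) (σ a) :=
    mulO_comm_of_mem_zero (pd_inr_mem_oPar_zero (parInv_mem_oPar ha) i) f
  rw [pd_inr_mulO, pd_inl_mulO]
  simp only [map_add, LinearMap.add_apply, ← mulO_assoc, h1, h2]
  abel

theorem TH_mulO_of_mem_zero {a : O F p m} (ha : a ∈ oPar F p m 0) (f g : O F p m) :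
    TH F p m a (f ⋆ g) = TH F p m a f ⋆ g + σ f ⋆ TH F p m a g := by
  simp only [TH_apply, map_sum, LinearMap.sum_apply, ← Finset.sum_add_distrib]
  refine Finset.sum_congr rfl fun i _ => ?_
  have h1 : pd F p m (Sum.inl i) a ⋆ σ f = σ f ⋆ pd F p m (Sum.inl i) a :=
    mulO_comm_of_mem_zero (pd_inl_mem_oPar ha i) _
  have h2 : pd F p m (Sum.inr i) (σ a) ⋆ f = σ f ⋆ pd F p m (Sum.inr i) (σ a) :=
    mulO_comm_of_mem_one (pd_inr_mem_oPar_one (parInv_mem_oPar ha) i) f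
  rw [pd_inr_mulO, pd_inl_mulO]
  simp only [map_add, LinearMap.add_apply, ← mulO_assoc, h1, h2]
  abel

theorem TH_TH_of_mem_one {a : O F p m} (ha : a ∈ oPar F p m 1) (b f : O F p m) :
    TH F p m a (TH F p m b f) = TH F p m b (TH F p m a f) + TH F p m (TH F p m a b) f := by
  have hs := sum_mulO_TH_pd a b f
  have e1 : ∀ i, TH F p m a (pd F p m (Sum.inl i) f) = pd F p m (Sum.inl i) (TH F p m a f) -
      TH F p m (pd F p m (Sum.inl i) a) f := fun i => by rw [pd_inl_TH]; abel
  have e2 : ∀ i, TH F p m a (pd F p m (Sum.inr i) f) = pd F p m (Sum.inr i) (TH F p m a f) -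
      TH F p m (pd F p m (Sum.inr i) a) f := fun i => by
    rw [pd_inr_TH, parInv_of_mem_one ha]; simp
  have e3 : ∀ i, pd F p m (Sum.inl i) (TH F p m a b) = TH F p m a (pd F p m (Sum.inl i) b) -
      TH F p m b (pd F p m (Sum.inl i) a) := fun i => by
    rw [pd_inl_TH, TH_comm_of_mem_one (pd_inl_mem_oPar ha i)]; abel
  have e4 : ∀ i, pd F p m (Sum.inr i) (σ (TH F p m a b)) =
      TH F p m a (pd F p m (Sum.inr i) (σ b)) -
      TH F p m b (pd F p m (Sum.inr i) (σ a)) := fun i => by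
    rw [parInv_TH, parInv_of_mem_one ha, map_neg (TH F p m), LinearMap.neg_apply, neg_neg,
      pd_inr_TH, parInv_of_mem_one ha, TH_comm_of_mem_zero (pd_inr_mem_oPar_zero ha i),
      parInv_parInv]
    simp only [map_neg, LinearMap.neg_apply]; abel
  rw [TH_apply b f, map_sum]
  simp only [map_add, TH_mulO_of_mem_one ha, e1, e2, map_sub]
  rw [TH_apply b (TH F p m a f), TH_apply (TH F p m a b) f]
  simp only [e3, e4, map_sub, LinearMap.sub_apply]
  simp only [Finset.sum_add_distrib, Finset.sum_sub_distrib] at hs ⊢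
  rw [← sub_eq_zero] at hs ⊢
  rw [← neg_eq_zero, ← hs]
  abel

theorem TH_TH_of_mem_zero {a : O F p m} (ha : a ∈ oPar F p m 0) (b f : O F p m) :
    TH F p m a (TH F p m b f) = TH F p m (TH F p m a b) f - TH F p m (σ b) (TH F p m a f) := by
  have hs := sum_mulO_TH_pd a (σ b) f
  have e1 : ∀ i, TH F p m a (pd F p m (Sum.inl i) f) = pd F p m (Sum.inl i) (TH F p m a f) -
      TH F p m (pd F p m (Sum.inl i) a) f := fun i => by rw [pd_inl_TH]; abel
  have e2 : ∀ i, TH F p m a (pd F p m (Sum.inr i) f) = TH F p m (pd F p m (Sum.inr i) a) f -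
      pd F p m (Sum.inr i) (TH F p m a f) := fun i => by
    rw [pd_inr_TH, parInv_of_mem_zero ha]; simp
  have e3 : ∀ i, pd F p m (Sum.inl i) (TH F p m a b) = TH F p m a (pd F p m (Sum.inl i) b) +
      TH F p m (σ b) (pd F p m (Sum.inl i) a) := fun i => by
    rw [pd_inl_TH, TH_comm_of_mem_zero (pd_inl_mem_oPar ha i)]; abel
  have e4 : ∀ i, pd F p m (Sum.inr i) (σ (TH F p m a b)) =
      TH F p m a (pd F p m (Sum.inr i) (σ b)) +
      TH F p m (σ b) (pd F p m (Sum.inr i) (σ a)) := fun i => by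
    rw [parInv_TH, parInv_of_mem_zero ha, map_neg, pd_inr_TH,
      parInv_of_mem_zero ha, TH_comm_of_mem_one (pd_inr_mem_oPar_one ha i)]
    abel
  rw [TH_apply b f, map_sum]
  simp only [map_add, TH_mulO_of_mem_zero ha, e1, e2, map_sub]
  rw [TH_apply (σ b) (TH F p m a f), TH_apply (TH F p m a b) f]
  simp only [e3, e4, map_add, LinearMap.add_apply, parInv_pd_inl, parInv_pd_inr, parInv_parInv,
    map_neg, LinearMap.neg_apply] at hs ⊢
  simp only [Finset.sum_add_distrib, Finset.sum_sub_distrib, Finset.sum_neg_distrib] at hs ⊢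
  rw [← sub_eq_zero] at hs ⊢
  rw [← hs]
  abel

/-- The operators `T_H(a)` bracket like the functions `a` under the odd Poisson bracket
`(a, b) ↦ T_H(a)(b)`. -/
theorem superBracket_TH (a b : O F p m) :
    superBracket F p m (TH F p m a) (TH F p m b) = TH F p m (TH F p m a b) := by
  induction a using mono_induction with
  | zero => simp
  | add f f' h1 h2 => simp [h1, h2]
  | smul c f h => simp [h]
  | mono α u hα =>
  induction b using mono_induction with
  | zero => simp
  | add f f' h1 h2 => simp [h1, h2]
  | smul c f h => simp [h]
  | mono β v hβ =>
  have ha : mono F p m α u ∈ oPar F p m u.card := mono_mem_oPar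
  have hb : mono F p m β v ∈ oPar F p m v.card := mono_mem_oPar
  rw [superBracket_apply (TH_mem_endPar ha) (TH_mem_endPar hb)]
  refine LinearMap.ext fun f => ?_
  rw [LinearMap.sub_apply, LinearMap.smul_apply, Module.End.mul_apply, Module.End.mul_apply]
  generalize (u.card : ZMod 2) = θ at ha
  generalize (v.card : ZMod 2) = η at hb
  have h2 : ∀ x : ZMod 2, x = 0 ∨ x = 1 := by decide
  rcases h2 θ with rfl | rfl
  · rw [TH_TH_of_mem_zero ha]
    rcases h2 η with rfl | rfl
    · rw [parInv_of_mem_zero hb]; simp [sgn]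
    · rw [parInv_of_mem_one hb]
      have : (1 + 1 : ZMod 2) ≠ 1 := by decide
      simp [sgn, this]
  · rw [TH_TH_of_mem_one ha]
    have : (1 + 1 : ZMod 2) ≠ 1 := by decide
    simp [sgn, this]

end

/-! ### The odd Laplacian -/

variable (F p m) in
/-- The odd Laplacian `Δ = ∑_{i ≤ m} ∂_i ∂_{i'}`. -/
def lap : End F (O F p m) := ∑ i, pd F p m (Sum.inl i) * pd F p m (Sum.inr i)

local notation "Δ" => lap F p m

theorem lap_apply (f : O F p m) :
    Δ f = ∑ i, pd F p m (Sum.inl i) (pd F p m (Sum.inr i) f) := by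
  simp [lap]

theorem parInv_lap (f : O F p m) : σ (Δ f) = -Δ (σ f) := by
  simp [lap_apply, parInv_pd_inl, parInv_pd_inr]

theorem pd_inl_lap (r : Fin m) (f : O F p m) :
    pd F p m (Sum.inl r) (Δ f) = Δ (pd F p m (Sum.inl r) f) := by
  simp only [lap_apply, map_sum]
  exact Finset.sum_congr rfl fun i _ => by rw [pd_inl_pd_inl r i, pd_inl_pd_inr r i]

theorem pd_inr_lap (r : Fin m) (f : O F p m) :
    pd F p m (Sum.inr r) (Δ f) = -Δ (pd F p m (Sum.inr r) f) := by
  simp only [lap_apply, map_sum, ← Finset.sum_neg_distrib]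
  exact Finset.sum_congr rfl fun i _ => by rw [← pd_inl_pd_inr i r, pd_inr_pd_inr r i, map_neg]

theorem lap_lap (h2 : (2 : F) ≠ 0) (f : O F p m) : Δ (Δ f) = 0 := by
  have h : Δ (Δ f) = -Δ (Δ f) := by
    conv_lhs => rw [lap_apply]
    simp only [pd_inr_lap, map_neg, Finset.sum_neg_distrib, pd_inl_lap]
    rw [← map_sum, ← lap_apply]
  have h' : (2 : F) • Δ (Δ f) = 0 := by
    rw [two_smul]; nth_rewrite 1 [h]; simp
  exact (smul_eq_zero.1 h').resolve_left h2

/-- The operator `Δ` has order two, and the bracket of Hamiltonian functions measures its failure to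
be a superderivation. -/
theorem lap_mulO [CharP F p] [Fact p.Prime] (f g : O F p m) :
    Δ (f ⋆ g) = Δ f ⋆ g + σ f ⋆ Δ g + TH F p m (σ f) g := by
  simp only [lap_apply, TH_apply, map_sum, LinearMap.sum_apply, ← Finset.sum_add_distrib]
  refine Finset.sum_congr rfl fun i _ => ?_
  rw [pd_inr_mulO, map_add, pd_inl_mulO, pd_inl_mulO, parInv_parInv]
  abel

/-- On the kernel of `Δ`, the bracket of Hamiltonian functions is `Δ` of their product. -/
theorem TH_eq_lap [CharP F p] [Fact p.Prime] {a b : O F p m} (ha : Δ a = 0) (hb : Δ b = 0) :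
    TH F p m a b = Δ (σ a ⋆ b) := by
  have : Δ (σ a) = 0 := by rw [← neg_eq_zero, ← parInv_lap, ha, map_zero]
  rw [lap_mulO, hb, this, parInv_parInv]; simp

theorem TH_mem_ker_lap [CharP F p] [Fact p.Prime] (h2 : (2 : F) ≠ 0) {a b : O F p m}
    (ha : Δ a = 0) (hb : Δ b = 0) : Δ (TH F p m a b) = 0 := by
  rw [TH_eq_lap ha hb, lap_lap h2]

/-! ### The variables -/

variable (F p m) in
/-- The variable `x_k`, `k ∈ Y`. -/
def gen : Y m → O F p m :=
  Sum.elim (fun i => mono F p m (eps i) ∅) fun i => mono F p m 0 {i}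

theorem pd_gen [hp : Fact p.Prime] (r s : Y m) :
    pd F p m r (gen F p m s) = if r = s then mono F p m 0 ∅ else 0 := by
  rcases r with r | r <;> rcases s with s | s
  · simp only [gen, Sum.elim_inl, Sum.inl.injEq]
    split_ifs with h
    · subst h
      simpa using pd_inl_mono_of_ne (F := F) (p := p) (α := 0) (r := r)
        (by simpa using hp.out.one_lt.ne) ∅
    · exact pd_inl_mono_zero (eps_of_ne h) _
  · simp only [gen, Sum.elim_inr]
    rw [pd_inl_mono_zero rfl]; simp
  · simp [gen, pd_inr_mono]
  · simp only [gen, Sum.elim_inr, pd_inr_mono, Finset.mem_singleton, Sum.inr.injEq]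
    split_ifs with h
    · subst h; simp [Finset.filter_singleton]
    · rfl

theorem vf_gen [Fact p.Prime] (f : Y m → O F p m) (r : Y m) : vf F p m f (gen F p m r) = f r := by
  rw [vf_apply, Finset.sum_eq_single r]
  · simp [pd_gen, mulO_mono_one]
  · intro b _ hb; simp [pd_gen, hb]
  · simp

theorem vf_injective [Fact p.Prime] : Function.Injective (vf F p m) := fun f g h =>
  funext fun r => by rw [← vf_gen f r, ← vf_gen g r, h]

theorem TH_gen_inl [Fact p.Prime] (a : O F p m) (i : Fin m) :
    TH F p m a (gen F p m (Sum.inl i)) = pd F p m (Sum.inr i) (σ a) := by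
  rw [TH_eq_vf, vf_gen]; rfl

theorem TH_gen_inr [Fact p.Prime] (a : O F p m) (i : Fin m) :
    TH F p m a (gen F p m (Sum.inr i)) = pd F p m (Sum.inl i) a := by
  rw [TH_eq_vf, vf_gen]; rfl

theorem parInv_gen_inl (i : Fin m) : σ (gen F p m (Sum.inl i)) = gen F p m (Sum.inl i) := by
  simp [gen, parInv_mono]

theorem parInv_gen_inr (i : Fin m) : σ (gen F p m (Sum.inr i)) = -gen F p m (Sum.inr i) := by
  simp [gen, parInv_mono]

theorem gen_mem_oPar (k : Y m) : gen F p m k ∈ oPar F p m (mu k : ℕ) := by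
  rcases k with i | i
  · simpa [gen, mu] using mono_mem_oPar (F := F) (p := p) (α := eps i) (u := ∅)
  · simpa [gen, mu] using mono_mem_oPar (F := F) (p := p) (α := 0) (u := {i})

theorem TH_of_gen_inl [Fact p.Prime] (i : Fin m) :
    TH F p m (gen F p m (Sum.inl i)) = pd F p m (Sum.inr i) := by
  refine LinearMap.ext fun f => ?_
  rw [TH_apply, parInv_gen_inl, Finset.sum_eq_single i]
  · simp [pd_gen, mono_one_mulO]
  · intro b _ hb; simp [pd_gen, hb]
  · simp

theorem TH_of_gen_inr [Fact p.Prime] (i : Fin m) :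
    TH F p m (gen F p m (Sum.inr i)) = (-1 : F) • pd F p m (Sum.inl i) := by
  refine LinearMap.ext fun f => ?_
  rw [TH_apply, parInv_gen_inr, Finset.sum_eq_single i]
  · simp [pd_gen, mono_one_mulO]
  · intro b _ hb; simp [pd_gen, hb]
  · simp

/-! ### The algebra `SHO` and its derived algebras -/

theorem div_hamiltonian (a : O F p m) :
    div F p m (Sum.elim (fun i => pd F p m (Sum.inr i) (σ a)) fun i => pd F p m (Sum.inl i) a) =
      (2 : F) • Δ (σ a) := by
  rw [div, LinearMap.sum_apply, Fintype.sum_sum_type, two_smul, lap_apply]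
  simp only [LinearMap.comp_apply, LinearMap.proj_apply, Sum.elim_inl, Sum.elim_inr, mu, pow_zero,
    pow_one, Module.End.one_apply, parInv_pd_inl, pd_inl_pd_inr]

/-- The divergence of `T_H(a)` is `±2 Δ(a)`, so `SHO` corresponds to the kernel of `Δ`. -/
theorem mem_SHO_iff [Fact p.Prime] (h2 : (2 : F) ≠ 0) {D : End F (O F p m)} :
    D ∈ SHO F p m ↔ ∃ a, Δ a = 0 ∧ TH F p m a = D := by
  have hσ : ∀ a : O F p m, Δ (σ a) = 0 ↔ Δ a = 0 := fun a => by
    rw [← neg_eq_zero, ← parInv_lap]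
    exact ⟨fun h => by rw [← parInv_parInv (Δ a), h, map_zero], fun h => by rw [h, map_zero]⟩
  constructor
  · intro h
    obtain ⟨h1, h3⟩ := Submodule.mem_inf.1 h
    obtain ⟨a, rfl⟩ := LinearMap.mem_range.1 h3
    obtain ⟨f, hf, hD⟩ := Submodule.mem_map.1 h1
    refine ⟨a, ?_, rfl⟩
    rw [TH_eq_vf] at hD
    rw [LinearMap.mem_ker, vf_injective hD, div_hamiltonian] at hf
    exact (hσ a).1 ((smul_eq_zero.1 hf).resolve_left h2)
  · rintro ⟨a, ha, rfl⟩
    refine Submodule.mem_inf.2 ⟨Submodule.mem_map.2 ⟨_, ?_, (TH_eq_vf a).symm⟩,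
      LinearMap.mem_range.2 ⟨a, rfl⟩⟩
    rw [LinearMap.mem_ker, div_hamiltonian, (hσ a).2 ha, smul_zero]

theorem isSubalg_SHO [CharP F p] [Fact p.Prime] (h2 : (2 : F) ≠ 0) :
    IsSubalg F p m (SHO F p m) := by
  intro D hD E hE
  obtain ⟨a, ha, rfl⟩ := (mem_SHO_iff h2).1 hD
  obtain ⟨b, hb, rfl⟩ := (mem_SHO_iff h2).1 hE
  rw [superBracket_TH]
  exact (mem_SHO_iff h2).2 ⟨_, TH_mem_ker_lap h2 ha hb, rfl⟩

theorem derived_le {X : Submodule F (End F (O F p m))} (hX : IsSubalg F p m X) :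
    derived F p m X ≤ X :=
  Submodule.map₂_le.2 fun D hD E hE => hX D hD E hE

theorem isSubalg_derived {X : Submodule F (End F (O F p m))} (hX : IsSubalg F p m X) :
    IsSubalg F p m (derived F p m X) := fun _ hD _ hE =>
  Submodule.apply_mem_map₂ _ (derived_le hX hD) (derived_le hX hE)

theorem isSubalg_SHO2 [CharP F p] [Fact p.Prime] (h2 : (2 : F) ≠ 0) :
    IsSubalg F p m (SHO2 F p m) :=
  isSubalg_derived (isSubalg_derived (isSubalg_SHO h2))

/-- Brackets of elements of the kernel of `Δ` lie in its image. -/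
theorem SHO2_le [CharP F p] [Fact p.Prime] (h2 : (2 : F) ≠ 0) :
    SHO2 F p m ≤ (LinearMap.range Δ).map (TH F p m) := by
  refine (derived_le (isSubalg_derived (isSubalg_SHO h2))).trans ?_
  refine Submodule.map₂_le.2 fun D hD E hE => ?_
  obtain ⟨a, ha, rfl⟩ := (mem_SHO_iff h2).1 hD
  obtain ⟨b, hb, rfl⟩ := (mem_SHO_iff h2).1 hE
  rw [superBracket_TH]
  exact ⟨_, ⟨_, rfl⟩, by rw [TH_eq_lap ha hb]⟩

/-! ### The `ℤ`-grading -/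

theorem mem_oDeg_iff {n : ℤ} {f : O F p m} :
    f ∈ oDeg F p m n ↔
      ∀ a, f a ≠ 0 → (((∑ i, (a.1 i : ℕ)) + a.2.card : ℕ) : ℤ) = n := by
  have : oDeg F p m n = Finsupp.supported F F
      {a : Idx p m | (((∑ i, (a.1 i : ℕ)) + a.2.card : ℕ) : ℤ) = n} := by
    rw [Finsupp.supported_eq_span_single, oDeg]
    congr 1; ext f; simp only [Set.mem_ofPred_eq, Set.mem_image]
    exact ⟨fun ⟨a, h, e⟩ => ⟨a, h, e.symm⟩, fun ⟨a, h, e⟩ => ⟨a, h, e.symm⟩⟩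
  rw [this, Finsupp.mem_supported]
  simp [Set.subset_def]

theorem mem_oPar_iff {θ : ZMod 2} {f : O F p m} :
    f ∈ oPar F p m θ ↔ ∀ a, f a ≠ 0 → (a.2.card : ZMod 2) = θ := by
  have : oPar F p m θ = Finsupp.supported F F {a : Idx p m | (a.2.card : ZMod 2) = θ} := by
    rw [Finsupp.supported_eq_span_single, oPar]
    congr 1; ext f; simp only [Set.mem_ofPred_eq, Set.mem_image]
    exact ⟨fun ⟨a, h, e⟩ => ⟨a, h, e.symm⟩, fun ⟨a, h, e⟩ => ⟨a, h, e.symm⟩⟩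
  rw [this, Finsupp.mem_supported]
  simp [Set.subset_def]

theorem mono_apply (α : Fin m → ℕ) (u : Finset (Fin m)) (a : Idx p m) :
    mono F p m α u a = if (∀ i, α i = a.1 i) ∧ u = a.2 then 1 else 0 := by
  by_cases h : ∀ i, α i < p
  · rw [mono_of_lt h, Finsupp.single_apply]
    congr 1
    rw [Prod.ext_iff, funext_iff]
    simp [Fin.ext_iff]
  · rw [mono, dif_neg h, if_neg]
    · rfl
    · exact fun h' => h fun i => by rw [h'.1 i]; exact (a.1 i).2

theorem mono_mem_oDeg {α : Fin m → ℕ} {u : Finset (Fin m)} {n : ℤ}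
    (h : (((∑ i, α i) + u.card : ℕ) : ℤ) = n) : mono F p m α u ∈ oDeg F p m n := by
  refine mem_oDeg_iff.2 fun a ha => ?_
  rw [mono_apply] at ha
  have := (ite_ne_right_iff.1 ha).1
  rw [← h, ← this.2]
  simp [this.1]

theorem sum_add_eps (α : Fin m → ℕ) (r : Fin m) : ∑ i, (α + eps r) i = (∑ i, α i) + 1 := by
  simp [Finset.sum_add_distrib, eps_apply]

theorem pd_mem_oDeg {n : ℤ} {f : O F p m} (hf : f ∈ oDeg F p m n) (r : Y m) :
    pd F p m r f ∈ oDeg F p m (n - 1) := by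
  induction hf using Submodule.span_induction with
  | mem x hx =>
    obtain ⟨a, ha, rfl⟩ := hx
    rw [← mono_val a]
    rcases r with r | r
    · by_cases h : (a.1 r : ℕ) = 0
      · rw [pd_inl_mono_zero (α := fun i => (a.1 i : ℕ)) h]; exact Submodule.zero_mem _
      · obtain ⟨β, hβ⟩ := exists_eq_add_eps (α := fun i => (a.1 i : ℕ)) h
        rw [hβ, pd_inl_mono_add (fun i => by rw [← hβ]; exact (a.1 i).2)]
        refine mono_mem_oDeg ?_
        have h1 : ∑ i, (a.1 i : ℕ) = (∑ i, β i) + 1 := by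
          rw [← sum_add_eps β r, ← hβ]
        rw [← ha, h1]; push_cast; ring
    · rw [pd_inr_mono]
      split_ifs with h
      · refine Submodule.smul_mem _ _ (mono_mem_oDeg ?_)
        rw [← ha, ← Finset.card_erase_add_one h]; push_cast; ring
      · exact Submodule.zero_mem _
  | zero => simp
  | add x y _ _ hx hy => rw [map_add]; exact Submodule.add_mem _ hx hy
  | smul c x _ hx => rw [map_smul]; exact Submodule.smul_mem _ _ hx

theorem parInv_mem_oDeg {n : ℤ} {f : O F p m} (hf : f ∈ oDeg F p m n) : σ f ∈ oDeg F p m n := by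
  induction hf using Submodule.span_induction with
  | mem x hx =>
    obtain ⟨a, ha, rfl⟩ := hx
    rw [← mono_val a, parInv_mono]
    exact Submodule.smul_mem _ _ (mono_mem_oDeg ha)
  | zero => simp
  | add x y _ _ hx hy => rw [map_add]; exact Submodule.add_mem _ hx hy
  | smul c x _ hx => rw [map_smul]; exact Submodule.smul_mem _ _ hx

theorem eq_zero_of_mem_oDeg_neg {n : ℤ} (hn : n < 0) {f : O F p m} (hf : f ∈ oDeg F p m n) :
    f = 0 := by
  ext a
  by_contra h
  have := mem_oDeg_iff.1 hf a h
  omega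

theorem eq_zero_of_mem_oDeg_of_ne {n k : ℤ} (hn : n ≠ k) {f : O F p m} (hf : f ∈ oDeg F p m n)
    (hk : f ∈ oDeg F p m k) : f = 0 := by
  ext a
  by_contra h
  exact hn ((mem_oDeg_iff.1 hf a h).symm.trans (mem_oDeg_iff.1 hk a h))

/-- Every coefficient other than the constant one can be read off from a partial derivative. -/
theorem exists_pd_apply_eq (a : Idx p m) (ha : (∃ i, (a.1 i : ℕ) ≠ 0) ∨ a.2.Nonempty) :
    ∃ (r : Y m) (a' : Idx p m) (c : F), c ≠ 0 ∧ (∀ f, pd F p m r f a' = c * f a) ∧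
      (∑ i, (a.1 i : ℕ)) + a.2.card = (∑ i, (a'.1 i : ℕ)) + a'.2.card + 1 ∧
      a.2.card = a'.2.card + mu r := by
  rcases ha with ⟨r, hr⟩ | ⟨r, hr⟩
  · obtain ⟨β, hβ⟩ := exists_eq_add_eps (α := fun i => (a.1 i : ℕ)) hr
    have hβ' : ∀ i, (a.1 i : ℕ) = β i + eps r i := fun i => congrFun hβ i
    have hlt : ∀ i, β i < p := fun i => by have := hβ' i; have := (a.1 i).2; omega
    refine ⟨Sum.inl r, (fun i => ⟨β i, hlt i⟩, a.2), 1, one_ne_zero, fun f => ?_, ?_, by simp [mu]⟩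
    · have : (Finsupp.lapply (fun i => ⟨β i, hlt i⟩, a.2) ∘ₗ pd F p m (Sum.inl r) :
          O F p m →ₗ[F] F) = Finsupp.lapply a := by
        refine linearMap_ext_mono fun α u hα => ?_
        simp only [LinearMap.comp_apply, Finsupp.lapply_apply]
        by_cases h : α r = 0
        · rw [pd_inl_mono_zero h, mono_apply, if_neg]
          · rfl
          · rintro ⟨h1, -⟩; exact hr (by rw [← h1, h])
        · obtain ⟨γ, rfl⟩ := exists_eq_add_eps h
          rw [pd_inl_mono_add hα, mono_apply, mono_apply]
          simp [hβ']
      simpa using LinearMap.congr_fun this f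
    · have h1 : ∑ i, (a.1 i : ℕ) = (∑ i, β i) + 1 := by
        rw [← sum_add_eps β r]; exact Finset.sum_congr rfl fun i _ => hβ' i
      rw [h1]; simp only; ring
  · refine ⟨Sum.inr r, (a.1, a.2.erase r), (-1) ^ (a.2.filter fun k => k < r).card, by simp,
      fun f => ?_, ?_, (Finset.card_erase_add_one hr).symm⟩
    · have : (Finsupp.lapply (a.1, a.2.erase r) ∘ₗ pd F p m (Sum.inr r) : O F p m →ₗ[F] F) =
          ((-1 : F) ^ (a.2.filter fun k => k < r).card) • Finsupp.lapply a := by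
        refine linearMap_ext_mono fun α u hα => ?_
        simp only [LinearMap.comp_apply, Finsupp.lapply_apply, LinearMap.smul_apply, pd_inr_mono,
          mono_apply]
        split_ifs with h h1 h1
        · rw [Finsupp.smul_apply, mono_apply, if_pos, h1.2]
          exact ⟨h1.1, by rw [h1.2]⟩
        · rw [Finsupp.smul_apply, mono_apply, if_neg]
          · simp
          · rintro ⟨h2, h3⟩
            simp only at h3
            exact h1 ⟨h2, by rw [← Finset.insert_erase h, ← Finset.insert_erase hr, h3]⟩
        · exact absurd (h1.2 ▸ hr) h
        · simp
      simpa using LinearMap.congr_fun this f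
    · simp only; rw [← Finset.card_erase_add_one hr]; ring

theorem eq_smul_one_of_forall [hp : Fact p.Prime] {f : O F p m}
    (h : ∀ a : Idx p m, (∃ i, (a.1 i : ℕ) ≠ 0) ∨ a.2.Nonempty → f a = 0) :
    ∃ c : F, f = c • mono F p m 0 ∅ := by
  refine ⟨f (fun _ => ⟨0, hp.out.pos⟩, ∅), Finsupp.ext fun a => ?_⟩
  rw [Finsupp.smul_apply, mono_apply]
  split_ifs with h'
  · rw [smul_eq_mul, mul_one]
    congr 1
    refine Prod.ext (funext fun i => Fin.ext (h'.1 i).symm) h'.2.symm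
  · rw [smul_zero]
    apply h
    by_contra hc
    push Not at hc
    exact h' ⟨fun i => (hc.1 i).symm, hc.2.symm⟩

/-- The common kernel of the `∂_r` consists of the constants. -/
theorem eq_smul_one_of_pd [Fact p.Prime] {f : O F p m} (h : ∀ r, pd F p m r f = 0) :
    ∃ c : F, f = c • mono F p m 0 ∅ := by
  refine eq_smul_one_of_forall fun a ha => ?_
  obtain ⟨r, a', c, hc, hf, -⟩ := exists_pd_apply_eq (F := F) a ha
  have := hf f
  rw [h r] at this
  exact (mul_eq_zero.1 this.symm).resolve_left hc

theorem TH_one : TH F p m (mono F p m 0 ∅) = 0 := by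
  refine LinearMap.ext fun f => ?_
  simp [TH_apply, parInv_mono, pd_inl_mono_zero, pd_inr_mono]

/-- An element of `HO` has a Hamiltonian function that is homogeneous for each of the gradings
for which the element is homogeneous. -/
theorem exists_TH_eq [Fact p.Prime] (c : O F p m) :
    ∃ b, TH F p m b = TH F p m c ∧
      (∀ n : ℤ, (∀ k, TH F p m c (gen F p m k) ∈ oDeg F p m (n - 1)) → b ∈ oDeg F p m n) ∧
      ∀ θ : ZMod 2, TH F p m c ∈ endPar F p m (θ + 1) → b ∈ oPar F p m θ := by
  classical
  set P : Idx p m → Prop := fun a => (∃ i, (a.1 i : ℕ) ≠ 0) ∨ a.2.Nonempty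
  refine ⟨c.filter P, ?_, fun n hn => ?_, fun θ hθ => ?_⟩
  · obtain ⟨d, hd⟩ := eq_smul_one_of_forall (f := c - c.filter P) fun a ha => by
      rw [Finsupp.sub_apply, Finsupp.filter_apply_pos P _ ha, sub_self]
    have := congrArg (TH F p m) hd
    rw [map_sub, map_smul, TH_one, smul_zero, sub_eq_zero] at this
    exact this.symm
  · refine mem_oDeg_iff.2 fun a ha => ?_
    have haP : P a := by
      by_contra h; exact ha (Finsupp.filter_apply_neg _ _ h)
    rw [Finsupp.filter_apply_pos _ _ haP] at ha
    obtain ⟨r, a', d, hd, hf, hdeg, -⟩ := exists_pd_apply_eq (F := F) a haP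
    have hmem : pd F p m r c ∈ oDeg F p m (n - 1) := by
      rcases r with r | r
      · rw [← TH_gen_inr]; exact hn _
      · have := parInv_mem_oDeg (hn (Sum.inl r))
        rw [TH_gen_inl, parInv_pd_inr, parInv_parInv] at this
        exact (Submodule.neg_mem_iff _).1 this
    have := mem_oDeg_iff.1 hmem a' (by rw [hf]; exact mul_ne_zero hd ha)
    rw [hdeg]; push_cast at this ⊢; omega
  · refine mem_oPar_iff.2 fun a ha => ?_
    have haP : P a := by
      by_contra h; exact ha (Finsupp.filter_apply_neg _ _ h)
    rw [Finsupp.filter_apply_pos _ _ haP] at ha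
    obtain ⟨r, a', d, hd, hf, -, hcard⟩ := exists_pd_apply_eq (F := F) a haP
    have hmem : pd F p m r c ∈ oPar F p m (θ + mu r) := by
      rcases r with r | r
      · rw [← TH_gen_inr]
        have := hθ (mu (Sum.inr r) : ℕ) (gen F p m (Sum.inr r)) (gen_mem_oPar _)
        simpa [mu, add_left_comm (1 : ZMod 2) θ, show (1 + 1 : ZMod 2) = 0 by decide] using this
      · have := hθ (mu (Sum.inl r) : ℕ) (gen F p m (Sum.inl r)) (gen_mem_oPar _)
        have := parInv_mem_oPar this
        rw [TH_gen_inl, parInv_pd_inr, parInv_parInv] at this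
        simpa [mu] using this
    have := mem_oPar_iff.1 hmem a' (by rw [hf]; exact mul_ne_zero hd ha)
    have h2 : ∀ x : ZMod 2, x + x = 0 := by decide
    rw [hcard, Nat.cast_add, this, add_assoc, h2, add_zero]

theorem apply_gen_mem_oDeg [Fact p.Prime] {n : ℤ} {D : End F (O F p m)} (hD : D ∈ wDeg F p m n)
    (k : Y m) : D (gen F p m k) ∈ oDeg F p m (n + 1) := by
  induction hD using Submodule.span_induction with
  | mem x hx =>
    obtain ⟨r, f, hf, rfl⟩ := hx
    rw [vf_gen]
    by_cases h : k = r
    · subst h; simpa using hf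
    · rw [Pi.single_eq_of_ne h]; exact Submodule.zero_mem _
  | zero => simp
  | add x y _ _ hx hy => exact Submodule.add_mem _ hx hy
  | smul c x _ hx => exact Submodule.smul_mem _ _ hx

theorem TH_mem_wDeg {n : ℤ} {a : O F p m} (ha : a ∈ oDeg F p m n) :
    TH F p m a ∈ wDeg F p m (n - 2) := by
  rw [TH_eq_vf, ← Finset.univ_sum_single (Sum.elim _ _), map_sum]
  refine Submodule.sum_mem _ fun r _ => Submodule.subset_span ⟨r, _, ?_, rfl⟩
  rw [show n - 2 + 1 = n - 1 by ring]
  rcases r with r | r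
  · exact pd_mem_oDeg (parInv_mem_oDeg ha) _
  · exact pd_mem_oDeg ha _

/-! ### Clean monomials -/

/-- A nonzero monomial `x^(β) x^v` is *clean* if no variable occurs in it together with its
conjugate, and if `β l < p - 1` for some `l ∉ v`. By the first condition it is in the kernel of `Δ`,
by the second one in the image. -/
structure IsClean (p : ℕ) (β : Fin m → ℕ) (v : Finset (Fin m)) : Prop where
  lt : ∀ i, β i < p
  eq_zero : ∀ i ∈ v, β i = 0
  exists_lt : ∃ l ∉ v, β l + 1 < p

theorem lap_mono_eq_zero {β : Fin m → ℕ} {v : Finset (Fin m)} (h : ∀ i ∈ v, β i = 0) :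
    Δ (mono F p m β v) = 0 := by
  rw [lap_apply]
  refine Finset.sum_eq_zero fun i _ => ?_
  rw [pd_inr_mono]
  split_ifs with hi
  · rw [map_smul, pd_inl_mono_zero (h i hi), smul_zero]
  · exact map_zero _

theorem lap_mono_insert {β : Fin m → ℕ} {v : Finset (Fin m)} {l : Fin m}
    (h : ∀ i ∈ v, β i = 0) (hl : l ∉ v) (hlt : β l + 1 ≠ p) :
    ∃ c : F, c ≠ 0 ∧ Δ (mono F p m (β + eps l) (insert l v)) = c • mono F p m β v := by
  refine ⟨(-1) ^ ((insert l v).filter fun k => k < l).card, by simp, ?_⟩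
  rw [lap_apply, Finset.sum_eq_single l]
  · rw [pd_inr_mono, if_pos (Finset.mem_insert_self _ _), map_smul, pd_inl_mono_of_ne hlt,
      Finset.erase_insert hl]
  · intro i _ hi
    rw [pd_inr_mono]
    split_ifs with hi'
    · have : i ∈ v := Finset.mem_of_mem_insert_of_ne hi' hi
      rw [map_smul, pd_inl_mono_zero (by simp [h i this, eps_of_ne hi]), smul_zero]
    · exact map_zero _
  · simp

section

variable [CharP F p] [Fact p.Prime]

theorem mulO_mono_of_disjoint {α β : Fin m → ℕ} {u v : Finset (Fin m)} (huv : Disjoint u v)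
    (h : ∀ i, α i + β i < p) :
    ∃ c : F, c ≠ 0 ∧ mono F p m α u ⋆ mono F p m β v = c • mono F p m (α + β) (u ∪ v) := by
  refine ⟨_, ?_, by rw [mulO_mono, if_pos huv]⟩
  refine mul_ne_zero (Finset.prod_ne_zero_iff.2 fun i _ => ?_) (mulSign_ne_zero _ _)
  rw [Ne, CharP.cast_eq_zero_iff F p]
  intro hd
  have := (Nat.choose_mul_factorial_mul_factorial (Nat.le_add_right (α i) (β i))) ▸
    (hd.mul_right (α i).factorial).mul_right (α i + β i - α i).factorial
  exact absurd ((Fact.out : p.Prime).dvd_factorial.1 this) (by have := h i; omega)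

theorem TH_mono_mono {β γ : Fin m → ℕ} {v w : Finset (Fin m)} (hβ : ∀ i ∈ v, β i = 0)
    (hγ : ∀ i ∈ w, γ i = 0) (hvw : Disjoint v w) (h : ∀ i, β i + γ i < p) :
    ∃ c : F, c ≠ 0 ∧ TH F p m (mono F p m β v) (mono F p m γ w) =
      c • Δ (mono F p m (β + γ) (v ∪ w)) := by
  obtain ⟨c, hc, h1⟩ := mulO_mono_of_disjoint (F := F) hvw h
  refine ⟨(-1) ^ v.card * c, mul_ne_zero (by simp) hc, ?_⟩
  rw [TH_eq_lap (lap_mono_eq_zero hβ) (lap_mono_eq_zero hγ), parInv_mono, map_smul,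
    LinearMap.smul_apply, map_smul, h1, map_smul, smul_smul]

/-- A clean monomial is the bracket of two factors of `x_l x_{l'}` times it, one containing `x_l`
and the other `x_{l'}`. -/
theorem TH_factors {β₁ β₂ : Fin m → ℕ} {v₁ v₂ : Finset (Fin m)} {l : Fin m}
    (h₁ : ∀ i ∈ v₁ ∪ v₂, β₁ i + β₂ i = 0) (hv : Disjoint v₁ v₂) (hl : l ∉ v₁ ∪ v₂) (hl₂ : β₂ l = 0)
    (hlt : ∀ i, β₁ i + β₂ i + eps l i < p) :
    ∃ c : F, c ≠ 0 ∧ TH F p m (mono F p m (β₁ + eps l) v₁) (mono F p m β₂ (insert l v₂)) =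
      c • mono F p m (β₁ + β₂) (v₁ ∪ v₂) := by
  simp only [Finset.mem_union, not_or] at hl h₁
  obtain ⟨c, hc, h⟩ := TH_mono_mono (F := F) (p := p) (β := β₁ + eps l) (γ := β₂) (v := v₁)
    (w := insert l v₂)
    (fun i hi => by
      have : i ≠ l := fun e => hl.1 (e ▸ hi)
      have := h₁ i (Or.inl hi)
      simp [eps_of_ne ‹i ≠ l›]; omega)
    (fun i hi => by
      rcases Finset.mem_insert.1 hi with rfl | hi
      · exact hl₂
      · have := h₁ i (Or.inr hi); omega)
    (Finset.disjoint_insert_right.2 ⟨hl.1, hv⟩)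
    (fun i => by have := hlt i; simp; omega)
  obtain ⟨d, hd, h'⟩ := lap_mono_insert (F := F) (p := p) (β := β₁ + β₂) (v := v₁ ∪ v₂) (l := l)
    (fun i hi => h₁ i (Finset.mem_union.1 hi)) (by simp [hl])
    (by have := hlt l; simp at this ⊢; omega)
  refine ⟨c * d, mul_ne_zero hc hd, ?_⟩
  rw [h, Finset.union_insert, add_right_comm, h', smul_smul]

end

/-! ### Factorisations of clean monomials -/

theorem exists_factor (β : Fin m → ℕ) (v : Finset (Fin m)) {k : ℕ}
    (hk : k ≤ ∑ i, β i + v.card) :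
    ∃ β' : Fin m → ℕ, ∃ v' ⊆ v, (∀ i, β' i ≤ β i) ∧ ∑ i, β' i + v'.card = k := by
  induction k with
  | zero => exact ⟨0, ∅, by simp, by simp, by simp⟩
  | succ k ih =>
    obtain ⟨β', v', hv, hβ, hs⟩ := ih (by omega)
    by_cases h : v' = v
    · subst h
      obtain ⟨i, -, hi⟩ := Finset.exists_lt_of_sum_lt (s := Finset.univ) (f := β')
        (g := β) (by omega)
      refine ⟨β' + eps i, v', hv, fun j => ?_, by rw [sum_add_eps]; omega⟩
      by_cases hj : j = i
      · subst hj; simp; omega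
      · simpa [eps_of_ne hj] using hβ j
    · obtain ⟨i, hi, hi'⟩ := Finset.exists_of_ssubset (hv.ssubset_of_ne h)
      exact ⟨β', insert i v', Finset.insert_subset hi hv, hβ,
        by rw [Finset.card_insert_of_notMem hi']; omega⟩

theorem exists_unused (β : Fin m → ℕ) (v : Finset (Fin m)) (h : ∑ i, β i + v.card < m) :
    ∃ l ∉ v, β l = 0 := by
  have h1 : (Finset.univ.filter fun i => β i ≠ 0).card ≤ ∑ i, β i := by
    rw [Finset.card_filter]
    exact Finset.sum_le_sum fun i _ => by split_ifs <;> omega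
  have h2 : ((Finset.univ.filter fun i => β i ≠ 0) ∪ v).card < m :=
    (Finset.card_union_le _ _).trans_lt (by omega)
  obtain ⟨l, hl⟩ : ∃ l, l ∉ (Finset.univ.filter fun i => β i ≠ 0) ∪ v := by
    by_contra hc
    push Not at hc
    rw [Finset.eq_univ_iff_forall.2 hc] at h2
    simp at h2
  simp only [Finset.mem_union, Finset.mem_filter, Finset.mem_univ, true_and, not_or, not_not] at hl
  exact ⟨l, hl.2, hl.1⟩

theorem isClean_of_lt {β : Fin m → ℕ} {v : Finset (Fin m)} (hp : 1 < p) (h1 : ∀ i, β i < p)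
    (h2 : ∀ i ∈ v, β i = 0) (h : ∑ i, β i + v.card < m) : IsClean p β v := by
  obtain ⟨l, hl, h0⟩ := exists_unused β v h
  exact ⟨h1, h2, l, hl, by omega⟩

section

variable [CharP F p] [hp : Fact p.Prime]

variable (F) in
/-- If `x_l x_{l'}` times a clean monomial is not zero, then every choice of a factor `x^(β₂) x^v₂`
of the monomial without `x_l` writes it as a bracket of two monomials in the kernel of `Δ`: the
chosen factor is multiplied by `x_{l'}` and the complementary one by `x_l`. -/
theorem IsClean.exists_TH_eq_smul {β β₂ : Fin m → ℕ} {v v₂ : Finset (Fin m)} {l : Fin m}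
    (h : IsClean p β v) (hl : l ∉ v) (hlp : β l + 1 < p) (hβ₂ : ∀ i, β₂ i ≤ β i) (hβl : β₂ l = 0)
    (hv : v₂ ⊆ v) :
    (∀ i, (β - β₂ + eps l) i < p) ∧ (∀ i ∈ v \ v₂, (β - β₂ + eps l) i = 0) ∧
      (∀ i ∈ insert l v₂, β₂ i = 0) ∧
      (∑ i, (β - β₂ + eps l) i + (v \ v₂).card) + (∑ i, β₂ i + v₂.card) =
        ∑ i, β i + v.card + 1 ∧
      (insert l v₂).card = v₂.card + 1 ∧
      ∃ c : F, c ≠ 0 ∧ TH F p m (mono F p m (β - β₂ + eps l) (v \ v₂))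
        (mono F p m β₂ (insert l v₂)) = c • mono F p m β v := by
  have hadd : β - β₂ + β₂ = β := funext fun i => by
    have := hβ₂ i; simp; omega
  have hun : (v \ v₂) ∪ v₂ = v := Finset.sdiff_union_of_subset hv
  have hlt : ∀ i, β i + eps l i < p := fun i => by
    by_cases hi : i = l
    · subst hi; simpa using hlp
    · simpa [eps_of_ne hi] using h.lt i
  have hsub : ∑ i, (β - β₂) i + ∑ i, β₂ i = ∑ i, β i := by
    rw [← Finset.sum_add_distrib]
    exact Finset.sum_congr rfl fun i _ => congrFun hadd i
  have hcard := Finset.card_sdiff_add_card_eq_card hv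
  refine ⟨fun i => ?_, fun i hi => ?_, fun i hi => ?_, ?_,
    Finset.card_insert_of_notMem fun e => hl (hv e), ?_⟩
  · have := hlt i; simp; omega
  · have hi' := (Finset.mem_sdiff.1 hi).1
    have : i ≠ l := fun e => hl (e ▸ hi')
    simp [eps_of_ne this, h.eq_zero i hi']
  · rcases Finset.mem_insert.1 hi with rfl | hi
    · exact hβl
    · have := hβ₂ i; have := h.eq_zero i (hv hi); omega
  · rw [sum_add_eps]; omega
  · obtain ⟨c, hc, h'⟩ := TH_factors (F := F) (p := p) (β₁ := β - β₂) (β₂ := β₂)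
      (v₁ := v \ v₂) (v₂ := v₂) (l := l)
      (fun i hi => by rw [hun] at hi; have := h.eq_zero i hi; have := hβ₂ i; simp; omega)
      Finset.sdiff_disjoint (by rwa [hun]) hβl
      (fun i => by have := hlt i; have := hβ₂ i; simp; omega)
    exact ⟨c, hc, by rw [h', hadd, hun]⟩

variable (F) in
/-- A clean monomial of degree at least `4` is the bracket of two others of smaller degree, or of
degree `3`. -/
theorem exists_TH_eq_of_four_le (hm : 3 < m) {β : Fin m → ℕ} {v : Finset (Fin m)}
    (h : IsClean p β v) (hd : 4 ≤ ∑ i, β i + v.card) :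
    ∃ β₁ v₁ β₂ v₂, IsClean p β₁ v₁ ∧ IsClean p β₂ v₂ ∧
      ∑ i, β₁ i + v₁.card + 1 = ∑ i, β i + v.card ∧ ∑ i, β₂ i + v₂.card = 3 ∧
      ∃ c : F, c ≠ 0 ∧ TH F p m (mono F p m β₁ v₁) (mono F p m β₂ v₂) = c • mono F p m β v := by
  have hp1 := hp.out.one_lt
  have hsum : ∀ l, ∑ i, Function.update β l 0 i + β l = ∑ i, β i := fun l => by
    rw [← Finset.sum_erase_add _ _ (Finset.mem_univ l),
      ← Finset.sum_erase_add (a := l) _ β (Finset.mem_univ l)]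
    simp only [Function.update_self, add_zero]
    congr 1
    exact Finset.sum_congr rfl fun i hi => Function.update_of_ne (Finset.ne_of_mem_erase hi) _ _
  -- there is room to move two variables other than `x_l` to the second factor
  obtain ⟨l, hl, hlp, hl2⟩ : ∃ l ∉ v, β l + 1 < p ∧
      2 ≤ ∑ i, Function.update β l 0 i + v.card := by
    obtain ⟨l₀, h1, h2⟩ := h.exists_lt
    by_cases h3 : 2 ≤ ∑ i, Function.update β l₀ 0 i + v.card
    · exact ⟨l₀, h1, h2, h3⟩
    have hs0 := hsum l₀
    obtain ⟨l, hl, hl0⟩ := exists_unused (Function.update β l₀ 0) (insert l₀ v)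
      (by rw [Finset.card_insert_of_notMem h1]; omega)
    simp only [Finset.mem_insert, not_or] at hl
    rw [Function.update_of_ne hl.1] at hl0
    have hs := hsum l
    exact ⟨l, hl.2, by omega, by omega⟩
  obtain ⟨β₂, v₂, hv, hβ, hs⟩ := exists_factor _ _ hl2
  have hβ₂ : ∀ i, β₂ i ≤ β i := fun i => by
    by_cases hi : i = l
    · subst hi; have := hβ i; simp at this; omega
    · simpa [hi] using hβ i
  have hβl : β₂ l = 0 := by simpa using hβ l
  obtain ⟨h1, h2, h3, h4, h5, h6⟩ := h.exists_TH_eq_smul F hl hlp hβ₂ hβl hv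
  have hsuml := hsum l
  refine ⟨_, _, _, _, ⟨h1, h2, ?_⟩, isClean_of_lt hp1 (fun i => (hβ₂ i).trans_lt (h.lt i)) h3
    (by omega), by omega, by omega, h6⟩
  by_cases hv2 : v₂ = ∅
  · subst hv2
    obtain ⟨i, -, hi⟩ := Finset.exists_ne_zero_of_sum_ne_zero (s := Finset.univ) (f := β₂)
      (by simp at hs; omega)
    have hil : i ≠ l := fun e => hi (e ▸ hβl)
    have h1 := hβ₂ i
    have h2 := h.lt i
    refine ⟨i, fun hiv => ?_, ?_⟩
    · have := h.eq_zero i (by simpa using hiv); omega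
    · simp [eps_of_ne hil]; omega
  · obtain ⟨i, hi⟩ := Finset.nonempty_iff_ne_empty.2 hv2
    have hil : i ≠ l := fun e => hl (e ▸ hv hi)
    exact ⟨i, by simp [hi], by simp [eps_of_ne hil, h.eq_zero i (hv hi)]; omega⟩

variable (F) in
/-- A clean monomial of degree at most `3` leaves a pair of conjugate variables unused, and this
pair can be split between the two factors. -/
theorem exists_TH_eq_of_le_three (hm : 3 < m) (hp2 : 2 < p) {β : Fin m → ℕ} {v : Finset (Fin m)}
    (h : IsClean p β v) (hd : ∑ i, β i + v.card ≤ 3) :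
    ∃ β₁ v₁ β₂ v₂, IsClean p β₁ v₁ ∧ IsClean p β₂ v₂ ∧
      ∃ c : F, c ≠ 0 ∧ TH F p m (mono F p m β₁ v₁) (mono F p m β₂ v₂) = c • mono F p m β v := by
  obtain ⟨l, hl, hl0⟩ := exists_unused β v (by omega)
  have hlt : ∀ i, β i + eps l i < p := fun i => by
    by_cases hi : i = l
    · subst hi; simp; omega
    · simpa [eps_of_ne hi] using h.lt i
  refine ⟨β + eps l, v, 0, {l}, ⟨hlt, fun i hi => ?_, l, hl, by simp; omega⟩,
    isClean_of_lt hp.out.one_lt (fun i => hp.out.pos) (by simp) (by simp; omega), ?_⟩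
  · have : i ≠ l := fun e => hl (e ▸ hi)
    simp [eps_of_ne this, h.eq_zero i hi]
  · obtain ⟨c, hc, h'⟩ := TH_factors (F := F) (p := p) (β₁ := β) (β₂ := 0) (v₁ := v) (v₂ := ∅)
      (l := l) (by simpa using h.eq_zero) (by simp) (by simpa using hl) rfl (by simpa using hlt)
    exact ⟨c, hc, by simpa using h'⟩

end

/-! ### Weights -/

variable (F) in
/-- The weight of `x^(α) x^u` under the `x_i x_{i'}`: up to sign, `x_i x_{i'} - x_j x_{j'}` acts on
the monomial by the scalar `wt F α u i - wt F α u j`. -/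
def wt (α : Fin m → ℕ) (u : Finset (Fin m)) (i : Fin m) : F := α i - if i ∈ u then 1 else 0

/-- A weight is *exceptional* if it differs from the weights of all variables, as a functional on
the torus spanned by the `x_i x_{i'} - x_j x_{j'}`. -/
def Exceptional (w : Fin m → F) : Prop :=
  ∀ (k : Fin m) (s : F), s = 1 ∨ s = -1 →
    ∃ i j, w i - w j ≠ s * ((if i = k then 1 else 0) - if j = k then 1 else 0)

/-- Weights of variables take only two different values on the positions `1, …, m`. -/
theorem exceptional_of_ne {w : Fin m → F} {i j l : Fin m} (h₁ : w i ≠ w j) (h₂ : w j ≠ w l)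
    (h₃ : w i ≠ w l) : Exceptional w := by
  have key : ∀ (k : Fin m) (s : F) (i j : Fin m), w i ≠ w j → i ≠ k → j ≠ k →
      ∃ i j, w i - w j ≠ s * ((if i = k then 1 else 0) - if j = k then 1 else 0) :=
    fun k s i j h hi hj => ⟨i, j, by simpa [hi, hj, sub_eq_zero] using h⟩
  intro k s _
  have hij : i ≠ j := fun e => h₁ (by rw [e])
  have hjl : j ≠ l := fun e => h₂ (by rw [e])
  have hil : i ≠ l := fun e => h₃ (by rw [e])
  by_cases hi : i = k
  · subst hi; exact key i s j l h₂ hij.symm hil.symm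
  · by_cases hj : j = k
    · subst hj; exact key j s i l h₃ hij hjl.symm
    · exact key k s i j h₁ hi hj

variable (F p) in
theorem natCast_ne_zero [CharP F p] {n : ℕ} (h0 : n ≠ 0) (h : n < p) : (n : F) ≠ 0 := fun e =>
  absurd (Nat.le_of_dvd (Nat.pos_of_ne_zero h0) ((CharP.cast_eq_zero_iff F p n).1 e)) (by omega)

variable (F) in
/-- No weight of a clean quadratic monomial is the weight of a variable. With `2 ε_k` against
`± ε_k`, here `p > 3` is needed. -/
theorem exceptional_wt_of_degree_two [CharP F p] (hm : 3 < m) (hp3 : 3 < p) {β : Fin m → ℕ}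
    {v : Finset (Fin m)} (hv : ∀ i ∈ v, β i = 0) (hd : ∑ i, β i + v.card = 2) :
    Exceptional (wt F β v) := by
  intro k s hs
  by_contra hc
  push Not at hc
  obtain ⟨o, ho, ho0⟩ := exists_unused β (insert k v)
    (by have := Finset.card_insert_le k v; omega)
  simp only [Finset.mem_insert, not_or] at ho
  have hwo : wt F β v o = 0 := by simp [wt, ho.2, ho0]
  have hle : ∀ i, β i ≤ 2 := fun i => by
    have := Finset.single_le_sum (f := β) (fun _ _ => Nat.zero_le _) (Finset.mem_univ i); omega
  have hw : ∀ i, i ≠ k → i ∉ v ∧ β i = 0 := fun i hi => by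
    have := hc i o
    rw [hwo, if_neg hi, if_neg ho.1] at this
    by_cases hiv : i ∈ v
    · simp [wt, hiv, hv i hiv] at this
    · refine ⟨hiv, ?_⟩
      by_contra h0
      have hne := natCast_ne_zero F p h0 (by have := hle i; omega)
      simp [wt, hiv] at this
      exact hne this
  have hsum : ∑ i, β i = β k :=
    Finset.sum_eq_single k (fun i _ hi => (hw i hi).2) (by simp)
  have hsub : v ⊆ {k} := fun i hi => by
    by_contra hik
    exact (hw i (by simpa using hik)).1 hi
  have hcard := Finset.card_le_card hsub
  rw [Finset.card_singleton] at hcard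
  by_cases hk : k ∈ v
  · have := hv k hk; omega
  · have h0 : v = ∅ := Finset.eq_empty_of_forall_notMem fun i hi => by
      have := hsub hi
      rw [Finset.mem_singleton] at this
      exact hk (this ▸ hi)
    subst h0
    have h2 : β k = 2 := by simpa [hsum] using hd
    have := hc k o
    rw [hwo, if_neg ho.1] at this
    simp [wt, h2] at this
    rcases hs with rfl | rfl
    · exact one_ne_zero (α := F) (by linear_combination this)
    · exact natCast_ne_zero F p (n := 3) (by omega) hp3 (by push_cast; linear_combination this)

section

variable [CharP F p] [hp : Fact p.Prime]

variable (F) in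
/-- A clean cubic monomial is the bracket of a quadratic one and of a cubic one whose weight is
exceptional. -/
theorem exists_TH_eq_of_eq_three (hm : 3 < m) (hp3 : 3 < p) {β : Fin m → ℕ} {v : Finset (Fin m)}
    (h : IsClean p β v) (hd : ∑ i, β i + v.card = 3) :
    ∃ β₁ v₁ β₂ v₂, IsClean p β₁ v₁ ∧ IsClean p β₂ v₂ ∧
      ((∑ i, β₁ i + v₁.card = 3 ∧ ∑ i, β₂ i + v₂.card = 2 ∧ Exceptional (wt F β₁ v₁)) ∨
        (∑ i, β₁ i + v₁.card = 2 ∧ ∑ i, β₂ i + v₂.card = 3 ∧ Exceptional (wt F β₂ v₂))) ∧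
      ∃ c : F, c ≠ 0 ∧ TH F p m (mono F p m β₁ v₁) (mono F p m β₂ v₂) = c • mono F p m β v := by
  have hp1 := hp.out.one_lt
  have h2 : (2 : F) ≠ 0 := by exact_mod_cast natCast_ne_zero F p (n := 2) (by omega) (by omega)
  have h3 : (3 : F) ≠ 0 := by exact_mod_cast natCast_ne_zero F p (n := 3) (by omega) hp3
  obtain ⟨l, hl, hl0⟩ := exists_unused β v (by omega)
  have split : ∀ (β₂ : Fin m → ℕ) (v₂ : Finset (Fin m)), v₂ ⊆ v → (∀ i, β₂ i ≤ β i) →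
      1 ≤ ∑ i, β₂ i + v₂.card → ∑ i, β₂ i + v₂.card ≤ 2 →
      IsClean p (β - β₂ + eps l) (v \ v₂) ∧ IsClean p β₂ (insert l v₂) ∧
      (∑ i, (β - β₂ + eps l) i + (v \ v₂).card) + (∑ i, β₂ i + v₂.card) = 4 ∧
      (insert l v₂).card = v₂.card + 1 ∧
      ∃ c : F, c ≠ 0 ∧ TH F p m (mono F p m (β - β₂ + eps l) (v \ v₂))
        (mono F p m β₂ (insert l v₂)) = c • mono F p m β v := by
    intro β₂ v₂ hv hβ₂ hs1 hs2
    obtain ⟨h1, h2, h3, h4, h5, h6⟩ := h.exists_TH_eq_smul F hl (by omega) hβ₂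
      (by have := hβ₂ l; omega) hv
    exact ⟨isClean_of_lt hp1 h1 h2 (by omega),
      isClean_of_lt hp1 (fun i => (hβ₂ i).trans_lt (h.lt i)) h3 (by omega), by omega, h5, h6⟩
  rcases Finset.eq_empty_or_nonempty v with rfl | ⟨j, hj⟩
  · obtain ⟨β₂, v₂, hv, hβ₂, hs⟩ := exists_factor β ∅ (k := 2) (by omega)
    obtain rfl : v₂ = ∅ := Finset.subset_empty.1 hv
    obtain ⟨h1, h1', h4, h5, h6⟩ := split β₂ ∅ hv hβ₂ (by omega) (by omega)
    refine ⟨_, _, _, _, h1, h1', Or.inr ⟨by omega, by omega, ?_⟩, h6⟩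
    have hβl : β₂ l = 0 := by have := hβ₂ l; omega
    obtain ⟨i, -, hi⟩ := Finset.exists_ne_zero_of_sum_ne_zero (s := Finset.univ) (f := β₂)
      (by simp at hs; omega)
    have hi2 : β₂ i ≤ 2 := by
      have := Finset.single_le_sum (f := β₂) (fun _ _ => Nat.zero_le _) (Finset.mem_univ i)
      simp at hs; omega
    have hil : i ≠ l := fun e => hi (e ▸ hβl)
    obtain ⟨o, ho, ho0⟩ := exists_unused β₂ {l} (by simp at hs ⊢; omega)
    have hol : o ≠ l := by simpa using ho
    have hneg : (-1 : F) ≠ 1 := fun e => h2 (by linear_combination -e)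
    have hneg2 : (-1 : F) ≠ 2 := fun e => h3 (by linear_combination -e)
    refine exceptional_of_ne (i := l) (j := i) (l := o) ?_ ?_ ?_ <;>
      simp only [wt, hβl, ho0, Finset.mem_insert, Finset.notMem_empty, or_false, hil, hol,
        if_true, if_false, Nat.cast_zero, zero_sub, sub_zero]
    · rcases (by omega : β₂ i = 1 ∨ β₂ i = 2) with e | e <;> simp [e, hneg, hneg2]
    · exact natCast_ne_zero F p hi (by omega)
    · simp
  · have hc := Finset.card_erase_add_one hj
    obtain ⟨β₂, v₂, hv, hβ₂, hs⟩ := exists_factor β (v.erase j) (k := 1) (by omega)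
    obtain ⟨h1, h1', h4, h5, h6⟩ := split β₂ v₂ (hv.trans (Finset.erase_subset _ _)) hβ₂
      (by omega) (by omega)
    refine ⟨_, _, _, _, h1, h1', Or.inl ⟨by omega, by omega, ?_⟩, h6⟩
    obtain ⟨o, ho, ho0⟩ := exists_unused _ _
      (show ∑ i, (β - β₂ + eps l) i + (v \ v₂).card < m by omega)
    have hjl : j ≠ l := fun e => hl (e ▸ hj)
    have hjv : j ∉ v₂ := fun e => Finset.notMem_erase j v (hv e)
    have hneg : (1 : F) ≠ -1 := fun e => h2 (by linear_combination e)
    have e1 : wt F (β - β₂ + eps l) (v \ v₂) l = 1 := by simp [wt, hl0, hl]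
    have e2 : wt F (β - β₂ + eps l) (v \ v₂) j = -1 := by
      simp [wt, eps_of_ne hjl, h.eq_zero j hj, hj, hjv]
    have e3 : wt F (β - β₂ + eps l) (v \ v₂) o = 0 := by
      rw [wt, ho0, if_neg ho]; simp
    refine exceptional_of_ne (i := l) (j := j) (l := o) ?_ ?_ ?_ <;> simp [e1, e2, e3, hneg]

end

/-! ### The image of `Δ` -/

theorem exists_pd_inl_mono (α : Fin m → ℕ) (u : Finset (Fin m)) (r : Fin m) :
    ∃ (β : Fin m → ℕ) (c : F), pd F p m (Sum.inl r) (mono F p m α u) = c • mono F p m β u := by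
  by_cases h : ∀ i, α i < p
  · by_cases h0 : α r = 0
    · exact ⟨0, 0, by rw [pd_inl_mono_zero h0]; simp⟩
    · obtain ⟨β, rfl⟩ := exists_eq_add_eps h0
      exact ⟨β, 1, by rw [pd_inl_mono_add h]; simp⟩
  · push Not at h
    obtain ⟨i, hi⟩ := h
    exact ⟨0, 0, by rw [mono_of_le hi]; simp⟩

section

variable [CharP F p] [hp : Fact p.Prime]

/-- If at least two pairs of conjugate variables occur in `x^(α) x^u`, then `Δ` of this monomial is
a multiple of the bracket of two clean monomials whose product is the monomial; otherwise it is
itself zero or a multiple of a clean monomial. -/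
theorem lap_mono_mem_of_ne_univ (hp3 : 3 < p) {S : Submodule F (O F p m)} {n : ℕ}
    (hS : ∀ θ, ∀ a ∈ S, a ∈ oPar F p m θ → ∀ b ∈ S, TH F p m a b ∈ S)
    (hG : ∀ β v, IsClean p β v → ∑ i, β i + v.card ≤ n → mono F p m β v ∈ S)
    {α : Fin m → ℕ} {u : Finset (Fin m)} (hα : ∀ i, α i < p) (hd : ∑ i, α i + u.card = n + 2)
    (hu : u ≠ Finset.univ) : Δ (mono F p m α u) ∈ S := by
  by_cases h1 : ∃ i ∈ u, α i ≠ 0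
  swap
  · push Not at h1
    rw [lap_mono_eq_zero h1]; exact Submodule.zero_mem _
  obtain ⟨i, hiu, hi⟩ := h1
  have hcu := Finset.card_erase_add_one hiu
  by_cases h2 : ∃ j ∈ u, j ≠ i ∧ α j ≠ 0
  swap
  · push Not at h2
    obtain ⟨β, rfl⟩ := exists_eq_add_eps hi
    have h0 : ∀ j ∈ u.erase i, β j = 0 := fun j hj => by
      have hji := Finset.ne_of_mem_erase hj
      simpa [eps_of_ne hji] using h2 j (Finset.mem_of_mem_erase hj) hji
    have hip := hα i
    simp at hip
    obtain ⟨c, -, h⟩ := lap_mono_insert (F := F) (p := p) (l := i) h0 (Finset.notMem_erase i u)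
      (by omega)
    rw [← Finset.insert_erase hiu, h]
    refine Submodule.smul_mem _ _ (hG _ _ ⟨fun j => ?_, h0, i, Finset.notMem_erase i u, hip⟩ ?_)
    · have := hα j; simp at this; omega
    · rw [sum_add_eps] at hd; omega
  obtain ⟨j, hju, hji, hj⟩ := h2
  obtain ⟨l, hl⟩ : ∃ l, l ∉ u := by
    by_contra hc; push Not at hc; exact hu (Finset.eq_univ_iff_forall.2 hc)
  -- `x_i'` goes to the first factor and `x_i` to the second; the even variables without partner in
  -- `u` are split so that both factors are in the image of `Δ`
  set β : Fin m → ℕ := fun k => if k = i then 0 else if k ∈ u then α k else min 1 (α k) with hβ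
  set γ : Fin m → ℕ := fun k => if k = i then α i else if k ∈ u then 0 else α k - min 1 (α k)
    with hγ
  have hsum : ∀ k, β k + γ k = α k := fun k => by
    simp only [hβ, hγ]; split_ifs with h h
    · subst h; omega
    · omega
    · omega
  have hli : l ≠ i := fun e => hl (e ▸ hiu)
  have hαl := hα l
  have hβc : IsClean p β {i} := ⟨fun k => by have := hsum k; have := hα k; omega,
    fun k hk => by simp [hβ, Finset.mem_singleton.1 hk], l, by simpa using hli, by
      simp only [hβ, if_neg hli, if_neg hl]; omega⟩
  have hγc : IsClean p γ (u.erase i) := ⟨fun k => by have := hsum k; have := hα k; omega,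
    fun k hk => by
      simp [hγ, Finset.ne_of_mem_erase hk, Finset.mem_of_mem_erase hk], l,
    fun e => hl (Finset.mem_of_mem_erase e), by
      simp only [hγ, if_neg hli, if_neg hl]; omega⟩
  have hadd : β + γ = α := funext hsum
  have hsums : ∑ k, β k + ∑ k, γ k = ∑ k, α k := by
    rw [← Finset.sum_add_distrib]; exact Finset.sum_congr rfl fun k _ => hsum k
  have hβj : 1 ≤ ∑ k, β k := by
    have := Finset.single_le_sum (f := β) (fun _ _ => Nat.zero_le _) (Finset.mem_univ j)
    have h' : β j = α j := by simp [hβ, hji, hju]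
    omega
  have hγi : 1 ≤ ∑ k, γ k := by
    have := Finset.single_le_sum (f := γ) (fun _ _ => Nat.zero_le _) (Finset.mem_univ i)
    have h' : γ i = α i := by simp [hγ]
    omega
  have hcj : 1 ≤ (u.erase i).card :=
    Finset.card_pos.2 ⟨j, Finset.mem_erase.2 ⟨hji, hju⟩⟩
  obtain ⟨c, hc, h⟩ := TH_mono_mono (F := F) (p := p) hβc.eq_zero hγc.eq_zero (by simp)
    (fun k => by rw [hsum]; exact hα k)
  rw [hadd, ← Finset.insert_eq, Finset.insert_erase hiu] at h
  refine (Submodule.smul_mem_iff _ hc).1 (h ▸ hS _ _ ?_ mono_mem_oPar _ ?_)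
  · exact hG _ _ hβc (by simp; omega)
  · exact hG _ _ hγc (by omega)

/-- The image of `Δ` is generated by clean monomials, except for `Δ` of the monomial of highest
degree. -/
theorem lap_mono_mem (hp3 : 3 < p) (hm : 3 < m) {S : Submodule F (O F p m)} {n : ℕ}
    (hS : ∀ θ, ∀ a ∈ S, a ∈ oPar F p m θ → ∀ b ∈ S, TH F p m a b ∈ S)
    (hG : ∀ β v, IsClean p β v → ∑ i, β i + v.card ≤ n → mono F p m β v ∈ S)
    {α : Fin m → ℕ} {u : Finset (Fin m)} (hα : ∀ i, α i < p) (hd : ∑ i, α i + u.card = n + 2)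
    (htop : ¬ (u = Finset.univ ∧ ∀ i, α i = p - 1)) : Δ (mono F p m α u) ∈ S := by
  by_cases hu : u = Finset.univ
  swap
  · exact lap_mono_mem_of_ne_univ hp3 hS hG hα hd hu
  subst hu
  simp only [true_and, not_forall] at htop
  obtain ⟨j, hj⟩ := htop
  have hjp := hα j
  have : Nontrivial (Fin m) := Fin.nontrivial_iff_two_le.2 (by omega)
  obtain ⟨k, hkj⟩ := exists_ne j
  have hcard : (Finset.univ.erase k).card + 1 = m := by
    rw [Finset.card_erase_add_one (Finset.mem_univ k)]; simp
  have hcard' : (Finset.univ : Finset (Fin m)).card = m := by simp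
  have hb : Δ (mono F p m (α + eps j) (Finset.univ.erase k)) ∈ S := by
    refine lap_mono_mem_of_ne_univ hp3 hS hG (fun i => ?_) ?_ ?_
    · by_cases hi : i = j
      · subst hi; simp; omega
      · simpa [eps_of_ne hi] using hα i
    · rw [sum_add_eps]; omega
    · exact fun e => Finset.notMem_erase k Finset.univ (by rw [e]; simp)
  have ha : mono F p m 0 {j, k} ∈ S := by
    refine hG _ _ (isClean_of_lt hp.out.one_lt (fun _ => hp.out.pos) (by simp) ?_) ?_
    · rw [Finset.card_pair hkj.symm]; simp; omega
    · rw [Finset.card_pair hkj.symm]; simp; omega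
  have hprod : ∃ c : F, c ≠ 0 ∧ mono F p m 0 {j, k} ⋆
      Δ (mono F p m (α + eps j) (Finset.univ.erase k)) = c • mono F p m α Finset.univ := by
    rw [lap_apply, map_sum, Finset.sum_eq_single j]
    · rw [pd_inr_mono, if_pos (by simp [hkj.symm]), map_smul, map_smul,
        pd_inl_mono_of_ne (by omega)]
      obtain ⟨c, hc, h⟩ := mulO_mono_of_disjoint (F := F) (p := p) (α := 0) (β := α) (u := {j, k})
        (v := (Finset.univ.erase k).erase j) (by
          rw [Finset.disjoint_insert_left, Finset.disjoint_singleton_left]; simp)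
        (by simpa using hα)
      refine ⟨(-1) ^ ((Finset.univ.erase k).filter fun i => i < j).card * c,
        mul_ne_zero (by simp) hc, ?_⟩
      rw [h, smul_smul, zero_add]
      congr 2
      ext i; simp; tauto
    · intro i _ hi
      rw [pd_inr_mono]
      split_ifs with h
      · obtain ⟨γ, c, hc⟩ := exists_pd_inl_mono (F := F) (p := p) (α + eps j)
          ((Finset.univ.erase k).erase i) i
        rw [map_smul, hc, map_smul, map_smul, mulO_mono, if_neg]
        · simp
        · rw [Finset.disjoint_insert_left]; simp [hi.symm, hkj.symm]
      · simp
    · simp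
  obtain ⟨c, hc, h⟩ := hprod
  have hTH : TH F p m (mono F p m 0 {j, k})
      (Δ (mono F p m (α + eps j) (Finset.univ.erase k))) = c • Δ (mono F p m α Finset.univ) := by
    rw [TH_eq_lap (lap_mono_eq_zero (by simp)) (lap_lap ?_ _), parInv_mono,
      Finset.card_pair hkj.symm, neg_one_sq, one_smul, h, map_smul]
    exact_mod_cast natCast_ne_zero F p (n := 2) (by omega) (by omega)
  exact (Submodule.smul_mem_iff _ hc).1 (hTH ▸ hS _ _ ha mono_mem_oPar _ hb)

end

/-! ### The torus -/

variable (F p) in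
/-- The quadratic function `x_i x_{i'}`. -/
def tor (i : Fin m) : O F p m := mono F p m (eps i) {i}

theorem tor_mem_oPar (i : Fin m) : tor F p i ∈ oPar F p m 1 := by
  simpa [tor] using mono_mem_oPar (F := F) (p := p) (α := eps i) (u := {i})

theorem tor_mem_oDeg (i : Fin m) : tor F p i ∈ oDeg F p m 2 :=
  mono_mem_oDeg (by simp [eps_apply])

theorem exists_lap_eq_tor_sub {i j : Fin m} (hij : i ≠ j) (hp : 2 < p) :
    ∃ c : F, c ≠ 0 ∧ Δ (mono F p m (eps i + eps j) {i, j}) = c • (tor F p i - tor F p j) := by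
  have key : ∀ i j : Fin m, i < j →
      Δ (mono F p m (eps i + eps j) {i, j}) = (-1 : F) • (tor F p i - tor F p j) := by
    intro i j hij
    have e1 : (({i, j} : Finset (Fin m)).filter fun k => k < i).card = 0 := by
      simp [Finset.filter_insert, Finset.filter_singleton, hij.le]
    have e2 : (({i, j} : Finset (Fin m)).filter fun k => k < j).card = 1 := by
      simp [Finset.filter_insert, Finset.filter_singleton, hij]
    rw [lap_apply, Finset.sum_eq_add (a := i) (b := j) hij.ne]
    · rw [pd_inr_mono, pd_inr_mono, if_pos (by simp), if_pos (by simp), e1, e2, map_smul, map_smul,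
        pd_inl_mono_of_ne (by simp [eps_of_ne hij.ne']; omega), add_comm (eps i),
        pd_inl_mono_of_ne (by simp [eps_of_ne hij.ne]; omega), 
        Finset.erase_insert (by simp [hij.ne]),
        Finset.pair_comm, Finset.erase_insert (by simp [hij.ne']), tor, tor]
      simp; abel
    · rintro k - ⟨h1, h2⟩
      rw [pd_inr_mono, if_neg (by simp [h1, h2]), map_zero]
    · simp
    · simp
  rcases lt_or_gt_of_ne hij with h | h
  · exact ⟨-1, by simp, key i j h⟩
  · refine ⟨1, one_ne_zero, ?_⟩
    rw [add_comm, Finset.pair_comm, key j i h]; simp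

section

variable [hp : Fact p.Prime]

theorem TH_tor_apply (i : Fin m) (f : O F p m) :
    TH F p m (tor F p i) f = gen F p m (Sum.inr i) ⋆ pd F p m (Sum.inr i) f -
      gen F p m (Sum.inl i) ⋆ pd F p m (Sum.inl i) f := by
  have h1 : ∀ j, pd F p m (Sum.inl j) (tor F p i) = if j = i then gen F p m (Sum.inr i) else 0 := by
    intro j
    split_ifs with h
    · subst h
      rw [tor, ← zero_add (eps j), pd_inl_mono_of_ne (by simpa using hp.out.one_lt.ne)]; rfl
    · exact pd_inl_mono_zero (eps_of_ne h) _
  have h2 : ∀ j, pd F p m (Sum.inr j) (tor F p i) = if j = i then gen F p m (Sum.inl i) else 0 := by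
    intro j
    rw [tor, pd_inr_mono]
    simp only [Finset.mem_singleton]
    split_ifs with h
    · subst h; simp [gen, Finset.filter_singleton]
    · rfl
  rw [TH_apply, Finset.sum_eq_single i]
  · rw [parInv_of_mem_one (tor_mem_oPar i), map_neg, h1, h2, if_pos rfl, if_pos rfl, map_neg,
      LinearMap.neg_apply, sub_eq_add_neg]
  · intro j _ hj
    rw [parInv_of_mem_one (tor_mem_oPar i), map_neg, h1, h2, if_neg hj, if_neg hj]; simp
  · simp

theorem TH_tor_mono (i : Fin m) (α : Fin m → ℕ) (u : Finset (Fin m)) :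
    TH F p m (tor F p i) (mono F p m α u) = -wt F α u i • mono F p m α u := by
  by_cases hα : ∀ j, α j < p
  swap
  · push Not at hα
    obtain ⟨j, hj⟩ := hα
    simp [mono_of_le hj]
  have h1 : gen F p m (Sum.inr i) ⋆ pd F p m (Sum.inr i) (mono F p m α u) =
      (if i ∈ u then (1 : F) else 0) • mono F p m α u := by
    rw [pd_inr_mono]
    split_ifs with h
    · rw [map_smul, gen, Sum.elim_inr, mulO_mono, if_pos (by simp), mulSign_singleton_left,
        filter_erase_lt, ← Finset.insert_eq, Finset.insert_erase h, smul_smul, zero_add]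
      simp [neg_one_pow_mul_self]
    · simp
  have h2 : gen F p m (Sum.inl i) ⋆ pd F p m (Sum.inl i) (mono F p m α u) =
      (α i : F) • mono F p m α u := by
    by_cases h : α i = 0
    · rw [pd_inl_mono_zero h, h]; simp
    · obtain ⟨β, rfl⟩ := exists_eq_add_eps h
      rw [pd_inl_mono_add hα, gen, Sum.elim_inl, mulO_mono, if_pos (by simp), add_comm (eps i) β,
        Finset.empty_union, prod_choose_split _ _ i, Finset.prod_eq_one, mulSign]
      · simp [add_comm]
      · intro j hj
        simp [eps_of_ne (Finset.ne_of_mem_erase hj)]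
  rw [TH_tor_apply, h1, h2, ← sub_smul, wt, neg_sub]

/-- The operator `Δ` respects weights. -/
theorem TH_tor_lap_mono (i : Fin m) {α : Fin m → ℕ} (u : Finset (Fin m)) (hα : ∀ j, α j < p) :
    TH F p m (tor F p i) (Δ (mono F p m α u)) = -wt F α u i • Δ (mono F p m α u) := by
  rw [lap_apply, map_sum, Finset.smul_sum]
  refine Finset.sum_congr rfl fun j _ => ?_
  rw [pd_inr_mono]
  split_ifs with h
  · rw [map_smul, map_smul, smul_comm]
    congr 1
    by_cases h0 : α j = 0
    · simp [pd_inl_mono_zero h0]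
    · obtain ⟨β, rfl⟩ := exists_eq_add_eps h0
      rw [pd_inl_mono_add hα, TH_tor_mono]
      congr 2
      by_cases hij : i = j
      · subst hij; simp [wt, h]
      · simp [wt, hij, eps_of_ne hij]
  · simp

/-- The position of the variable `x_k` among the even or among the odd variables. -/
def pos : Y m → Fin m := Sum.elim id id

variable (F) in
/-- The sign `1` for even and `-1` for odd variables. -/
def ysgn : Y m → F := Sum.elim (fun _ => 1) fun _ => -1

theorem ysgn_eq (k : Y m) : ysgn F k = 1 ∨ ysgn F k = -1 := by
  rcases k with k | k <;> simp [ysgn]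

theorem TH_tor_gen (i : Fin m) (k : Y m) :
    TH F p m (tor F p i) (gen F p m k) =
      -(ysgn F k * if i = pos k then 1 else 0) • gen F p m k := by
  rcases k with k | k <;> simp only [gen, Sum.elim_inl, Sum.elim_inr, TH_tor_mono] <;> congr 2 <;>
    by_cases h : i = k <;> simp [wt, ysgn, pos, eps_apply, h]

end

theorem exists_eq_sum_gen {b : O F p m} (hb : b ∈ oDeg F p m 1) :
    ∃ c : Y m → F, b = ∑ k, c k • gen F p m k := by
  have : oDeg F p m 1 ≤ Submodule.span F (Set.range (gen F p m)) := by
    refine Submodule.span_le.2 ?_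
    rintro _ ⟨a, ha, rfl⟩
    have ha' : ∑ i, (a.1 i : ℕ) + a.2.card = 1 := by exact_mod_cast ha
    rw [← mono_val a]
    refine Submodule.subset_span ?_
    rcases Nat.eq_zero_or_pos a.2.card with h | h
    · have hs : ∑ i, (a.1 i : ℕ) = 1 := by omega
      obtain ⟨i, -, hi⟩ := Finset.exists_ne_zero_of_sum_ne_zero (s := Finset.univ)
        (f := fun i => (a.1 i : ℕ)) (by omega)
      obtain ⟨β, hβ⟩ := exists_eq_add_eps (α := fun i => (a.1 i : ℕ)) hi
      have h0 : ∑ i, β i = 0 := by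
        have := sum_add_eps β i
        rw [← hβ, hs] at this; omega
      refine ⟨Sum.inl i, ?_⟩
      rw [Finset.card_eq_zero.1 h, hβ, show β = 0 from funext fun j =>
        (Finset.sum_eq_zero_iff.1 h0) j (Finset.mem_univ j), zero_add]
      rfl
    · have hs : ∑ i, (a.1 i : ℕ) = 0 := by omega
      obtain ⟨i, hi⟩ := Finset.card_eq_one.1 (show a.2.card = 1 by omega)
      refine ⟨Sum.inr i, ?_⟩
      rw [hi, show (fun i => (a.1 i : ℕ)) = 0 from funext fun j =>
        (Finset.sum_eq_zero_iff.1 hs) j (Finset.mem_univ j)]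
      rfl
  obtain ⟨c, hc⟩ := (Submodule.mem_span_range_iff_exists_fun F).1 (this hb)
  exact ⟨c, hc.symm⟩

section

variable [hp : Fact p.Prime]

theorem pd_eq_zero_of_TH_eq_zero {x : O F p m} (h : TH F p m x = 0) (r : Y m) :
    pd F p m r x = 0 := by
  rcases r with r | r
  · rw [← TH_gen_inr, h]; rfl
  · have := TH_gen_inl x r
    rw [h, LinearMap.zero_apply] at this
    rw [← parInv_parInv (pd F p m (Sum.inr r) x), parInv_pd_inr, ← this]; simp

theorem eq_zero_of_TH_sum_gen {c : Y m → F} (h : TH F p m (∑ k, c k • gen F p m k) = 0) (k : Y m) :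
    c k = 0 := by
  have := pd_eq_zero_of_TH_eq_zero h k
  rw [map_sum, Finset.sum_eq_single k] at this
  · rw [map_smul, pd_gen, if_pos rfl] at this
    have h1 := DFunLike.congr_fun this ((fun _ => ⟨0, hp.out.pos⟩, ∅) : Idx p m)
    rw [Finsupp.smul_apply, mono_apply, if_pos (by simp)] at h1
    simpa using h1
  · intro b _ hb; rw [map_smul, pd_gen, if_neg hb.symm, smul_zero]
  · simp

end

/-! ### Elements of `SHO^(2)` -/

section

variable [CharP F p] [hp : Fact p.Prime]

theorem TH_mem_derived (hm : 3 < m) (hp3 : 3 < p) {A : Submodule F (End F (O F p m))}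
    (hA : ∀ β v, IsClean p β v → TH F p m (mono F p m β v) ∈ A) {β : Fin m → ℕ}
    {v : Finset (Fin m)} (h : IsClean p β v) : TH F p m (mono F p m β v) ∈ derived F p m A := by
  obtain ⟨β₁, v₁, β₂, v₂, h1, h2, c, hc, h3⟩ : ∃ β₁ v₁ β₂ v₂, IsClean p β₁ v₁ ∧ IsClean p β₂ v₂ ∧
      ∃ c : F, c ≠ 0 ∧ TH F p m (mono F p m β₁ v₁) (mono F p m β₂ v₂) = c • mono F p m β v := by
    by_cases hd : 4 ≤ ∑ i, β i + v.card
    · obtain ⟨β₁, v₁, β₂, v₂, h1, h2, -, -, h3⟩ := exists_TH_eq_of_four_le F hm h hd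
      exact ⟨β₁, v₁, β₂, v₂, h1, h2, h3⟩
    · exact exists_TH_eq_of_le_three F hm (by omega) h (by omega)
  refine (Submodule.smul_mem_iff _ hc).1 ?_
  rw [← map_smul, ← h3, ← superBracket_TH]
  exact Submodule.apply_mem_map₂ _ (hA _ _ h1) (hA _ _ h2)

/-- Clean monomials are brackets of clean monomials, so they stay in all derived algebras of
`SHO`. -/
theorem TH_mono_mem_SHO2 (hm : 3 < m) (hp3 : 3 < p) {β : Fin m → ℕ} {v : Finset (Fin m)}
    (h : IsClean p β v) : TH F p m (mono F p m β v) ∈ SHO2 F p m := by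
  have h2 : (2 : F) ≠ 0 := by exact_mod_cast natCast_ne_zero F p (n := 2) (by omega) (by omega)
  refine TH_mem_derived hm hp3 (fun β v h => TH_mem_derived hm hp3 (fun β v h => ?_) h) h
  exact (mem_SHO_iff h2).2 ⟨_, lap_mono_eq_zero h.eq_zero, rfl⟩

theorem TH_gen_mem_SHO2 (hm : 3 < m) (hp3 : 3 < p) (k : Y m) :
    TH F p m (gen F p m k) ∈ SHO2 F p m := by
  rcases k with k | k
  · refine TH_mono_mem_SHO2 hm hp3 (isClean_of_lt hp.out.one_lt (fun i => ?_) (by simp) ?_)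
    · rw [eps_apply]; split_ifs <;> omega
    · simp [eps_apply]; omega
  · refine TH_mono_mem_SHO2 hm hp3 (isClean_of_lt hp.out.one_lt (fun i => hp.out.pos) (by simp) ?_)
    simp; omega

theorem pd_mem_SHO2 (hm : 3 < m) (hp3 : 3 < p) (k : Y m) : pd F p m k ∈ SHO2 F p m := by
  rcases k with k | k
  · have h := TH_gen_mem_SHO2 (F := F) hm hp3 (Sum.inr k)
    rw [TH_of_gen_inr] at h
    exact (Submodule.smul_mem_iff _ (by simp)).1 h
  · rw [← TH_of_gen_inl]; exact TH_gen_mem_SHO2 hm hp3 _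

theorem TH_lap_mono_mem_SHO2 (hm : 3 < m) (hp3 : 3 < p) {α : Fin m → ℕ} {u : Finset (Fin m)}
    (hα : ∀ i, α i < p) (htop : ¬ (u = Finset.univ ∧ ∀ i, α i = p - 1)) :
    TH F p m (Δ (mono F p m α u)) ∈ SHO2 F p m := by
  have h2 : (2 : F) ≠ 0 := by exact_mod_cast natCast_ne_zero F p (n := 2) (by omega) (by omega)
  by_cases hd : 2 ≤ ∑ i, α i + u.card
  · obtain ⟨n, hn⟩ := Nat.exists_eq_add_of_le' hd
    refine lap_mono_mem (S := (SHO2 F p m).comap (TH F p m)) (n := n) hp3 hm ?_ ?_ hα hn htop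
    · intro θ a ha _ b hb
      rw [Submodule.mem_comap, ← superBracket_TH]
      exact isSubalg_SHO2 h2 _ ha _ hb
    · exact fun β v h _ => TH_mono_mem_SHO2 hm hp3 h
  · rw [lap_mono_eq_zero, map_zero]
    · exact Submodule.zero_mem _
    · intro i hi
      have := Finset.single_le_sum (f := α) (fun _ _ => Nat.zero_le _) (Finset.mem_univ i)
      have := Finset.card_pos.2 ⟨i, hi⟩
      omega

theorem TH_tor_sub_mem_SHO2 (hm : 3 < m) (hp3 : 3 < p) (i j : Fin m) :
    TH F p m (tor F p i - tor F p j) ∈ SHO2 F p m := by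
  by_cases hij : i = j
  · rw [hij, sub_self, map_zero]; exact Submodule.zero_mem _
  obtain ⟨c, hc, h⟩ := exists_lap_eq_tor_sub (F := F) (p := p) hij (by omega)
  refine (Submodule.smul_mem_iff _ hc).1 ?_
  rw [← map_smul, ← h]
  refine TH_lap_mono_mem_SHO2 hm hp3 (fun k => ?_) ?_
  · simp only [Pi.add_apply, eps_apply]; split_ifs <;> omega
  · rintro ⟨e, -⟩
    have := congrArg Finset.card e
    rw [Finset.card_pair hij, Finset.card_univ, Fintype.card_fin] at this
    omega

end

/-! ### Transitivity -/

theorem TH_eq_zero_of_pd {b : O F p m} (h : ∀ r, pd F p m r b = 0) : TH F p m b = 0 := by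
  refine LinearMap.ext fun f => ?_
  rw [TH_apply]
  refine Finset.sum_eq_zero fun i _ => ?_
  have : pd F p m (Sum.inr i) (σ b) = 0 := by
    rw [← neg_eq_zero, ← parInv_pd_inr, h, map_zero]
  rw [this, h]; simp

/-- Hamiltonian functions of degree at most `0` are constant. -/
theorem TH_eq_zero_of_nonpos {n : ℤ} (hn : n ≤ 0) {b : O F p m} (hb : b ∈ oDeg F p m n) :
    TH F p m b = 0 :=
  TH_eq_zero_of_pd fun r => eq_zero_of_mem_oDeg_neg (n := n - 1) (by omega) (pd_mem_oDeg hb r)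

/-- A Hamiltonian operator of degree at least `0` that commutes with all `∂_r` is zero. -/
theorem TH_eq_zero_of_TH_pd [Fact p.Prime] {n : ℤ} (hn : 2 ≤ n) {b : O F p m}
    (hb : b ∈ oDeg F p m n) (h : ∀ r, TH F p m (pd F p m r b) = 0) : TH F p m b = 0 := by
  refine TH_eq_zero_of_pd fun r => ?_
  obtain ⟨c, hc⟩ := eq_smul_one_of_pd fun s => pd_eq_zero_of_TH_eq_zero (h r) s
  refine eq_zero_of_mem_oDeg_of_ne (n := n - 1) (k := 0) (by omega) (pd_mem_oDeg hb r) ?_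
  rw [hc]
  exact Submodule.smul_mem _ _ (mono_mem_oDeg (by simp))

theorem TH_gen_mem_oDeg [Fact p.Prime] {n : ℤ} {b : O F p m} (hb : b ∈ oDeg F p m n) (k : Y m) :
    TH F p m (gen F p m k) b ∈ oDeg F p m (n - 1) := by
  rcases k with k | k
  · rw [TH_of_gen_inl]; exact pd_mem_oDeg hb _
  · rw [TH_of_gen_inr]; exact Submodule.smul_mem _ _ (pd_mem_oDeg hb _)

theorem gen_mem_oDeg (k : Y m) : gen F p m k ∈ oDeg F p m 1 := by
  rcases k with k | k
  · exact mono_mem_oDeg (by simp [eps_apply])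
  · exact mono_mem_oDeg (by simp)

/-- The `ℤ/2`-grading and the `ℤ`-grading are compatible. -/
theorem mem_oDeg_of_add_mem {η₁ η₂ : ZMod 2} (hη : η₁ ≠ η₂) {n : ℤ} {x y : O F p m}
    (hx : x ∈ oPar F p m η₁) (hy : y ∈ oPar F p m η₂) (h : x + y ∈ oDeg F p m n) :
    x ∈ oDeg F p m n := by
  refine mem_oDeg_iff.2 fun a ha => mem_oDeg_iff.1 h a ?_
  have : y a = 0 := by
    by_contra hc
    exact hη ((mem_oPar_iff.1 hx a ha).symm.trans (mem_oPar_iff.1 hy a hc))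
  simpa [this] using ha

/-- A homogeneous function of degree `1` only involves variables of its own parity. -/
theorem exists_eq_sum_gen_of_mem_oPar {η : ZMod 2} {b : O F p m} (hb : b ∈ oDeg F p m 1)
    (hη : b ∈ oPar F p m η) :
    ∃ c : Y m → F, b = ∑ k, c k • gen F p m k ∧ ∀ k, ((mu k : ℕ) : ZMod 2) ≠ η → c k = 0 := by
  obtain ⟨c, hc⟩ := exists_eq_sum_gen hb
  refine ⟨fun k => if ((mu k : ℕ) : ZMod 2) = η then c k else 0, ?_, fun k hk => if_neg hk⟩
  have h := oProj_of_mem hη η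
  rw [if_pos rfl, hc, map_sum] at h
  refine (hc.trans h.symm).trans (Finset.sum_congr rfl fun k _ => ?_)
  rw [map_smul, oProj_of_mem (gen_mem_oPar k)]
  by_cases hk : ((mu k : ℕ) : ZMod 2) = η <;> simp [hk]

/-! ### Superderivations and Hamiltonian functions -/

section

variable [CharP F p] [hp : Fact p.Prime] {hX : IsSubalg F p m (SHO2 F p m)}

theorem adOn_TH {a b : O F p m} (ha : TH F p m a ∈ SHO2 F p m) (hb : TH F p m b ∈ SHO2 F p m) :
    adOn hX ⟨TH F p m a, ha⟩ ⟨TH F p m b, hb⟩ =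
      ⟨TH F p m (TH F p m a b), superBracket_TH a b ▸ hX _ ha _ hb⟩ :=
  Subtype.ext (superBracket_TH a b)

theorem TH_TH_mem (hX : IsSubalg F p m (SHO2 F p m)) {a b : O F p m}
    (ha : TH F p m a ∈ SHO2 F p m) (hb : TH F p m b ∈ SHO2 F p m) :
    TH F p m (TH F p m a b) ∈ SHO2 F p m :=
  superBracket_TH a b ▸ hX _ ha _ hb

theorem exists_TH_eq_of_mem_SHO2 (h2 : (2 : F) ≠ 0) (D : SHO2 F p m) :
    ∃ b, TH F p m b = D.1 ∧ (∀ n : ℤ, D.1 ∈ wDeg F p m (n - 2) → b ∈ oDeg F p m n) ∧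
      ∀ θ : ZMod 2, D.1 ∈ endPar F p m (θ + 1) → b ∈ oPar F p m θ := by
  obtain ⟨c, -, hc⟩ := SHO2_le h2 D.2
  obtain ⟨b, hb, h1, h3⟩ := exists_TH_eq c
  rw [hc] at hb h1 h3
  exact ⟨b, hb, fun n hn => h1 n fun k => by
    have := apply_gen_mem_oDeg hn k; rwa [show n - 2 + 1 = n - 1 by ring] at this, h3⟩

variable (hX) in
/-- The superderivations of parity `θ` and degree `-t`. The condition on the degree is stated for
homogeneous elements only, and in terms of the coefficients of the operators; this makes it easy
to pass to the even and the odd part of a superderivation. -/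
structure IsHomDer (θ : ZMod 2) (t : ℕ) (φ : SHO2 F p m →ₗ[F] SHO2 F p m) : Prop where
  mem : φ ∈ derPar hX θ
  deg : ∀ (η : ZMod 2) (s : ℤ) (D : SHO2 F p m), D.1 ∈ endPar F p m η → D.1 ∈ wDeg F p m s →
    ∀ k, (φ D).1 (gen F p m k) ∈ oDeg F p m (s - t + 1)

/-- The Hamiltonian functions of the elements of the kernel of `φ`. -/
def kerFun (φ : SHO2 F p m →ₗ[F] SHO2 F p m) : Submodule F (O F p m) :=
  ((LinearMap.ker φ).map (SHO2 F p m).subtype).comap (TH F p m)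

omit [CharP F p] hp in
theorem mem_kerFun {φ : SHO2 F p m →ₗ[F] SHO2 F p m} {a : O F p m} :
    a ∈ kerFun φ ↔ ∃ h : TH F p m a ∈ SHO2 F p m, φ ⟨TH F p m a, h⟩ = 0 := by
  simp only [kerFun, Submodule.mem_comap, Submodule.mem_map, LinearMap.mem_ker,
    Submodule.subtype_apply]
  constructor
  · rintro ⟨D, hD, h⟩
    exact ⟨h ▸ D.2, by rw [← hD]; congr 1; exact Subtype.ext h.symm⟩
  · rintro ⟨h, h'⟩
    exact ⟨_, h', rfl⟩

variable {θ : ZMod 2} {t : ℕ} {φ : SHO2 F p m →ₗ[F] SHO2 F p m}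

theorem IsHomDer.exists_apply_eq (h2 : (2 : F) ≠ 0) (hφ : IsHomDer hX θ t φ) {η : ZMod 2} {n : ℤ}
    {a : O F p m} (hpar : a ∈ oPar F p m η) (hdeg : a ∈ oDeg F p m n)
    (ha : TH F p m a ∈ SHO2 F p m) :
    ∃ b ∈ oDeg F p m (n - t), b ∈ oPar F p m (η + θ) ∧ (φ ⟨TH F p m a, ha⟩).1 = TH F p m b := by
  obtain ⟨c, -, hc⟩ := SHO2_le h2 (φ ⟨TH F p m a, ha⟩).2
  obtain ⟨b, hb, h1, h3⟩ := exists_TH_eq c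
  rw [hc] at hb h1 h3
  refine ⟨b, h1 _ fun k => ?_, h3 _ ?_, hb.symm⟩
  · have := hφ.deg _ _ ⟨TH F p m a, ha⟩ (TH_mem_endPar hpar) (TH_mem_wDeg hdeg) k
    rwa [show n - 2 - t + 1 = n - t - 1 by ring] at this
  · have := hφ.mem.1 _ ⟨TH F p m a, ha⟩ (TH_mem_endPar hpar)
    rwa [add_right_comm] at this

/-- The Leibniz rule, in terms of Hamiltonian functions. -/
theorem IsHomDer.apply_TH_TH (hφ : IsHomDer hX θ t φ) {η : ZMod 2} {a b : O F p m}
    (hpar : a ∈ oPar F p m η) (ha : TH F p m a ∈ SHO2 F p m) (hb : TH F p m b ∈ SHO2 F p m)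
    {a' b' : O F p m} (ha' : (φ ⟨TH F p m a, ha⟩).1 = TH F p m a')
    (hb' : (φ ⟨TH F p m b, hb⟩).1 = TH F p m b') :
    (φ ⟨TH F p m (TH F p m a b), TH_TH_mem hX ha hb⟩).1 =
      TH F p m (TH F p m a' b) + sgn F θ (η + 1) • TH F p m (TH F p m a b') := by
  have h := hφ.mem.2 _ ⟨TH F p m a, ha⟩ ⟨TH F p m b, hb⟩ (TH_mem_endPar hpar)
  rw [adOn_TH] at h
  have h1 : (adOn hX (φ ⟨TH F p m a, ha⟩) ⟨TH F p m b, hb⟩).1 = TH F p m (TH F p m a' b) := by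
    rw [← superBracket_TH, ← ha']; rfl
  have h3 : (adOn hX ⟨TH F p m a, ha⟩ (φ ⟨TH F p m b, hb⟩)).1 = TH F p m (TH F p m a b') := by
    rw [← superBracket_TH, ← hb']; rfl
  rw [h, Submodule.coe_add, Submodule.coe_smul, h1, h3]

theorem IsHomDer.TH_mem_kerFun (hφ : IsHomDer hX θ t φ) {η : ZMod 2} {a b : O F p m}
    (ha : a ∈ kerFun φ) (hpar : a ∈ oPar F p m η) (hb : b ∈ kerFun φ) :
    TH F p m a b ∈ kerFun φ := by
  obtain ⟨ha, ha'⟩ := mem_kerFun.1 ha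
  obtain ⟨hb, hb'⟩ := mem_kerFun.1 hb
  refine mem_kerFun.2 ⟨TH_TH_mem hX ha hb, Subtype.ext ?_⟩
  rw [hφ.apply_TH_TH hpar ha hb (a' := 0) (b' := 0) (by rw [ha']; simp) (by rw [hb']; simp)]
  simp

/-- Elements of degree below `t - 1` have nowhere to go under a superderivation of degree `-t`. -/
theorem IsHomDer.mem_kerFun_of_le (h2 : (2 : F) ≠ 0) (hφ : IsHomDer hX θ t φ) {η : ZMod 2} {n : ℤ}
    (hn : n ≤ t) {a : O F p m} (hpar : a ∈ oPar F p m η) (hdeg : a ∈ oDeg F p m n)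
    (ha : TH F p m a ∈ SHO2 F p m) : a ∈ kerFun φ := by
  obtain ⟨b, hb, -, h⟩ := hφ.exists_apply_eq h2 hpar hdeg ha
  exact mem_kerFun.2 ⟨ha, Subtype.ext (by rw [h, TH_eq_zero_of_nonpos (by omega) hb]; rfl)⟩

/-- Superderivations of negative degree commute with the `ad ∂_r` up to sign, so by transitivity
they are determined by their values in degree `-1`. -/
theorem IsHomDer.mem_kerFun_of_pd (h2 : (2 : F) ≠ 0) (hm : 3 < m) (hp3 : 3 < p)
    (hφ : IsHomDer hX θ t φ) (ht : 1 ≤ t) {η : ZMod 2} {n : ℤ} (hn : t + 1 < n) {a : O F p m}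
    (hpar : a ∈ oPar F p m η) (hdeg : a ∈ oDeg F p m n) (ha : TH F p m a ∈ SHO2 F p m)
    (h : ∀ r, pd F p m r a ∈ kerFun φ) : a ∈ kerFun φ := by
  obtain ⟨b, hb, -, hab⟩ := hφ.exists_apply_eq h2 hpar hdeg ha
  have hs : ∀ x y : ZMod 2, sgn F x y ≠ 0 := fun x y => by rw [sgn]; split_ifs <;> simp
  have key : ∀ k, TH F p m (TH F p m (gen F p m k) b) = 0 := by
    intro k
    obtain ⟨hk, hk'⟩ := mem_kerFun.1 (hφ.mem_kerFun_of_le h2 (n := 1) (by exact_mod_cast ht)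
      (gen_mem_oPar k) (gen_mem_oDeg k) (TH_gen_mem_SHO2 hm hp3 k))
    have h1 := hφ.apply_TH_TH (gen_mem_oPar k) hk ha (a' := 0) (by rw [hk']; simp) hab
    have h3 : TH F p m (gen F p m k) a ∈ kerFun φ := by
      rcases k with k | k
      · rw [TH_of_gen_inl]; exact h _
      · rw [TH_of_gen_inr]; exact Submodule.smul_mem _ _ (h _)
    obtain ⟨h4, h5⟩ := mem_kerFun.1 h3
    rw [h5] at h1
    simpa [hs] using h1.symm
  refine mem_kerFun.2 ⟨ha, Subtype.ext ?_⟩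
  rw [hab, TH_eq_zero_of_TH_pd (n := n - t) (by omega) hb]
  · rfl
  · rintro (r | r)
    · have := key (Sum.inr r)
      rw [TH_of_gen_inr] at this
      simpa using this
    · have := key (Sum.inl r)
      rwa [TH_of_gen_inl] at this

omit [CharP F p] in
theorem TH_tor_sub_sum_gen (i j : Fin m) (c : Y m → F) :
    TH F p m (tor F p i - tor F p j) (∑ k, c k • gen F p m k) =
      ∑ k, (-(ysgn F k * ((if i = pos k then 1 else 0) - if j = pos k then 1 else 0)) * c k) •
        gen F p m k := by
  rw [map_sum]
  refine Finset.sum_congr rfl fun k _ => ?_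
  rw [map_smul, map_sub, LinearMap.sub_apply, TH_tor_gen, TH_tor_gen, ← sub_smul, smul_smul]
  congr 1; ring

omit [CharP F p] hp in
theorem tor_sub_mem_oPar (i j : Fin m) : tor F p i - tor F p j ∈ oPar F p m 1 :=
  Submodule.sub_mem _ (tor_mem_oPar i) (tor_mem_oPar j)

/-- A superderivation of degree `-t` that vanishes on the torus preserves weights. It maps functions
of degree `t + 1` to combinations of the variables, so it kills those of exceptional weight. -/
theorem IsHomDer.mem_kerFun_of_exceptional (h2 : (2 : F) ≠ 0) (hφ : IsHomDer hX θ t φ)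
    (htor : ∀ i j, tor F p i - tor F p j ∈ kerFun φ) {η : ZMod 2} {a : O F p m}
    (hpar : a ∈ oPar F p m η) (hdeg : a ∈ oDeg F p m (t + 1)) (ha : TH F p m a ∈ SHO2 F p m)
    {w : Fin m → F} (hw : Exceptional w) (haw : ∀ i, TH F p m (tor F p i) a = -w i • a) :
    a ∈ kerFun φ := by
  obtain ⟨b, hb, -, hab⟩ := hφ.exists_apply_eq h2 hpar hdeg ha
  rw [add_sub_cancel_left] at hb
  obtain ⟨c, rfl⟩ := exists_eq_sum_gen hb
  have hc : ∀ k, c k = 0 := by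
    intro k
    obtain ⟨i, j, hij⟩ := hw (pos k) (ysgn F k) (ysgn_eq k)
    obtain ⟨ht, ht'⟩ := mem_kerFun.1 (htor i j)
    have h1 := hφ.apply_TH_TH (tor_sub_mem_oPar i j) ht ha (a' := 0) (by rw [ht']; simp) hab
    have h3 : (φ ⟨TH F p m (TH F p m (tor F p i - tor F p j) a), TH_TH_mem hX ht ha⟩).1 =
        -(w i - w j) • TH F p m (∑ k, c k • gen F p m k) := by
      rw [← hab, ← Submodule.coe_smul, ← map_smul]
      congr 2
      have e : TH F p m (tor F p i - tor F p j) a = -(w i - w j) • a := by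
        rw [map_sub, LinearMap.sub_apply, haw, haw, ← sub_smul]
        congr 1; ring
      exact Subtype.ext ((congrArg (TH F p m) e).trans (map_smul _ _ _))
    have hs : sgn F θ (1 + 1) = 1 := by
      simp [sgn, show (1 + 1 : ZMod 2) ≠ 1 by decide]
    rw [h3, hs, TH_tor_sub_sum_gen, ← map_smul, Finset.smul_sum, map_zero, LinearMap.zero_apply,
      map_zero, zero_add, one_smul, ← sub_eq_zero, ← map_sub (TH F p m),
      ← Finset.sum_sub_distrib] at h1
    simp only [smul_smul, ← sub_smul] at h1
    have h4 := eq_zero_of_TH_sum_gen h1 k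
    rw [← sub_mul] at h4
    refine (mul_eq_zero.1 h4).resolve_left fun h5 => hij ?_
    linear_combination -h5
  refine mem_kerFun.2 ⟨ha, Subtype.ext ?_⟩
  rw [hab]
  simp [hc]

/-- Clean monomials of degree at most `t + 1` are killed: for `t ≥ 2` they are brackets of functions
of smaller degree or of exceptional weight, and for `t = 1` they are of exceptional weight. -/
theorem IsHomDer.mono_mem_kerFun (hm : 3 < m) (hp3 : 3 < p) (h2 : (2 : F) ≠ 0)
    (hφ : IsHomDer hX θ t φ) (ht : 1 ≤ t)
    (htor : ∀ i j, tor F p i - tor F p j ∈ kerFun φ) {β : Fin m → ℕ} {v : Finset (Fin m)}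
    (h : IsClean p β v) (hd : ∑ i, β i + v.card ≤ t + 1) : mono F p m β v ∈ kerFun φ := by
  have hle : ∀ {β : Fin m → ℕ} {v : Finset (Fin m)}, IsClean p β v → ∑ i, β i + v.card ≤ t →
      mono F p m β v ∈ kerFun φ := fun h hd =>
    hφ.mem_kerFun_of_le h2 (by exact_mod_cast hd) mono_mem_oPar (mono_mem_oDeg rfl)
      (TH_mono_mem_SHO2 hm hp3 h)
  have hex : ∀ {β : Fin m → ℕ} {v : Finset (Fin m)}, IsClean p β v → ∑ i, β i + v.card = t + 1 →
      Exceptional (wt F β v) → mono F p m β v ∈ kerFun φ := fun h hd hw =>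
    hφ.mem_kerFun_of_exceptional h2 htor mono_mem_oPar (mono_mem_oDeg (by exact_mod_cast hd))
      (TH_mono_mem_SHO2 hm hp3 h) hw fun i => TH_tor_mono i _ _
  rcases hd.lt_or_eq with hd | hd
  · exact hle h (by omega)
  rcases (by omega : t = 1 ∨ t = 2 ∨ 3 ≤ t) with ht | ht | ht
  · exact hex h hd (exceptional_wt_of_degree_two F hm hp3 h.eq_zero (by omega))
  · obtain ⟨β₁, v₁, β₂, v₂, h1, h3, h4, c, hc, h5⟩ :=
      exists_TH_eq_of_eq_three F hm hp3 h (by omega)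
    refine (Submodule.smul_mem_iff _ hc).1 (h5 ▸ ?_)
    rcases h4 with ⟨e1, e2, e3⟩ | ⟨e1, e2, e3⟩
    · exact hφ.TH_mem_kerFun (hex h1 (by omega) e3) mono_mem_oPar (hle h3 (by omega))
    · exact hφ.TH_mem_kerFun (hle h1 (by omega)) mono_mem_oPar (hex h3 (by omega) e3)
  · obtain ⟨β₁, v₁, β₂, v₂, h1, h3, e1, e2, c, hc, h5⟩ :=
      exists_TH_eq_of_four_le F hm h (by omega)
    exact (Submodule.smul_mem_iff _ hc).1
      (h5 ▸ hφ.TH_mem_kerFun (hle h1 (by omega)) mono_mem_oPar (hle h3 (by omega)))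

end

/-! ### Vanishing of superderivations -/

theorem pd_mono_eq_zero_or (r : Y m) {α : Fin m → ℕ} (u : Finset (Fin m)) (hα : ∀ i, α i < p) :
    pd F p m r (mono F p m α u) = 0 ∨ ∃ (α' : Fin m → ℕ) (u' : Finset (Fin m)) (c : F), c ≠ 0 ∧
      (∀ i, α' i < p) ∧ ∑ i, α' i + u'.card + 1 = ∑ i, α i + u.card ∧
      pd F p m r (mono F p m α u) = c • mono F p m α' u' := by
  rcases r with r | r
  · by_cases h : α r = 0
    · exact Or.inl (pd_inl_mono_zero h u)
    · obtain ⟨β, rfl⟩ := exists_eq_add_eps h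
      refine Or.inr ⟨β, u, 1, one_ne_zero, fun i => ?_, ?_, ?_⟩
      · have := hα i; simp at this; omega
      · rw [sum_add_eps]; ring
      · rw [pd_inl_mono_add hα, one_smul]
  · by_cases h : r ∈ u
    · refine Or.inr ⟨α, u.erase r, (-1) ^ (u.filter fun k => k < r).card, by simp, hα, ?_, ?_⟩
      · rw [← Finset.card_erase_add_one h]; ring
      · rw [pd_inr_mono, if_pos h]
    · exact Or.inl (by rw [pd_inr_mono, if_neg h])

theorem pd_lap (r : Y m) : ∃ c : F, c ≠ 0 ∧ ∀ f, pd F p m r (Δ f) = c • Δ (pd F p m r f) := by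
  rcases r with r | r
  · exact ⟨1, one_ne_zero, fun f => by rw [pd_inl_lap, one_smul]⟩
  · exact ⟨-1, by simp, fun f => by rw [pd_inr_lap]; simp⟩

theorem lap_mem_oDeg {n : ℤ} {f : O F p m} (hf : f ∈ oDeg F p m n) : Δ f ∈ oDeg F p m (n - 2) := by
  rw [lap_apply]
  refine Submodule.sum_mem _ fun i _ => ?_
  have := pd_mem_oDeg (pd_mem_oDeg hf (Sum.inr i)) (Sum.inl i)
  rwa [sub_sub] at this

theorem lap_mem_oPar {η : ZMod 2} {f : O F p m} (hf : f ∈ oPar F p m η) :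
    Δ f ∈ oPar F p m (η + 1) := by
  rw [lap_apply]
  exact Submodule.sum_mem _ fun i _ => pd_inl_mem_oPar (pd_inr_mem_oPar hf i) i

section

variable [CharP F p] [hp : Fact p.Prime] {hX : IsSubalg F p m (SHO2 F p m)}
  {θ : ZMod 2} {t : ℕ} {φ : SHO2 F p m →ₗ[F] SHO2 F p m}

theorem TH_pd_mem (hm : 3 < m) (hp3 : 3 < p) (hX : IsSubalg F p m (SHO2 F p m)) {a : O F p m}
    (ha : TH F p m a ∈ SHO2 F p m) (r : Y m) : TH F p m (pd F p m r a) ∈ SHO2 F p m := by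
  rcases r with r | r
  · have := TH_TH_mem hX (TH_gen_mem_SHO2 hm hp3 (Sum.inr r)) ha
    rw [TH_of_gen_inr, LinearMap.smul_apply, map_smul] at this
    exact (Submodule.smul_mem_iff _ (by simp)).1 this
  · have := TH_TH_mem hX (TH_gen_mem_SHO2 hm hp3 (Sum.inl r)) ha
    rwa [TH_of_gen_inl] at this

/-- The argument is by induction on the degree: in degree `t + 1` the clean monomials generate
everything but the element of highest degree, and above it transitivity applies. -/
theorem IsHomDer.lap_mono_mem_kerFun (hm : 3 < m) (hp3 : 3 < p) (h2 : (2 : F) ≠ 0)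
    (hφ : IsHomDer hX θ t φ) (ht : 1 ≤ t)
    (htor : ∀ i j, tor F p i - tor F p j ∈ kerFun φ) (n : ℕ) :
    ∀ (α : Fin m → ℕ) (u : Finset (Fin m)), (∀ i, α i < p) → ∑ i, α i + u.card = n + 2 →
      TH F p m (Δ (mono F p m α u)) ∈ SHO2 F p m → Δ (mono F p m α u) ∈ kerFun φ := by
  induction n with
  | zero =>
    intro α u hα hd h
    refine hφ.mem_kerFun_of_le h2 (n := 0) (by omega) (lap_mem_oPar mono_mem_oPar) ?_ h
    exact lap_mem_oDeg (n := 2) (mono_mem_oDeg (by exact_mod_cast hd))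
  | succ n ih =>
    intro α u hα hd h
    have hpar := lap_mem_oPar (mono_mem_oPar (F := F) (p := p) (α := α) (u := u))
    have hdeg : Δ (mono F p m α u) ∈ oDeg F p m (n + 1 : ℕ) := by
      have := lap_mem_oDeg (mono_mem_oDeg (F := F) (p := p) (α := α) (u := u)
        (n := ((n + 1 : ℕ) : ℤ) + 2) (by exact_mod_cast hd))
      rwa [add_sub_cancel_right] at this
    rcases lt_trichotomy (n + 1) (t + 1) with hn | hn | hn
    · exact hφ.mem_kerFun_of_le h2 (by omega) hpar hdeg h
    · by_cases htop : u = Finset.univ ∧ ∀ i, α i = p - 1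
      · -- the torus acts trivially on the element of highest degree
        refine hφ.mem_kerFun_of_exceptional h2 htor hpar (by rw [hn] at hdeg; exact_mod_cast hdeg) h
          (w := wt F α u) ?_ fun i => TH_tor_lap_mono i u hα
        intro k s hs
        have : Nontrivial (Fin m) := Fin.nontrivial_iff_two_le.2 (by omega)
        obtain ⟨i, hi⟩ := exists_ne k
        refine ⟨k, i, ?_⟩
        rw [wt, wt, htop.1, htop.2, htop.2]
        rcases hs with rfl | rfl <;> simp [hi]
      · exact lap_mono_mem hp3 hm (fun η a ha hη b hb => hφ.TH_mem_kerFun ha hη hb)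
          (fun β v hβ hd => hφ.mono_mem_kerFun hm hp3 h2 ht htor hβ hd) hα (by omega) htop
    · refine hφ.mem_kerFun_of_pd h2 hm hp3 ht (n := (n + 1 : ℕ)) (by exact_mod_cast hn) hpar hdeg h
        fun r => ?_
      have hr := TH_pd_mem hm hp3 hX h r
      obtain ⟨c, hc, hpd⟩ := pd_lap (F := F) (p := p) r
      rw [hpd] at hr ⊢
      rcases pd_mono_eq_zero_or (F := F) r u hα with h0 | ⟨α', u', d, hd0, hα', hd', h0⟩
      · rw [h0]; simp
      · rw [h0, map_smul (lap F p m), smul_smul] at hr ⊢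
        refine Submodule.smul_mem _ _ (ih α' u' hα' (by omega) ?_)
        rw [map_smul] at hr
        exact (Submodule.smul_mem_iff _ (mul_ne_zero hc hd0)).1 hr

/-- A homogeneous superderivation of negative degree that vanishes on the torus is zero. -/
theorem IsHomDer.eq_zero (hm : 3 < m) (hp3 : 3 < p) (h2 : (2 : F) ≠ 0)
    (hφ : IsHomDer hX θ t φ) (ht : 1 ≤ t)
    (htor : ∀ i j, tor F p i - tor F p j ∈ kerFun φ) : φ = 0 := by
  have hmono : ∀ a : Idx p m, TH F p m (Δ (Finsupp.single a 1)) ∈ SHO2 F p m →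
      Δ (Finsupp.single a 1) ∈ kerFun φ := by
    intro a h
    rw [← mono_val a] at h ⊢
    by_cases hd : 2 ≤ ∑ i, (a.1 i : ℕ) + a.2.card
    · obtain ⟨n, hn⟩ := Nat.exists_eq_add_of_le' hd
      exact hφ.lap_mono_mem_kerFun hm hp3 h2 ht htor n _ _ (fun i => (a.1 i).2) hn h
    · refine hφ.mem_kerFun_of_le h2 (n := ((∑ i, (a.1 i : ℕ) + a.2.card : ℕ) : ℤ) - 2)
        (by omega) (lap_mem_oPar mono_mem_oPar) (lap_mem_oDeg (mono_mem_oDeg rfl)) h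
  have hp0 := hp.out.pos
  set T : Idx p m := (fun _ => ⟨p - 1, by omega⟩, Finset.univ) with hT
  have hsingle : ∀ a : Idx p m, a ≠ T → Δ (Finsupp.single a 1) ∈ kerFun φ := by
    intro a ha
    refine hmono a ?_
    rw [← mono_val a]
    refine TH_lap_mono_mem_SHO2 hm hp3 (fun i => (a.1 i).2) fun h => ha ?_
    exact Prod.ext (funext fun i => Fin.ext (h.2 i)) h.1
  -- whether `Δ` of the monomial `T` of highest degree belongs to the algebra does not matter: if it
  -- does not, then no element has a component along it
  refine LinearMap.ext fun D => ?_
  obtain ⟨_, ⟨f, rfl⟩, hf⟩ := SHO2_le h2 D.2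
  have hrest : Δ (f.erase T) ∈ kerFun φ := by
    rw [← Finsupp.sum_single (f.erase T), Finsupp.sum, map_sum]
    refine Submodule.sum_mem _ fun a ha => ?_
    rw [← mul_one (f.erase T a), ← smul_eq_mul, ← Finsupp.smul_single, map_smul]
    refine Submodule.smul_mem _ _ (hsingle a ?_)
    rintro rfl
    simp at ha
  have hsum : Δ f = f T • Δ (Finsupp.single T 1) + Δ (f.erase T) := by
    rw [← map_smul, ← map_add, Finsupp.smul_single, smul_eq_mul, mul_one,
      Finsupp.single_add_erase]
  have hmem : Δ f ∈ kerFun φ := by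
    rw [hsum]
    refine Submodule.add_mem _ ?_ hrest
    by_cases h0 : f T = 0
    · rw [h0, zero_smul]; exact Submodule.zero_mem _
    · refine Submodule.smul_mem _ _ (hmono T ((Submodule.smul_mem_iff _ h0).1 ?_))
      have h1 : Δ f ∈ (SHO2 F p m).comap (TH F p m) := by
        rw [Submodule.mem_comap, hf]; exact D.2
      have h3 : Δ (f.erase T) ∈ (SHO2 F p m).comap (TH F p m) := (mem_kerFun.1 hrest).1
      rw [hsum, Submodule.add_mem_iff_left _ h3] at h1
      rw [← map_smul]
      exact h1
  obtain ⟨h1, h3⟩ := mem_kerFun.1 hmem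
  rw [LinearMap.zero_apply, ← h3]
  congr 1
  exact Subtype.ext hf.symm

/-! ### Inner superderivations of negative degree -/

/-- The super Jacobi identity. -/
theorem superBracket_TH_superBracket (hchar : (2 : F) ≠ 0) {a : O F p m}
    (ha : TH F p m a ∈ endPar F p m θ) {η : ZMod 2} {D E : End F (O F p m)}
    (hD : D ∈ SHO2 F p m) (hE : E ∈ SHO2 F p m) (hpar : D ∈ endPar F p m η) :
    superBracket F p m (TH F p m a) (superBracket F p m D E) =
      superBracket F p m (superBracket F p m (TH F p m a) D) E +
      sgn F θ η • superBracket F p m D (superBracket F p m (TH F p m a) E) := by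
  obtain ⟨b, rfl, -, -⟩ := exists_TH_eq_of_mem_SHO2 hchar ⟨D, hD⟩
  obtain ⟨c, rfl, -, -⟩ := exists_TH_eq_of_mem_SHO2 hchar ⟨E, hE⟩
  have h3 := LinearMap.congr_fun (superBracket_apply ha hpar) c
  rw [superBracket_TH] at h3
  rw [superBracket_TH, superBracket_TH, superBracket_TH, superBracket_TH, superBracket_TH,
    superBracket_TH, ← map_smul, ← map_add, h3]
  congr 1
  exact (sub_add_cancel _ _).symm

theorem adOn_mem_derPar (hchar : (2 : F) ≠ 0) {a : O F p m} (ha : a ∈ oPar F p m (θ + 1))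
    (hmem : TH F p m a ∈ SHO2 F p m) : adOn hX ⟨TH F p m a, hmem⟩ ∈ derPar hX θ := by
  have h2 : ∀ x : ZMod 2, x + 1 + 1 = x := by decide
  have ha' : TH F p m a ∈ endPar F p m θ := by
    have := TH_mem_endPar ha; rwa [h2] at this
  refine ⟨fun η D hD x f hf => ?_, fun η D E hD => Subtype.ext ?_⟩
  · have h1 : (adOn hX ⟨TH F p m a, hmem⟩ D).1 = superBracket F p m (TH F p m a) D.1 := rfl
    rw [h1, superBracket_apply ha' hD]
    refine Submodule.sub_mem _ ?_ (Submodule.smul_mem _ _ ?_)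
    · have := ha' _ _ (hD _ _ hf)
      rwa [add_assoc] at this
    · have := hD _ _ (ha' _ _ hf)
      rwa [add_assoc, add_comm θ] at this
  · have hval : ∀ A B : SHO2 F p m, (adOn hX A B).1 = superBracket F p m A.1 B.1 := fun _ _ => rfl
    rw [Submodule.coe_add, Submodule.coe_smul, hval, hval, hval, hval, hval, hval]
    rw [superBracket_TH_superBracket hchar ha' D.2 E.2 hD]

/-- Every function of degree `1` gives a combination of the `ad ∂_r`. -/
theorem adOn_mem_span (hm : 3 < m) (hp3 : 3 < p) (c : Y m → F)
    (hmem : TH F p m (∑ k, c k • gen F p m k) ∈ SHO2 F p m) :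
    adOn hX ⟨TH F p m (∑ k, c k • gen F p m k), hmem⟩ ∈ Submodule.span F
      (Set.range fun i : Y m => adOn hX ⟨pd F p m i, pd_mem_SHO2 hm hp3 i⟩) := by
  have : adOn hX ⟨TH F p m (∑ k, c k • gen F p m k), hmem⟩ =
      ∑ i, c (Sum.inl i) • adOn hX ⟨pd F p m (Sum.inr i), pd_mem_SHO2 hm hp3 _⟩ +
      ∑ i, (-c (Sum.inr i)) • adOn hX ⟨pd F p m (Sum.inl i), pd_mem_SHO2 hm hp3 _⟩ := by
    refine LinearMap.ext fun D => Subtype.ext ?_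
    have h1 : (adOn hX ⟨TH F p m (∑ k, c k • gen F p m k), hmem⟩ D).1 =
        superBracket F p m (TH F p m (∑ k, c k • gen F p m k)) D.1 := rfl
    have h2 : ∀ i, (adOn hX ⟨pd F p m i, pd_mem_SHO2 hm hp3 i⟩ D).1 =
        superBracket F p m (pd F p m i) D.1 := fun _ => rfl
    rw [h1, Fintype.sum_sum_type]
    simp only [map_add, map_sum, map_smul, LinearMap.add_apply, LinearMap.sum_apply,
      LinearMap.smul_apply, Submodule.coe_add, Submodule.coe_sum, Submodule.coe_smul, h2,
      TH_of_gen_inl, TH_of_gen_inr, smul_smul, mul_neg, mul_one]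
  rw [this]
  exact Submodule.add_mem _
    (Submodule.sum_mem _ fun i _ => Submodule.smul_mem _ _ (Submodule.subset_span ⟨_, rfl⟩))
    (Submodule.sum_mem _ fun i _ => Submodule.smul_mem _ _ (Submodule.subset_span ⟨_, rfl⟩))

theorem TH_sum_gen_mem_SHO2 (hm : 3 < m) (hp3 : 3 < p) (c : Y m → F) :
    TH F p m (∑ k, c k • gen F p m k) ∈ SHO2 F p m := by
  rw [map_sum]
  refine Submodule.sum_mem _ fun k _ => ?_
  rw [map_smul]
  exact Submodule.smul_mem _ _ (TH_gen_mem_SHO2 hm hp3 k)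

omit [CharP F p] in
theorem TH_sum_gen_mem_oDeg (c : Y m → F) {n : ℤ} {b : O F p m} (hb : b ∈ oDeg F p m n) :
    TH F p m (∑ k, c k • gen F p m k) b ∈ oDeg F p m (n - 1) := by
  rw [map_sum, LinearMap.sum_apply]
  refine Submodule.sum_mem _ fun k _ => ?_
  rw [map_smul]
  exact Submodule.smul_mem _ _ (TH_gen_mem_oDeg hb k)

theorem adOn_mem_wDeg (hchar : (2 : F) ≠ 0) (c : Y m → F)
    (hmem : TH F p m (∑ k, c k • gen F p m k) ∈ SHO2 F p m) {s : ℤ} {D : SHO2 F p m}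
    (hD : D.1 ∈ wDeg F p m s) :
    (adOn hX ⟨TH F p m (∑ k, c k • gen F p m k), hmem⟩ D).1 ∈ wDeg F p m (s - 1) := by
  obtain ⟨b, hb, hdeg, -⟩ := exists_TH_eq_of_mem_SHO2 hchar D
  have h1 : (adOn hX ⟨TH F p m (∑ k, c k • gen F p m k), hmem⟩ D).1 =
      superBracket F p m (TH F p m (∑ k, c k • gen F p m k)) D.1 := rfl
  rw [h1, ← hb, superBracket_TH]
  have := TH_mem_wDeg (TH_sum_gen_mem_oDeg c (hdeg (s + 2) (by rwa [add_sub_cancel_right])))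
  rwa [show s + 2 - 1 - 2 = s - 1 by ring] at this

theorem adOn_mem_derDeg (hchar : (2 : F) ≠ 0) (c : Y m → F)
    (hmem : TH F p m (∑ k, c k • gen F p m k) ∈ SHO2 F p m)
    (hpar : ∑ k, c k • gen F p m k ∈ oPar F p m (θ + 1)) :
    adOn hX ⟨TH F p m (∑ k, c k • gen F p m k), hmem⟩ ∈ derDeg hX (-1) := by
  refine ⟨?_, fun s D hD => adOn_mem_wDeg hchar c hmem hD⟩
  have h := adOn_mem_derPar (hX := hX) hchar hpar hmem
  have h2 : ∀ x : ZMod 2, x = 0 ∨ x = 1 := by decide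
  rcases h2 θ with rfl | rfl
  · exact Submodule.mem_sup_left h
  · exact Submodule.mem_sup_right h

theorem adOn_pd_mem_negDer (hchar : (2 : F) ≠ 0) (r : Y m) (hr : pd F p m r ∈ SHO2 F p m) :
    adOn hX ⟨pd F p m r, hr⟩ ∈ negDer hX := by
  have h : ∀ (k : Y m) (d : F) (θ : ZMod 2), ((mu k : ℕ) : ZMod 2) = θ + 1 →
      d • TH F p m (gen F p m k) = pd F p m r → adOn hX ⟨pd F p m r, hr⟩ ∈ negDer hX := by
    intro k d θ hθ hk
    have hsum : ∑ l, (Pi.single k d : Y m → F) l • gen F p m l = d • gen F p m k := by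
      rw [Finset.sum_eq_single k (fun l _ hl => by rw [Pi.single_eq_of_ne hl, zero_smul])
        (by simp), Pi.single_eq_same]
    have heq : TH F p m (∑ l, (Pi.single k d : Y m → F) l • gen F p m l) = pd F p m r := by
      rw [hsum, map_smul, hk]
    have hmem : TH F p m (∑ l, (Pi.single k d : Y m → F) l • gen F p m l) ∈ SHO2 F p m := by
      rwa [heq]
    have hsub : (⟨pd F p m r, hr⟩ : SHO2 F p m) = ⟨_, hmem⟩ := Subtype.ext heq.symm
    rw [hsub]
    refine Submodule.subset_span ⟨-1, by omega, adOn_mem_derDeg (θ := θ) hchar _ hmem ?_⟩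
    rw [hsum, ← hθ]
    exact Submodule.smul_mem _ _ (gen_mem_oPar k)
  rcases r with i | i
  · exact h (Sum.inr i) (-1) 0 (by simp [mu]) (by
      rw [TH_of_gen_inr, smul_smul, neg_mul_neg, one_mul, one_smul])
  · exact h (Sum.inl i) 1 1 (by rw [mu, Sum.elim_inl]; decide)
      (by rw [TH_of_gen_inl, one_smul])

/-- A superderivation of degree `-1` agrees on the torus with an inner one. -/
theorem IsHomDer.exists_eq_on_torus (hm : 3 < m) (hchar : (2 : F) ≠ 0)
    (hp3 : 3 < p) (hφ : IsHomDer hX θ 1 φ) :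
    ∃ e : Y m → F, ∑ k, e k • gen F p m k ∈ oPar F p m (θ + 1) ∧ ∀ i j,
      (φ ⟨TH F p m (tor F p i - tor F p j), TH_tor_sub_mem_SHO2 hm hp3 i j⟩).1 =
        TH F p m (TH F p m (tor F p i - tor F p j) (∑ k, e k • gen F p m k)) := by
  have hdeg : ∀ i j, tor F p i - tor F p j ∈ oDeg F p m 2 := fun i j =>
    Submodule.sub_mem _ (tor_mem_oDeg i) (tor_mem_oDeg j)
  have hex : ∀ i j, ∃ c : Y m → F, (∀ k, ((mu k : ℕ) : ZMod 2) ≠ 1 + θ → c k = 0) ∧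
      (φ ⟨TH F p m (tor F p i - tor F p j), TH_tor_sub_mem_SHO2 hm hp3 i j⟩).1 =
        TH F p m (∑ k, c k • gen F p m k) := by
    intro i j
    obtain ⟨b, hb, hb', h⟩ := hφ.exists_apply_eq hchar (tor_sub_mem_oPar i j) (hdeg i j)
      (TH_tor_sub_mem_SHO2 hm hp3 i j)
    obtain ⟨c, rfl, hc⟩ := exists_eq_sum_gen_of_mem_oPar hb hb'
    exact ⟨c, hc, h⟩
  choose c hc0 hc using hex
  -- the scalar by which the torus acts on the variables
  set χ : Fin m → Fin m → Y m → F := fun i j k =>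
    -(ysgn F k * ((if i = pos k then 1 else 0) - if j = pos k then 1 else 0)) with hχ
  have htor0 : ∀ i j i' j', TH F p m (tor F p i - tor F p j) (tor F p i' - tor F p j') = 0 := by
    have : ∀ i j, TH F p m (tor F p i) (tor F p j) = 0 := fun i j => by
      rw [tor, tor, ← tor, TH_tor_mono]
      simp [wt, eps_apply]
    intro i j i' j'
    simp [this]
  -- applying `φ` to the vanishing bracket of two elements of the torus shows that
  -- `c i j k / χ i j k` does not depend on `i` and `j`
  have hcoc : ∀ i j i' j' k, χ i' j' k * c i j k = χ i j k * c i' j' k := by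
    intro i j i' j' k
    have h := hφ.apply_TH_TH (tor_sub_mem_oPar i j) (TH_tor_sub_mem_SHO2 hm hp3 i j)
      (TH_tor_sub_mem_SHO2 hm hp3 i' j') (hc i j) (hc i' j')
    have hz : (⟨TH F p m (TH F p m (tor F p i - tor F p j) (tor F p i' - tor F p j')),
        TH_TH_mem hX (TH_tor_sub_mem_SHO2 hm hp3 i j) (TH_tor_sub_mem_SHO2 hm hp3 i' j')⟩ :
        SHO2 F p m) = 0 := 
      Subtype.ext ((congrArg (TH F p m) (htor0 i j i' j')).trans (map_zero _))
    have hs : sgn F θ (1 + 1) = 1 := by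
      simp [sgn, show (1 + 1 : ZMod 2) ≠ 1 by decide]
    have hswap : TH F p m (∑ k, c i j k • gen F p m k) (tor F p i' - tor F p j') =
        -TH F p m (tor F p i' - tor F p j') (∑ k, c i j k • gen F p m k) := by
      rw [TH_comm_of_mem_one (tor_sub_mem_oPar i' j'), neg_neg]
    rw [hz, map_zero, hs, one_smul, hswap, ← map_add, TH_tor_sub_sum_gen, TH_tor_sub_sum_gen,
      neg_add_eq_sub, ← Finset.sum_sub_distrib] at h
    simp only [← sub_smul] at h
    have := eq_zero_of_TH_sum_gen h.symm k
    linear_combination -this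
  have : Nontrivial (Fin m) := Fin.nontrivial_iff_two_le.2 (by omega)
  -- a place where `χ` is invertible
  choose q hq using fun k : Y m => exists_ne (pos k)
  have hχq : ∀ k, χ (pos k) (q k) k = -ysgn F k := fun k => by simp [hχ, hq k]
  have hsq : ∀ k : Y m, ysgn F k * ysgn F k = 1 := fun k => by
    rcases ysgn_eq (F := F) k with h | h <;> simp [h]
  refine ⟨fun k => -ysgn F k * c (pos k) (q k) k, ?_, fun i j => ?_⟩
  · refine Submodule.sum_mem _ fun k _ => ?_
    by_cases hk : ((mu k : ℕ) : ZMod 2) = 1 + θ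
    · refine Submodule.smul_mem _ _ ?_
      rw [add_comm, ← hk]; exact gen_mem_oPar k
    · have := hc0 (pos k) (q k) k hk
      simp [this]
  · rw [hc, TH_tor_sub_sum_gen]
    congr 1
    refine Finset.sum_congr rfl fun k _ => ?_
    congr 1
    have h1 := hcoc i j (pos k) (q k) k
    rw [hχq] at h1
    have h3 := hsq k
    simp only [hχ] at h1
    linear_combination (-c i j k) * h3 - ysgn F k * h1

/-- For `t = 1` an inner superderivation is subtracted first, to kill the torus; for `t ≥ 2` the
torus, which has degree `0`, is killed anyway. -/
theorem IsHomDer.mem_span (hm : 3 < m) (hp3 : 3 < p) (hchar : (2 : F) ≠ 0)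
    (hφ : IsHomDer hX θ t φ) (ht : 1 ≤ t) :
    φ ∈ Submodule.span F
      (Set.range fun i : Y m => adOn hX ⟨pd F p m i, pd_mem_SHO2 hm hp3 i⟩) := by
  rcases ht.eq_or_lt with rfl | ht'
  · obtain ⟨e, he, h⟩ := hφ.exists_eq_on_torus hm hchar hp3
    have hmem := TH_sum_gen_mem_SHO2 hm hp3 e
    have hder : IsHomDer hX θ 1 (φ + adOn hX ⟨TH F p m (∑ k, e k • gen F p m k), hmem⟩) := by
      refine ⟨Submodule.add_mem _ hφ.mem (adOn_mem_derPar hchar he hmem), fun η s D h1 h3 k => ?_⟩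
      refine Submodule.add_mem _ (hφ.deg η s D h1 h3 k) ?_
      have := apply_gen_mem_oDeg (adOn_mem_wDeg (hX := hX) hchar e hmem h3) k
      exact_mod_cast this
    have h0 := hder.eq_zero hm hp3 hchar le_rfl fun i j => by
      refine mem_kerFun.2 ⟨TH_tor_sub_mem_SHO2 hm hp3 i j, Subtype.ext ?_⟩
      rw [LinearMap.add_apply, adOn_TH, Submodule.coe_add, h,
        TH_comm_of_mem_one (tor_sub_mem_oPar i j)]
      simp
    have h4 : φ = (-1 : F) • adOn hX ⟨TH F p m (∑ k, e k • gen F p m k), hmem⟩ := by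
      refine LinearMap.ext fun D => ?_
      have h5 := LinearMap.congr_fun h0 D
      rw [LinearMap.add_apply, LinearMap.zero_apply] at h5
      refine Subtype.ext ((eq_neg_of_add_eq_zero_left (congrArg Subtype.val h5)).trans ?_)
      exact (neg_one_smul F _).symm
    rw [h4]
    exact Submodule.smul_mem _ _ (adOn_mem_span hm hp3 e hmem)
  · rw [hφ.eq_zero hm hp3 hchar ht fun i j => hφ.mem_kerFun_of_le hchar (n := 2)
      (by exact_mod_cast ht') (tor_sub_mem_oPar i j)
      (Submodule.sub_mem _ (tor_mem_oDeg i) (tor_mem_oDeg j)) (TH_tor_sub_mem_SHO2 hm hp3 i j)]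
    exact Submodule.zero_mem _

omit [CharP F p] in
/-- The even and the odd part of a superderivation of degree `-t` have degree `-t`. -/
theorem isHomDer_of_add {θ θ' : ZMod 2} (hθ : θ ≠ θ') {φ ψ : SHO2 F p m →ₗ[F] SHO2 F p m}
    (hφ : φ ∈ derPar hX θ) (hψ : ψ ∈ derPar hX θ')
    (h : ∀ s : ℤ, ∀ D : SHO2 F p m, D.1 ∈ wDeg F p m s → ((φ + ψ) D).1 ∈ wDeg F p m (s + -t)) :
    IsHomDer hX θ t φ := by
  refine ⟨hφ, fun η s D h1 h3 k => ?_⟩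
  have h4 := apply_gen_mem_oDeg (h s D h3) k
  rw [LinearMap.add_apply, Submodule.coe_add, LinearMap.add_apply, ← sub_eq_add_neg] at h4
  exact mem_oDeg_of_add_mem (by simpa using hθ) (hφ.1 η D h1 _ _ (gen_mem_oPar k))
    (hψ.1 η D h1 _ _ (gen_mem_oPar k)) h4

end

end SHOAlg

end

theorem theorem2p9 {F : Type*} [Field F] (p m : ℕ) [CharP F p] (hp : 3 < p) (hm : 3 < m) :
    ∃ (hX : SHOAlg.IsSubalg F p m (SHOAlg.SHO2 F p m))
      (hd : ∀ i : SHOAlg.Y m, SHOAlg.pd F p m i ∈ SHOAlg.SHO2 F p m),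
      SHOAlg.negDer hX =
        Submodule.span F (Set.range fun i : SHOAlg.Y m =>
          SHOAlg.adOn hX ⟨SHOAlg.pd F p m i, hd i⟩) := by
  have hprime : Fact p.Prime :=
    ⟨(CharP.char_is_prime_or_zero F p).resolve_right (by omega)⟩
  have h2 : (2 : F) ≠ 0 := by
    exact_mod_cast SHOAlg.natCast_ne_zero F p (n := 2) (by omega) (by omega)
  refine ⟨SHOAlg.isSubalg_SHO2 h2, SHOAlg.pd_mem_SHO2 hm hp, le_antisymm ?_ ?_⟩
  · refine Submodule.span_le.2 ?_
    rintro φ ⟨i, hi, hφ, hdeg⟩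
    obtain ⟨φ₀, h0, φ₁, h1, rfl⟩ := Submodule.mem_sup.1 hφ
    obtain ⟨t, rfl⟩ : ∃ t : ℕ, i = -t := ⟨i.natAbs, by omega⟩
    exact Submodule.add_mem _
      ((SHOAlg.isHomDer_of_add zero_ne_one h0 h1 hdeg).mem_span hm hp h2 (by omega))
      ((SHOAlg.isHomDer_of_add one_ne_zero h1 h0 (by rwa [add_comm φ₁ φ₀])).mem_span hm hp h2
        (by omega))
  · refine Submodule.span_le.2 ?_
    rintro _ ⟨k, rfl⟩
    exact SHOAlg.adOn_pd_mem_negDer h2 k _
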